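/- Let $H^2$ be the upper half-plane model of the hyperbolic plane, with ideal boundary $\mathbb{R}\cup\{\infty\}$. Let $G\subset \mathrm{PSL}_2(\mathbb{Z})$ be the group of isometries generated by (the classes of) $$A=\begin{pmatrix}1&-1\\-1&2\end{pmatrix},\qquad B=\begin{pmatrix}1&1\\1&2\end{pmatrix},$$ let $M=H^2/G$ be the modular torus, and let $\pi:H^2\to M$ be the canonical projection. The cusps of $G$ are the ideal points fixed by a parabolic element of $G$; they project to the single cusp (ideal point) of $M$. A triple $(x_1,x_2,x_3)$ of real numbers is a *rational Markov triple* if $x_k=p_k/q_k$ for some positive integers $q_1,q_2,q_3$ with $q_1^2+q_2^2+q_3^2=3q_1q_2q_3$ and some integers $p_1,p_2,p_3$ with $p_2q_1-p_1q_2=q_3$ and $p_3q_2-p_2q_3=q_1$. An *ideal triangle* or *ideal quadrilateral* is the closed convex hull in $H^2$ of three or four distinct ideal points, its vertices. A closed set $D\subset H^2$ is a *fundamental domain* of $M$ if $\pi(D)=M$ and $\pi$ is injective on the interior of $D$. An *ideal triangulation* of $M$ is a decomposition of $M$ into the disjoint union of finitely many edges and finitely many triangles, where each edge is $\pi(g)$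 for a complete geodesic $g$ in $H^2$ whose two ends are cusps of $G$ and on which $\pi$ is injective, and each triangle is the image under $\pi$ of the interior of an ideal triangle on whose interior $\pi$ is injective and whose three sides project to edges. **Lemma.** For real numbers $x_1<x_2<x_3$, the following statements are equivalent: (i) $(x_1,x_2,x_3)$ is a rational Markov triple. (ii) The ideal quadrilateral with vertices $x_1,x_2,x_3,\infty$ is a fundamental domain of the modular torus $M$. (iii) There is an ideal triangulation of $M$ such that the interiors of the ideal triangles with vertices $x_1,x_2,\infty$ and $x_2,x_3,\infty$ project under $\pi$ to two distinct triangles, and these two are all the triangles of the triangulation. -/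

import Mathlib

open scoped UpperHalfPlane MatrixGroups

/-! ### Markov triples -/

/-- A Markov triple: a positive integer solution of Markov's equation. -/
def IsMarkovTriple (q₁ q₂ q₃ : ℤ) : Prop :=
  0 < q₁ ∧ 0 < q₂ ∧ 0 < q₃ ∧ q₁ ^ 2 + q₂ ^ 2 + q₃ ^ 2 = 3 * q₁ * q₂ * q₃

/-- A triple of real numbers is a rational Markov triple if `xₖ = pₖ / qₖ` for a Markov triple
`(q₁, q₂, q₃)` and integers `p₁, p₂, p₃` with `p₂ q₁ - p₁ q₂ = q₃` and `p₃ q₂ - p₂ q₃ = q₁`. -/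
def IsRationalMarkovTriple (x₁ x₂ x₃ : ℝ) : Prop :=
  ∃ p₁ p₂ p₃ q₁ q₂ q₃ : ℤ,
    IsMarkovTriple q₁ q₂ q₃ ∧
    p₂ * q₁ - p₁ * q₂ = q₃ ∧
    p₃ * q₂ - p₂ * q₃ = q₁ ∧
    x₁ = (p₁ : ℝ) / (q₁ : ℝ) ∧ x₂ = (p₂ : ℝ) / (q₂ : ℝ) ∧ x₃ = (p₃ : ℝ) / (q₃ : ℝ)

/-! ### Ideal polygons in the hyperbolic plane

The hyperbolic plane is the upper half-plane `ℍ`, its ideal boundary is `OnePoint ℝ`, and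
`GL (Fin 2) ℝ` acts on both by Moebius transformations (composed with a reflection of `ℍ` if the
determinant is negative). -/

/-- The convex hull in `ℍ` of a set of ideal points: the intersection of all closed half-planes
that have these points on their ideal boundary. The closed half-planes are the preimages under
`g : GL (Fin 2) ℝ` of the half-plane `{z | 0 ≤ Re z}`, whose ideal boundary is `[0, ∞]`. -/
def idealHull (S : Set (OnePoint ℝ)) : Set ℍ :=
  {z | ∀ g : GL (Fin 2) ℝ,
    (∀ s ∈ S, g • s = OnePoint.infty ∨ ∃ t : ℝ, 0 ≤ t ∧ g • s = (t : OnePoint ℝ)) →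
      0 ≤ (g • z).re}

/-- The (complete) geodesic with ideal endpoints `a` and `b`. -/
def idealGeodesic (a b : OnePoint ℝ) : Set ℍ := idealHull {a, b}

/-- The (closed) ideal triangle with vertices `a`, `b`, `c`. -/
def idealTriangle (a b c : OnePoint ℝ) : Set ℍ := idealHull {a, b, c}

/-- The (closed) ideal quadrilateral with vertices `a`, `b`, `c`, `d`. -/
def idealQuadrilateral (a b c d : OnePoint ℝ) : Set ℍ := idealHull {a, b, c, d}

/-! ### The modular torus -/

/-- The matrix `A` representing the first generator. -/
def torusGenA : SL(2, ℤ) := ⟨!![1, -1; -1, 2], by norm_num [Matrix.det_fin_two_of]⟩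

/-- The matrix `B` representing the second generator. -/
def torusGenB : SL(2, ℤ) := ⟨!![1, 1; 1, 2], by norm_num [Matrix.det_fin_two_of]⟩

/-- The group generated by `A` and `B`. It is written as a subgroup of `SL(2, ℤ)` instead of
`PSL(2, ℤ)`; this has the same orbits in `ℍ` because `-1` acts trivially. -/
def modularTorusGroup : Subgroup SL(2, ℤ) := Subgroup.closure {torusGenA, torusGenB}

/-- The modular torus: the orbit space of `modularTorusGroup` acting on `ℍ`. -/
abbrev ModularTorus : Type := MulAction.orbitRel.Quotient modularTorusGroup ℍ

/-- The canonical projection from `ℍ` to the modular torus. -/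
noncomputable def torusProj (z : ℍ) : ModularTorus :=
  Quotient.mk (MulAction.orbitRel modularTorusGroup ℍ) z

/-- The ideal points that project to the cusp (ideal point) of the modular torus: the fixed points
of parabolic elements of the group. -/
def IsTorusCusp (c : OnePoint ℝ) : Prop :=
  IsCusp c (modularTorusGroup.map (Matrix.SpecialLinearGroup.mapGL ℝ))

/-- A closed set `D ⊆ ℍ` is a fundamental domain of the modular torus if it contains at least one
point of every orbit, and its interior contains at most one point of every orbit. The covering
condition is required everywhere, not only up to a set of measure zero. -/
structure IsTorusFundamentalDomain (D : Set ℍ) : Prop where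
  isClosed : IsClosed D
  surjOn : Set.SurjOn torusProj D Set.univ
  injOn : Set.InjOn torusProj (interior D)

/-- A simple geodesic in the modular torus with both ends in the cusp. -/
def IsTorusIdealArc (e : Set ModularTorus) : Prop :=
  ∃ a b : OnePoint ℝ, a ≠ b ∧ IsTorusCusp a ∧ IsTorusCusp b ∧
    Set.InjOn torusProj (idealGeodesic a b) ∧ e = torusProj '' idealGeodesic a b

/-- An ideal triangulation of the modular torus: a decomposition of it into the disjoint union of
finitely many simple geodesics with both ends in the cusp (the edges) and finitely many embedded
open ideal triangles whose sides are edges. -/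
structure TorusIdealTriangulation where
  edges : Set (Set ModularTorus)
  triangles : Set (Set ModularTorus)
  edges_finite : edges.Finite
  triangles_finite : triangles.Finite
  isIdealArc_of_mem : ∀ e ∈ edges, IsTorusIdealArc e
  triangle_of_mem : ∀ t ∈ triangles, ∃ a b c : OnePoint ℝ,
    a ≠ b ∧ b ≠ c ∧ c ≠ a ∧
    Set.InjOn torusProj (interior (idealTriangle a b c)) ∧
    t = torusProj '' interior (idealTriangle a b c) ∧
    torusProj '' idealGeodesic a b ∈ edges ∧
    torusProj '' idealGeodesic b c ∈ edges ∧
    torusProj '' idealGeodesic c a ∈ edges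
  edges_disjoint_triangles : Disjoint edges triangles
  pairwiseDisjoint : (edges ∪ triangles).PairwiseDisjoint id
  cover : ⋃₀ (edges ∪ triangles) = Set.univ

open Matrix Matrix.SpecialLinearGroup

/-! ### The congruence description of the group -/

/-- The congruence conditions that cut out `± modularTorusGroup`. -/
def TorusCongruence (γ : SL(2, ℤ)) : Prop :=
  ((γ 0 0 + γ 1 1 : ZMod 2) = 1 ∨ (γ 0 1 : ZMod 2) = 0 ∧ (γ 1 0 : ZMod 2) = 0) ∧
  ((γ 0 0 + γ 1 1 : ZMod 3) = 0 ∨ (γ 0 1 : ZMod 3) = 0 ∧ (γ 1 0 : ZMod 3) = 0)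

lemma det_cast_zmod (γ : SL(2, ℤ)) (n : ℕ) :
    (γ 0 0 : ZMod n) * γ 1 1 - γ 0 1 * γ 1 0 = 1 := by
  have h := γ.det_coe
  rw [Matrix.det_fin_two] at h
  exact_mod_cast congrArg (Int.cast : ℤ → ZMod n) h

lemma det_eq_one_int (γ : SL(2, ℤ)) : γ 0 0 * γ 1 1 - γ 0 1 * γ 1 0 = 1 := by
  have h := γ.det_coe
  rwa [Matrix.det_fin_two] at h

lemma coe_torusGenA : (torusGenA : Matrix (Fin 2) (Fin 2) ℤ) = !![1, -1; -1, 2] := rfl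

lemma coe_torusGenB : (torusGenB : Matrix (Fin 2) (Fin 2) ℤ) = !![1, 1; 1, 2] := rfl

lemma torusCongruence_genA_mul (γ : SL(2, ℤ)) :
    TorusCongruence (torusGenA * γ) ↔ TorusCongruence γ := by
  have h2 : ∀ a b c d : ZMod 2, a * d - b * c = 1 →
      ((a - c + (-b + 2 * d) = 1 ∨ b - d = 0 ∧ -a + 2 * c = 0) ↔
        (a + d = 1 ∨ b = 0 ∧ c = 0)) := by decide
  have h3 : ∀ a b c d : ZMod 3, a * d - b * c = 1 →
      ((a - c + (-b + 2 * d) = 0 ∨ b - d = 0 ∧ -a + 2 * c = 0) ↔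
        (a + d = 0 ∨ b = 0 ∧ c = 0)) := by decide
  have e2 := h2 _ _ _ _ (det_cast_zmod γ 2)
  have e3 := h3 _ _ _ _ (det_cast_zmod γ 3)
  unfold TorusCongruence
  rw [← e2, ← e3]
  simp [SpecialLinearGroup.coe_mul, coe_torusGenA, Matrix.mul_apply, Fin.sum_univ_two,
    sub_eq_add_neg]

lemma torusCongruence_genB_mul (γ : SL(2, ℤ)) :
    TorusCongruence (torusGenB * γ) ↔ TorusCongruence γ := by
  have h2 : ∀ a b c d : ZMod 2, a * d - b * c = 1 →
      ((a + c + (b + 2 * d) = 1 ∨ b + d = 0 ∧ a + 2 * c = 0) ↔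
        (a + d = 1 ∨ b = 0 ∧ c = 0)) := by decide
  have h3 : ∀ a b c d : ZMod 3, a * d - b * c = 1 →
      ((a + c + (b + 2 * d) = 0 ∨ b + d = 0 ∧ a + 2 * c = 0) ↔
        (a + d = 0 ∨ b = 0 ∧ c = 0)) := by decide
  have e2 := h2 _ _ _ _ (det_cast_zmod γ 2)
  have e3 := h3 _ _ _ _ (det_cast_zmod γ 3)
  unfold TorusCongruence
  rw [← e2, ← e3]
  simp [SpecialLinearGroup.coe_mul, coe_torusGenB, Matrix.mul_apply, Fin.sum_univ_two]

lemma torusCongruence_mul_left {g : SL(2, ℤ)} (hg : g ∈ modularTorusGroup) :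
    ∀ γ, TorusCongruence (g * γ) ↔ TorusCongruence γ := by
  induction hg using Subgroup.closure_induction with
  | mem x hx =>
    rcases hx with rfl | rfl
    · exact torusCongruence_genA_mul
    · exact torusCongruence_genB_mul
  | one => simp
  | mul x y _ _ hx hy => intro γ; rw [mul_assoc, hx, hy]
  | inv x _ hx => intro γ; rw [← hx (x⁻¹ * γ), mul_inv_cancel_left]

lemma torusCongruence_neg (γ : SL(2, ℤ)) : TorusCongruence (-γ) ↔ TorusCongruence γ := by
  have h2 : ∀ a b c d : ZMod 2, ((-a + -d = 1 ∨ -b = 0 ∧ -c = 0) ↔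
        (a + d = 1 ∨ b = 0 ∧ c = 0)) := by decide
  have h3 : ∀ a b c d : ZMod 3, ((-a + -d = 0 ∨ -b = 0 ∧ -c = 0) ↔
        (a + d = 0 ∨ b = 0 ∧ c = 0)) := by decide
  unfold TorusCongruence
  rw [← h2, ← h3]
  simp

lemma torusCongruence_one : TorusCongruence 1 := by
  unfold TorusCongruence; simp

lemma torusGenA_mem : torusGenA ∈ modularTorusGroup := Subgroup.subset_closure (by simp)

lemma torusGenB_mem : torusGenB ∈ modularTorusGroup := Subgroup.subset_closure (by simp)

lemma modularTorusGroup_conj_mem {s : SL(2, ℤ)}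
    (hA : s * torusGenA * s⁻¹ ∈ modularTorusGroup) (hB : s * torusGenB * s⁻¹ ∈ modularTorusGroup)
    {g : SL(2, ℤ)} (hg : g ∈ modularTorusGroup) : s * g * s⁻¹ ∈ modularTorusGroup := by
  have : modularTorusGroup ≤ modularTorusGroup.comap (MulAut.conj s).toMonoidHom := by
    conv_lhs => unfold modularTorusGroup
    rw [Subgroup.closure_le]
    rintro x (rfl | rfl)
    · simpa using hA
    · simpa using hB
  simpa using this hg

lemma sl2_ext_int {g h : SL(2, ℤ)} (h00 : g 0 0 = h 0 0) (h01 : g 0 1 = h 0 1)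
    (h10 : g 1 0 = h 1 0) (h11 : g 1 1 = h 1 1) : g = h := by
  ext i j
  fin_cases i <;> fin_cases j <;> assumption

open ModularGroup in
lemma modularTorusGroup_conj_S {g : SL(2, ℤ)} (hg : g ∈ modularTorusGroup) :
    S * g * S⁻¹ ∈ modularTorusGroup := by
  refine modularTorusGroup_conj_mem ?_ ?_ hg
  · have : S * torusGenA * S⁻¹ = torusGenA⁻¹ := by
      apply Subtype.ext
      simp [SpecialLinearGroup.coe_mul, SpecialLinearGroup.coe_inv, coe_torusGenA, coe_torusGenB,
        ModularGroup.coe_S, ModularGroup.coe_T, Matrix.adjugate_fin_two]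
    rw [this]; exact inv_mem torusGenA_mem
  · have : S * torusGenB * S⁻¹ = torusGenB⁻¹ := by
      apply Subtype.ext
      simp [SpecialLinearGroup.coe_mul, SpecialLinearGroup.coe_inv, coe_torusGenA, coe_torusGenB,
        ModularGroup.coe_S, ModularGroup.coe_T, Matrix.adjugate_fin_two]
    rw [this]; exact inv_mem torusGenB_mem

open ModularGroup in
lemma modularTorusGroup_conj_T {g : SL(2, ℤ)} (hg : g ∈ modularTorusGroup) :
    T * g * T⁻¹ ∈ modularTorusGroup := by
  refine modularTorusGroup_conj_mem ?_ ?_ hg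
  · have : T * torusGenA * T⁻¹ = torusGenB * torusGenA := by
      apply Subtype.ext
      simp [SpecialLinearGroup.coe_mul, SpecialLinearGroup.coe_inv, coe_torusGenA, coe_torusGenB,
        ModularGroup.coe_S, ModularGroup.coe_T, Matrix.adjugate_fin_two]
    rw [this]; exact mul_mem torusGenB_mem torusGenA_mem
  · have : T * torusGenB * T⁻¹ = torusGenA⁻¹ := by
      apply Subtype.ext
      simp [SpecialLinearGroup.coe_mul, SpecialLinearGroup.coe_inv, coe_torusGenA, coe_torusGenB,
        ModularGroup.coe_S, ModularGroup.coe_T, Matrix.adjugate_fin_two]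
    rw [this]; exact inv_mem torusGenA_mem

open ModularGroup in
lemma modularTorusGroup_conj_T_inv {g : SL(2, ℤ)} (hg : g ∈ modularTorusGroup) :
    T⁻¹ * g * T ∈ modularTorusGroup := by
  have := modularTorusGroup_conj_mem (s := T⁻¹) ?_ ?_ hg
  · simpa using this
  · have : T⁻¹ * torusGenA * T⁻¹⁻¹ = torusGenB⁻¹ := by
      apply Subtype.ext
      simp [SpecialLinearGroup.coe_mul, SpecialLinearGroup.coe_inv, coe_torusGenA, coe_torusGenB,
        ModularGroup.coe_S, ModularGroup.coe_T, Matrix.adjugate_fin_two]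
    rw [this]; exact inv_mem torusGenB_mem
  · have : T⁻¹ * torusGenB * T⁻¹⁻¹ = torusGenA * torusGenB := by
      apply Subtype.ext
      simp [SpecialLinearGroup.coe_mul, SpecialLinearGroup.coe_inv, coe_torusGenA, coe_torusGenB,
        ModularGroup.coe_S, ModularGroup.coe_T, Matrix.adjugate_fin_two]
    rw [this]; exact mul_mem torusGenA_mem torusGenB_mem

open ModularGroup in
instance modularTorusGroup_normal : modularTorusGroup.Normal := by
  have hS2 : ∀ g : SL(2, ℤ), S⁻¹ * g * S = S * g * S⁻¹ := by
    intro g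
    have : (S⁻¹ : SL(2, ℤ)) = -S := by
      apply Subtype.ext
      simp [SpecialLinearGroup.coe_mul, SpecialLinearGroup.coe_inv, coe_torusGenA, coe_torusGenB,
        ModularGroup.coe_S, ModularGroup.coe_T, Matrix.adjugate_fin_two]
    rw [this]; simp
  rw [← Subgroup.normalizer_eq_top_iff, eq_top_iff, ← SpecialLinearGroup.SL2Z_generators,
    Subgroup.closure_le]
  rintro s (rfl | rfl)
  · refine Subgroup.mem_normalizer_iff.2 fun g ↦ ⟨modularTorusGroup_conj_S, fun h ↦ ?_⟩
    have := modularTorusGroup_conj_S h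
    rw [← hS2] at this
    simpa [mul_assoc] using this
  · refine Subgroup.mem_normalizer_iff.2 fun g ↦ ⟨modularTorusGroup_conj_T, fun h ↦ ?_⟩
    simpa [mul_assoc] using modularTorusGroup_conj_T_inv h

open ModularGroup in
lemma S_eq_genA_genB_T : S = torusGenA * torusGenB * (T ^ 3)⁻¹ := by
  rw [eq_mul_inv_iff_mul_eq]
  apply Subtype.ext
  simp [SpecialLinearGroup.coe_mul, SpecialLinearGroup.coe_inv, coe_torusGenA, coe_torusGenB,
    ModularGroup.coe_S, ModularGroup.coe_T, Matrix.adjugate_fin_two, pow_succ]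

open ModularGroup in
lemma exists_eq_mul_T_zpow (γ : SL(2, ℤ)) :
    ∃ g ∈ modularTorusGroup, ∃ i : ℤ, γ = g * T ^ i := by
  have : modularTorusGroup ⊔ Subgroup.zpowers T = ⊤ := by
    rw [eq_top_iff, ← SpecialLinearGroup.SL2Z_generators, Subgroup.closure_le]
    have hT : T ∈ modularTorusGroup ⊔ Subgroup.zpowers T :=
      Subgroup.mem_sup_right (Subgroup.mem_zpowers T)
    rintro s (rfl | rfl)
    · rw [S_eq_genA_genB_T]
      exact mul_mem (Subgroup.mem_sup_left (mul_mem torusGenA_mem torusGenB_mem))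
        (inv_mem (pow_mem hT 3))
    · exact hT
  have hγ : γ ∈ modularTorusGroup ⊔ Subgroup.zpowers T := this ▸ Subgroup.mem_top γ
  rw [Subgroup.mem_sup_of_normal_left] at hγ
  obtain ⟨g, hg, _, ⟨i, rfl⟩, h⟩ := hγ
  exact ⟨g, hg, i, h.symm⟩

open ModularGroup in
lemma neg_T_pow_six_mem : -(T ^ 6) ∈ modularTorusGroup := by
  have h : -(T ^ 6) = torusGenA * torusGenB * ((T ^ 3)⁻¹ * (torusGenA * torusGenB) * (T ^ 3)⁻¹⁻¹)
      := by
      apply Subtype.ext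
      simp [SpecialLinearGroup.coe_mul, SpecialLinearGroup.coe_inv, coe_torusGenA, coe_torusGenB,
        ModularGroup.coe_S, ModularGroup.coe_T, Matrix.adjugate_fin_two, pow_succ]
  have hAB := mul_mem torusGenA_mem torusGenB_mem
  rw [h]
  exact mul_mem hAB (modularTorusGroup_normal.conj_mem _ hAB _)

open ModularGroup in
lemma torusCongruence_T_zpow {i : ℤ} : TorusCongruence (T ^ i) ↔ 6 ∣ i := by
  have h2 : (1 + 1 : ZMod 2) ≠ 1 := by decide
  have h3 : (1 + 1 : ZMod 3) ≠ 0 := by decide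
  unfold TorusCongruence
  simp only [coe_T_zpow, Matrix.of_apply, Matrix.cons_val', Matrix.cons_val_zero,
    Matrix.cons_val_one, Matrix.cons_val_fin_one, Int.cast_one, Int.cast_zero, and_true, h2, h3,
    false_or]
  rw [ZMod.intCast_zmod_eq_zero_iff_dvd, ZMod.intCast_zmod_eq_zero_iff_dvd]
  push_cast
  omega

lemma torusCongruence_iff {γ : SL(2, ℤ)} :
    TorusCongruence γ ↔ γ ∈ modularTorusGroup ∨ -γ ∈ modularTorusGroup := by
  constructor
  · intro h
    obtain ⟨g, hg, i, rfl⟩ := exists_eq_mul_T_zpow γ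
    rw [torusCongruence_mul_left hg, torusCongruence_T_zpow] at h
    obtain ⟨k, rfl⟩ := h
    have key : ∀ k : ℤ, ModularGroup.T ^ (6 * k) ∈ modularTorusGroup ∨
        -ModularGroup.T ^ (6 * k) ∈ modularTorusGroup := by
      intro k
      have := zpow_mem neg_T_pow_six_mem k
      rw [_root_.zpow_mul]
      rcases Int.even_or_odd k with hk | hk
      · rw [hk.neg_zpow] at this; exact Or.inl this
      · rw [hk.neg_zpow] at this; exact Or.inr this
    rcases key k with h | h
    · exact Or.inl (mul_mem hg h)
    · right; rw [← mul_neg]; exact mul_mem hg h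
  · rintro (h | h)
    · have := torusCongruence_mul_left h 1
      rw [mul_one] at this
      exact this.2 torusCongruence_one
    · have := torusCongruence_mul_left h 1
      rw [mul_one, torusCongruence_neg] at this
      exact this.2 torusCongruence_one

/-- The subgroup `± modularTorusGroup`. -/
def torusGroupPM : Subgroup SL(2, ℤ) where
  carrier := {γ | TorusCongruence γ}
  one_mem' := torusCongruence_one
  mul_mem' := by
    intro a b ha hb
    rcases torusCongruence_iff.1 ha with h | h
    · exact (torusCongruence_mul_left h b).2 hb
    · have := (torusCongruence_mul_left h b).2 hb
      rwa [neg_mul, torusCongruence_neg] at this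
  inv_mem' := by
    intro a ha
    rcases torusCongruence_iff.1 ha with h | h
    · exact torusCongruence_iff.2 (Or.inl (inv_mem h))
    · refine torusCongruence_iff.2 (Or.inr ?_)
      have : -a⁻¹ = (-a)⁻¹ := by
        rw [eq_inv_iff_mul_eq_one]; simp
      rw [this]; exact inv_mem h

lemma modularTorusGroup_le : modularTorusGroup ≤ torusGroupPM :=
  fun _ h ↦ torusCongruence_iff.2 (Or.inl h)

/-- The image of `± modularTorusGroup` in `GL (Fin 2) ℝ`. -/
noncomputable def torusGL : Subgroup (GL (Fin 2) ℝ) := torusGroupPM.map (mapGL ℝ)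

lemma torusProj_eq_iff {z w : ℍ} : torusProj z = torusProj w ↔ ∃ g ∈ torusGL, g • z = w := by
  unfold torusProj
  rw [Quotient.eq, MulAction.orbitRel_apply]
  constructor
  · rintro ⟨g, hg⟩
    refine ⟨mapGL ℝ (g⁻¹ : SL(2, ℤ)), ⟨_, inv_mem (modularTorusGroup_le g.2), rfl⟩, ?_⟩
    rw [← hg]
    change (g⁻¹ : SL(2, ℤ)) • ((g : SL(2, ℤ)) • w) = w
    rw [inv_smul_smul]
  · rintro ⟨_, ⟨γ, hγ, rfl⟩, rfl⟩
    rcases torusCongruence_iff.1 hγ with h | h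
    · refine ⟨⟨γ⁻¹, inv_mem h⟩, ?_⟩
      change γ⁻¹ • (γ • z) = z
      simp
    · refine ⟨⟨(-γ)⁻¹, inv_mem h⟩, ?_⟩
      change (-γ)⁻¹ • (γ • z) = z
      rw [← ModularGroup.SL_neg_smul γ z, inv_smul_smul]

/-! ### Homogeneous coordinates of ideal points -/

/-- First homogeneous coordinate of an ideal point. -/
noncomputable def ipX (a : OnePoint ℝ) : ℝ := a.elim 1 id

/-- Second homogeneous coordinate of an ideal point. -/
noncomputable def ipY (a : OnePoint ℝ) : ℝ := a.elim 0 fun _ ↦ 1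

@[simp] lemma ipX_infty : ipX OnePoint.infty = 1 := rfl
@[simp] lemma ipY_infty : ipY OnePoint.infty = 0 := rfl
@[simp] lemma ipX_coe (t : ℝ) : ipX (t : OnePoint ℝ) = t := rfl
@[simp] lemma ipY_coe (t : ℝ) : ipY (t : OnePoint ℝ) = 1 := rfl

/-- The bilinear form attached to a point `z` of the hyperbolic plane, evaluated at two ideal
points. -/
noncomputable def polar (a b : OnePoint ℝ) (z : ℍ) : ℝ :=
  (ipX a - ipY a * z.re) * (ipX b - ipY b * z.re) + ipY a * ipY b * z.im ^ 2

/-- The determinant of two ideal points. -/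
noncomputable def wedge (a b : OnePoint ℝ) : ℝ := ipX a * ipY b - ipY a * ipX b

/-- A function that is negative to the left and positive to the right of the oriented geodesic
from `a` to `b`, or conversely. -/
noncomputable def omega (a b : OnePoint ℝ) (z : ℍ) : ℝ := wedge a b * polar a b z

lemma wedge_eq_zero_iff {a b : OnePoint ℝ} : wedge a b = 0 ↔ a = b := by
  induction a using OnePoint.rec <;> induction b using OnePoint.rec <;>
    simp [wedge, sub_eq_zero]

lemma omega_swap (a b : OnePoint ℝ) (z : ℍ) : omega b a z = -omega a b z := by
  unfold omega wedge polar; ring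

lemma omega_infty_coe (t : ℝ) (z : ℍ) : omega OnePoint.infty t z = t - z.re := by
  simp [omega, wedge, polar]

lemma omega_coe_infty (t : ℝ) (z : ℍ) : omega t OnePoint.infty z = z.re - t := by
  simp [omega, wedge, polar]

lemma omega_coe_coe (s t : ℝ) (z : ℍ) :
    omega s t z = (s - t) * ((z.re - s) * (z.re - t) + z.im ^ 2) := by
  simp [omega, wedge, polar]; left; ring

/-! ### Action of matrices -/

lemma det_val_eq (g : GL (Fin 2) ℝ) : g.det.val = g 0 0 * g 1 1 - g 0 1 * g 1 0 := by
  rw [GeneralLinearGroup.val_det_apply, Matrix.det_fin_two]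

lemma ip_smul (g : GL (Fin 2) ℝ) (a : OnePoint ℝ) :
    ∃ c : ℝ, c ≠ 0 ∧ c * ipX (g • a) = g 0 0 * ipX a + g 0 1 * ipY a ∧
      c * ipY (g • a) = g 1 0 * ipX a + g 1 1 * ipY a := by
  have hd : g 0 0 * g 1 1 - g 0 1 * g 1 0 ≠ 0 := by
    rw [← det_val_eq]; exact g.det.ne_zero
  induction a using OnePoint.rec with
  | infty =>
    rw [OnePoint.smul_infty_eq_ite]
    split_ifs with h
    · refine ⟨g 0 0, ?_, by simp, by simp [h]⟩
      rintro h0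
      simp [h, h0] at hd
    · refine ⟨g 1 0, h, ?_, by simp⟩
      simp; field_simp
  | coe t =>
    rw [OnePoint.smul_some_eq_ite]
    split_ifs with h
    · refine ⟨g 0 0 * t + g 0 1, ?_, by simp, by simp [h]⟩
      intro h0
      apply hd
      by_cases h00 : g 0 0 = 0
      · have : g 0 1 = 0 := by simpa [h00] using h0
        simp [h00, this]
      · have ht : t = -g 0 1 / g 0 0 := by field_simp; linarith
        subst ht
        field_simp at h
        linarith
    · refine ⟨g 1 0 * t + g 1 1, h, ?_, by simp⟩
      simp; field_simp

lemma normSq_denom_eq (g : GL (Fin 2) ℝ) (z : ℍ) :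
    Complex.normSq (UpperHalfPlane.denom g z) =
      (g 1 0 * z.re + g 1 1) ^ 2 + (g 1 0 * z.im) ^ 2 := by
  simp [UpperHalfPlane.denom, Complex.normSq_apply]; ring

lemma re_smul_eq (g : GL (Fin 2) ℝ) (z : ℍ) :
    (g • z).re = ((g 0 0 * z.re + g 0 1) * (g 1 0 * z.re + g 1 1) + g 0 0 * g 1 0 * z.im ^ 2) /
      ((g 1 0 * z.re + g 1 1) ^ 2 + (g 1 0 * z.im) ^ 2) := by
  rw [UpperHalfPlane.re_smul, Complex.div_re, normSq_denom_eq]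
  simp [UpperHalfPlane.denom, UpperHalfPlane.num]
  ring

lemma im_smul_eq (g : GL (Fin 2) ℝ) (z : ℍ) :
    (g • z).im = |g 0 0 * g 1 1 - g 0 1 * g 1 0| * z.im /
      ((g 1 0 * z.re + g 1 1) ^ 2 + (g 1 0 * z.im) ^ 2) := by
  rw [UpperHalfPlane.im_smul_eq_div_normSq, normSq_denom_eq, det_val_eq]

lemma denom_form_pos (g : GL (Fin 2) ℝ) (z : ℍ) :
    0 < (g 1 0 * z.re + g 1 1) ^ 2 + (g 1 0 * z.im) ^ 2 := by
  rw [← normSq_denom_eq]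
  exact UpperHalfPlane.normSq_denom_pos g z.im_ne_zero

lemma polar_transform {p q r s u₁ u₂ v₁ v₂ x y D : ℝ} (hD : D ≠ 0)
    (h : D = (r * x + s) ^ 2 + (r * y) ^ 2) :
    ((p * u₁ + q * u₂) - (r * u₁ + s * u₂) *
        (((p * x + q) * (r * x + s) + p * r * y ^ 2) / D)) *
      ((p * v₁ + q * v₂) - (r * v₁ + s * v₂) *
        (((p * x + q) * (r * x + s) + p * r * y ^ 2) / D)) +
      (r * u₁ + s * u₂) * (r * v₁ + s * v₂) * ((p * s - q * r) * y / D) ^ 2 =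
    (p * s - q * r) ^ 2 / D * ((u₁ - u₂ * x) * (v₁ - v₂ * x) + u₂ * v₂ * y ^ 2) := by
  field_simp
  subst h
  ring

lemma omega_smul (g : GL (Fin 2) ℝ) (hg : 0 < g.det.val) (a b : OnePoint ℝ) (z : ℍ) :
    ∃ k : ℝ, 0 < k ∧ omega (g • a) (g • b) (g • z) = k * omega a b z := by
  obtain ⟨c, hc, hcx, hcy⟩ := ip_smul g a
  obtain ⟨d, hd, hdx, hdy⟩ := ip_smul g b
  have hD := denom_form_pos g z
  rw [det_val_eq] at hg
  refine ⟨(g 0 0 * g 1 1 - g 0 1 * g 1 0) ^ 3 / (((g 1 0 * z.re + g 1 1) ^ 2 +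
    (g 1 0 * z.im) ^ 2) * (c * d) ^ 2), by positivity, ?_⟩
  have e : (c * d) ^ 2 * omega (g • a) (g • b) (g • z) =
      ((c * ipX (g • a)) * (d * ipY (g • b)) - (c * ipY (g • a)) * (d * ipX (g • b))) *
      (((c * ipX (g • a)) - (c * ipY (g • a)) * (g • z).re) *
        ((d * ipX (g • b)) - (d * ipY (g • b)) * (g • z).re) +
        (c * ipY (g • a)) * (d * ipY (g • b)) * (g • z).im ^ 2) := by
    unfold omega wedge polar; ring
  rw [hcx, hcy, hdx, hdy, re_smul_eq, im_smul_eq, abs_of_pos hg,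
    polar_transform hD.ne' rfl] at e
  have hcd : (c * d) ^ 2 ≠ 0 := by positivity
  rw [← mul_right_inj' hcd, e]
  rw [← mul_assoc ((c * d) ^ 2), ← div_div, mul_div_cancel₀ _ hcd]
  unfold omega wedge polar
  ring

lemma omega_smul_neg_iff {g : GL (Fin 2) ℝ} (hg : 0 < g.det.val) {a b : OnePoint ℝ} {z : ℍ} :
    omega (g • a) (g • b) (g • z) < 0 ↔ omega a b z < 0 := by
  obtain ⟨k, hk, h⟩ := omega_smul g hg a b z
  rw [h]; constructor <;> intro h' <;> nlinarith

lemma omega_smul_nonpos_iff {g : GL (Fin 2) ℝ} (hg : 0 < g.det.val) {a b : OnePoint ℝ} {z : ℍ} :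
    omega (g • a) (g • b) (g • z) ≤ 0 ↔ omega a b z ≤ 0 := by
  obtain ⟨k, hk, h⟩ := omega_smul g hg a b z
  rw [h]; constructor <;> intro h' <;> nlinarith

lemma omega_smul_eq_zero_iff {g : GL (Fin 2) ℝ} (hg : 0 < g.det.val) {a b : OnePoint ℝ} {z : ℍ} :
    omega (g • a) (g • b) (g • z) = 0 ↔ omega a b z = 0 := by
  obtain ⟨k, hk, h⟩ := omega_smul g hg a b z
  rw [h]; simp [hk.ne']

/-! ### Topology of the half-plane in coordinates -/

lemma eventually_nhds_iff_re_im {z : ℍ} {p : ℍ → Prop} :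
    (∀ᶠ w in nhds z, p w) ↔
      ∃ ε > 0, ∀ w : ℍ, |w.re - z.re| < ε → |w.im - z.im| < ε → p w := by
  constructor
  · intro h
    rw [UpperHalfPlane.isEmbedding_coe.nhds_eq_comap, Filter.eventually_comap,
      Metric.eventually_nhds_iff] at h
    obtain ⟨ε, hε, h⟩ := h
    refine ⟨ε / 2, by positivity, fun w h1 h2 ↦ h (y := (w : ℂ)) ?_ w rfl⟩
    rw [Complex.dist_eq]
    refine (Complex.norm_le_abs_re_add_abs_im _).trans_lt ?_
    simp only [Complex.sub_re, Complex.sub_im, UpperHalfPlane.coe_re, UpperHalfPlane.coe_im]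
    linarith
  · rintro ⟨ε, hε, h⟩
    have h1 : ∀ᶠ w : ℍ in nhds z, |w.re - z.re| < ε := by
      have : Continuous fun w : ℍ ↦ |w.re - z.re| :=
        (UpperHalfPlane.continuous_re.sub continuous_const).abs
      exact this.continuousAt.eventually_lt continuousAt_const (by simpa using hε)
    have h2 : ∀ᶠ w : ℍ in nhds z, |w.im - z.im| < ε := by
      have : Continuous fun w : ℍ ↦ |w.im - z.im| :=
        (UpperHalfPlane.continuous_im.sub continuous_const).abs
      exact this.continuousAt.eventually_lt continuousAt_const (by simpa using hε)
    filter_upwards [h1, h2] with w using h w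

@[fun_prop] lemma continuous_polar (a b : OnePoint ℝ) : Continuous (polar a b) := by
  have := UpperHalfPlane.continuous_re
  have := UpperHalfPlane.continuous_im
  unfold polar; fun_prop

@[fun_prop] lemma continuous_omega (a b : OnePoint ℝ) : Continuous (omega a b) := by
  unfold omega; fun_prop

/-- The point with given real and imaginary part. -/
def hpt (x y : ℝ) (hy : 0 < y) : ℍ := ⟨⟨x, y⟩, hy⟩

@[simp] lemma hpt_re (x y : ℝ) (hy : 0 < y) : (hpt x y hy).re = x := rfl
@[simp] lemma hpt_im (x y : ℝ) (hy : 0 < y) : (hpt x y hy).im = y := rfl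

/-! ### Ideal hulls -/

lemma mem_idealHull_iff {S : Set (OnePoint ℝ)} {z : ℍ} :
    z ∈ idealHull S ↔ ∀ g : GL (Fin 2) ℝ,
      (∀ s ∈ S, 0 ≤ (g 0 0 * ipX s + g 0 1 * ipY s) * (g 1 0 * ipX s + g 1 1 * ipY s)) →
      0 ≤ (g 0 0 * z.re + g 0 1) * (g 1 0 * z.re + g 1 1) + g 0 0 * g 1 0 * z.im ^ 2 := by
  unfold idealHull
  simp only [Set.mem_ofPred_eq]
  refine forall_congr' fun g ↦ imp_congr (forall₂_congr fun s hs ↦ ?_) ?_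
  · obtain ⟨c, hc, hx, hy⟩ := ip_smul g s
    rw [← hx, ← hy]
    have : c * ipX (g • s) * (c * ipY (g • s)) = c ^ 2 * (ipX (g • s) * ipY (g • s)) := by ring
    rw [this, mul_nonneg_iff_of_pos_left (by positivity)]
    generalize g • s = a
    induction a using OnePoint.rec <;> simp
  · rw [re_smul_eq]
    have := denom_form_pos g z
    constructor
    · intro h
      have := mul_nonneg h this.le
      rwa [div_mul_cancel₀ _ (denom_form_pos g z).ne'] at this
    · intro h
      positivity

/-- Every half-plane that contains the ideal points `S` contains the ideal hull of `S`. -/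
lemma mem_halfPlane_of_mem_idealHull {S : Set (OnePoint ℝ)} {z : ℍ} (hz : z ∈ idealHull S)
    (a b c d : ℝ) (hd : a * d - b * c ≠ 0)
    (h : ∀ s ∈ S, 0 ≤ (a * ipX s + b * ipY s) * (c * ipX s + d * ipY s)) :
    0 ≤ (a * z.re + b) * (c * z.re + d) + a * c * z.im ^ 2 := by
  have := mem_idealHull_iff.1 hz
    (GeneralLinearGroup.mkOfDetNeZero !![a, b; c, d] (by rwa [Matrix.det_fin_two_of]))
  simpa [GeneralLinearGroup.mkOfDetNeZero] using this (by
    simpa [GeneralLinearGroup.mkOfDetNeZero] using h)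

lemma smul_mem_idealHull_image_iff (g : GL (Fin 2) ℝ) {S : Set (OnePoint ℝ)} {z : ℍ} :
    g • z ∈ idealHull ((g • ·) '' S) ↔ z ∈ idealHull S := by
  unfold idealHull
  simp only [Set.mem_ofPred_eq, Set.forall_mem_image]
  constructor
  · intro h k hk
    have := h (k * g⁻¹)
    simpa [mul_smul] using this (by simpa [mul_smul] using hk)
  · intro h k hk
    have := h (k * g)
    simpa [mul_smul] using this (by simpa [mul_smul] using hk)

lemma smul_mem_idealGeodesic_iff (g : GL (Fin 2) ℝ) {a b : OnePoint ℝ} {z : ℍ} :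
    g • z ∈ idealGeodesic (g • a) (g • b) ↔ z ∈ idealGeodesic a b := by
  unfold idealGeodesic
  rw [← smul_mem_idealHull_image_iff g (S := {a, b}), Set.image_pair]

lemma smul_mem_idealTriangle_iff (g : GL (Fin 2) ℝ) {a b c : OnePoint ℝ} {z : ℍ} :
    g • z ∈ idealTriangle (g • a) (g • b) (g • c) ↔ z ∈ idealTriangle a b c := by
  unfold idealTriangle
  rw [← smul_mem_idealHull_image_iff g (S := {a, b, c}), Set.image_insert_eq, Set.image_pair]

lemma idealGeodesic_comm (a b : OnePoint ℝ) : idealGeodesic a b = idealGeodesic b a := by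
  unfold idealGeodesic; rw [Set.pair_comm]

lemma mem_idealGeodesic_coe_infty {t : ℝ} {z : ℍ} :
    z ∈ idealGeodesic t OnePoint.infty ↔ z.re = t := by
  constructor
  · intro h
    have h1 := mem_halfPlane_of_mem_idealHull h 1 (-t) 0 1 (by norm_num) (by simp)
    have h2 := mem_halfPlane_of_mem_idealHull h (-1) t 0 1 (by norm_num) (by simp)
    linarith
  · rintro rfl
    refine mem_idealHull_iff.2 fun g hg ↦ ?_
    have h1 := hg z.re (by simp)
    have h2 := hg OnePoint.infty (by simp)
    simp only [ipX_coe, ipY_coe, ipX_infty, ipY_infty, mul_one, mul_zero, add_zero] at h1 h2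
    positivity

lemma mem_idealGeodesic_of_lt {s t : ℝ} (hst : s < t) {z : ℍ} :
    z ∈ idealGeodesic s t ↔ (z.re - s) * (z.re - t) + z.im ^ 2 = 0 := by
  constructor
  · intro h
    have h1 := mem_halfPlane_of_mem_idealHull h 1 (-t) 1 (-s) (by linarith) (by simp)
    have h2 := mem_halfPlane_of_mem_idealHull h (-1) t 1 (-s) (by linarith) (by simp)
    nlinarith
  · intro h
    refine mem_idealHull_iff.2 fun g hg ↦ ?_
    have h1 := hg s (by simp)
    have h2 := hg t (by simp)
    simp only [ipX_coe, ipY_coe, mul_one] at h1 h2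
    have hy := sq_nonneg z.im
    have hs : s ≤ z.re := by by_contra! hc; nlinarith
    have ht : z.re ≤ t := by by_contra! hc; nlinarith
    have e : (t - s) * ((g 0 0 * z.re + g 0 1) * (g 1 0 * z.re + g 1 1) +
        g 0 0 * g 1 0 * z.im ^ 2) = (t - z.re) * ((g 0 0 * s + g 0 1) * (g 1 0 * s + g 1 1)) +
        (z.re - s) * ((g 0 0 * t + g 0 1) * (g 1 0 * t + g 1 1)) := by
      linear_combination (t - s) * g 0 0 * g 1 0 * h
    have := add_nonneg (mul_nonneg (sub_nonneg.2 ht) h1) (mul_nonneg (sub_nonneg.2 hs) h2)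
    rw [← e] at this
    exact nonneg_of_mul_nonneg_right this (sub_pos.2 hst)

lemma mem_idealGeodesic_iff {a b : OnePoint ℝ} (h : a ≠ b) {z : ℍ} :
    z ∈ idealGeodesic a b ↔ omega a b z = 0 := by
  induction a using OnePoint.rec with
  | infty =>
    induction b using OnePoint.rec with
    | infty => exact absurd rfl h
    | coe t =>
      rw [idealGeodesic_comm, mem_idealGeodesic_coe_infty, omega_infty_coe, sub_eq_zero, eq_comm]
  | coe s =>
    induction b using OnePoint.rec with
    | infty => rw [mem_idealGeodesic_coe_infty, omega_coe_infty, sub_eq_zero]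
    | coe t =>
      have hst : s ≠ t := fun e ↦ h (by rw [e])
      rw [omega_coe_coe, mul_eq_zero, sub_eq_zero, or_iff_right hst]
      rcases lt_or_gt_of_ne hst with h' | h'
      · exact mem_idealGeodesic_of_lt h'
      · rw [idealGeodesic_comm, mem_idealGeodesic_of_lt h', mul_comm]

lemma mem_idealTriangle_infty {a b : ℝ} (hab : a < b) {z : ℍ} :
    z ∈ idealTriangle a b OnePoint.infty ↔
      a ≤ z.re ∧ z.re ≤ b ∧ 0 ≤ (z.re - a) * (z.re - b) + z.im ^ 2 := by
  constructor
  · intro h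
    have h1 := mem_halfPlane_of_mem_idealHull h 1 (-a) 0 1 (by norm_num) (by simp [hab.le])
    have h2 := mem_halfPlane_of_mem_idealHull h (-1) b 0 1 (by norm_num) (by simp [hab.le])
    have h3 := mem_halfPlane_of_mem_idealHull h 1 (-b) 1 (-a) (by linarith) (by simp)
    exact ⟨by linarith, by linarith, by linarith⟩
  · rintro ⟨ha, hb, h⟩
    refine mem_idealHull_iff.2 fun g hg ↦ ?_
    have h1 := hg a (by simp)
    have h2 := hg b (by simp)
    have h3 := hg OnePoint.infty (by simp)
    simp only [ipX_coe, ipY_coe, ipX_infty, ipY_infty, mul_one, mul_zero, add_zero] at h1 h2 h3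
    have e : (b - a) * ((g 0 0 * z.re + g 0 1) * (g 1 0 * z.re + g 1 1) +
        g 0 0 * g 1 0 * z.im ^ 2) = (b - z.re) * ((g 0 0 * a + g 0 1) * (g 1 0 * a + g 1 1)) +
        (z.re - a) * ((g 0 0 * b + g 0 1) * (g 1 0 * b + g 1 1)) +
        (b - a) * (g 0 0 * g 1 0 * ((z.re - a) * (z.re - b) + z.im ^ 2)) := by
      ring
    have := add_nonneg (add_nonneg (mul_nonneg (sub_nonneg.2 hb) h1)
      (mul_nonneg (sub_nonneg.2 ha) h2)) (mul_nonneg (sub_nonneg.2 hab.le) (mul_nonneg h3 h))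
    rw [← e] at this
    exact nonneg_of_mul_nonneg_right this (sub_pos.2 hab)

lemma mem_idealQuadrilateral {a b c : ℝ} (hab : a < b) (hbc : b < c) {z : ℍ} :
    z ∈ idealQuadrilateral a b c OnePoint.infty ↔
      a ≤ z.re ∧ z.re ≤ c ∧ 0 ≤ (z.re - a) * (z.re - b) + z.im ^ 2 ∧
        0 ≤ (z.re - b) * (z.re - c) + z.im ^ 2 := by
  have hac := hab.trans hbc
  constructor
  · intro h
    have h1 := mem_halfPlane_of_mem_idealHull h 1 (-a) 0 1 (by norm_num)
      (by simp [hab.le, hac.le])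
    have h2 := mem_halfPlane_of_mem_idealHull h (-1) c 0 1 (by norm_num)
      (by simp [hac.le, hbc.le])
    have h3 := mem_halfPlane_of_mem_idealHull h 1 (-b) 1 (-a) (by linarith) (by
      simp; nlinarith)
    have h4 := mem_halfPlane_of_mem_idealHull h 1 (-c) 1 (-b) (by linarith) (by
      simp; nlinarith)
    exact ⟨by linarith, by linarith, by linarith, by linarith⟩
  · rintro ⟨ha, hc, h, h'⟩
    have sub : ∀ S : Set (OnePoint ℝ), S ⊆ {(a : OnePoint ℝ), ↑b, ↑c, OnePoint.infty} →
        z ∈ idealHull S → z ∈ idealQuadrilateral a b c OnePoint.infty := by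
      intro S hS hz g hg
      exact hz g fun s hs ↦ hg s (hS hs)
    rcases le_total z.re b with hb | hb
    · refine sub {(a : OnePoint ℝ), (b : OnePoint ℝ), OnePoint.infty} ?_ ((mem_idealTriangle_infty hab).2 ⟨ha, hb, h⟩)
      rintro s (rfl | rfl | rfl) <;> simp
    · refine sub {(b : OnePoint ℝ), (c : OnePoint ℝ), OnePoint.infty} ?_ ((mem_idealTriangle_infty hbc).2 ⟨hb, hc, h'⟩)
      rintro s (rfl | rfl | rfl) <;> simp

/-! ### Interiors -/

lemma lt_re_of_mem_interior {A : Set ℍ} {a : ℝ} (hA : ∀ z ∈ A, a ≤ z.re) {z : ℍ}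
    (hz : z ∈ interior A) : a < z.re := by
  obtain ⟨ε, hε, h⟩ := eventually_nhds_iff_re_im.1 (mem_interior_iff_mem_nhds.1 hz)
  have := hA _ (h (hpt (z.re - ε / 2) z.im z.im_pos)
    (by simp [abs_of_pos (half_pos hε)]; linarith) (by simpa using hε))
  simp at this; linarith

lemma re_lt_of_mem_interior {A : Set ℍ} {a : ℝ} (hA : ∀ z ∈ A, z.re ≤ a) {z : ℍ}
    (hz : z ∈ interior A) : z.re < a := by
  obtain ⟨ε, hε, h⟩ := eventually_nhds_iff_re_im.1 (mem_interior_iff_mem_nhds.1 hz)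
  have := hA _ (h (hpt (z.re + ε / 2) z.im z.im_pos)
    (by simp [abs_of_pos (half_pos hε)]; linarith) (by simpa using hε))
  simp at this; linarith

lemma pos_of_mem_interior {A : Set ℍ} {a b : ℝ}
    (hA : ∀ z ∈ A, 0 ≤ (z.re - a) * (z.re - b) + z.im ^ 2) {z : ℍ}
    (hz : z ∈ interior A) : 0 < (z.re - a) * (z.re - b) + z.im ^ 2 := by
  obtain ⟨ε, hε, h⟩ := eventually_nhds_iff_re_im.1 (mem_interior_iff_mem_nhds.1 hz)
  have hy := z.im_pos
  set δ := min (ε / 2) (z.im / 2) with hδ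
  have hδ0 : 0 < δ := by positivity
  have hδ1 : δ ≤ ε / 2 := min_le_left _ _
  have hδ2 : δ ≤ z.im / 2 := min_le_right _ _
  have := hA _ (h (hpt z.re (z.im - δ) (by linarith)) (by simpa using hε)
    (by simp [abs_of_pos hδ0]; linarith))
  simp at this; nlinarith

lemma mem_interior_idealTriangle {a b : ℝ} (hab : a < b) {z : ℍ} :
    z ∈ interior (idealTriangle a b OnePoint.infty) ↔
      a < z.re ∧ z.re < b ∧ 0 < (z.re - a) * (z.re - b) + z.im ^ 2 := by
  constructor
  · intro h
    exact ⟨lt_re_of_mem_interior (fun z hz ↦ ((mem_idealTriangle_infty hab).1 hz).1) h,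
      re_lt_of_mem_interior (fun z hz ↦ ((mem_idealTriangle_infty hab).1 hz).2.1) h,
      pos_of_mem_interior (fun z hz ↦ ((mem_idealTriangle_infty hab).1 hz).2.2) h⟩
  · rintro ⟨h1, h2, h3⟩
    have c1 := UpperHalfPlane.continuous_re
    have c2 := UpperHalfPlane.continuous_im
    rw [mem_interior_iff_mem_nhds]
    have e1 := c1.continuousAt.eventually_const_lt h1
    have e2 := c1.continuousAt.eventually_lt_const h2
    have e3 := (show Continuous fun z : ℍ ↦ (z.re - a) * (z.re - b) + z.im ^ 2 by
      fun_prop).continuousAt.eventually_const_lt h3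
    filter_upwards [e1, e2, e3] with w h1 h2 h3
    exact (mem_idealTriangle_infty hab).2 ⟨h1.le, h2.le, h3.le⟩

lemma mem_interior_idealQuadrilateral {a b c : ℝ} (hab : a < b) (hbc : b < c) {z : ℍ} :
    z ∈ interior (idealQuadrilateral a b c OnePoint.infty) ↔
      a < z.re ∧ z.re < c ∧ 0 < (z.re - a) * (z.re - b) + z.im ^ 2 ∧
        0 < (z.re - b) * (z.re - c) + z.im ^ 2 := by
  have key := @mem_idealQuadrilateral a b c hab hbc
  constructor
  · intro h
    exact ⟨lt_re_of_mem_interior (fun z hz ↦ (key.1 hz).1) h,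
      re_lt_of_mem_interior (fun z hz ↦ (key.1 hz).2.1) h,
      pos_of_mem_interior (fun z hz ↦ (key.1 hz).2.2.1) h,
      pos_of_mem_interior (fun z hz ↦ (key.1 hz).2.2.2) h⟩
  · rintro ⟨h1, h2, h3, h4⟩
    have c1 := UpperHalfPlane.continuous_re
    have c2 := UpperHalfPlane.continuous_im
    rw [mem_interior_iff_mem_nhds]
    have e1 := c1.continuousAt.eventually_const_lt h1
    have e2 := c1.continuousAt.eventually_lt_const h2
    have e3 := (show Continuous fun z : ℍ ↦ (z.re - a) * (z.re - b) + z.im ^ 2 by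
      fun_prop).continuousAt.eventually_const_lt h3
    have e4 := (show Continuous fun z : ℍ ↦ (z.re - b) * (z.re - c) + z.im ^ 2 by
      fun_prop).continuousAt.eventually_const_lt h4
    filter_upwards [e1, e2, e3, e4] with w h1 h2 h3 h4
    exact key.2 ⟨h1.le, h2.le, h3.le, h4.le⟩

lemma isClosed_idealQuadrilateral {a b c : ℝ} (hab : a < b) (hbc : b < c) :
    IsClosed (idealQuadrilateral a b c OnePoint.infty) := by
  have c1 := UpperHalfPlane.continuous_re
  have c2 := UpperHalfPlane.continuous_im
  have : idealQuadrilateral a b c OnePoint.infty = {z : ℍ | a ≤ z.re} ∩ {z : ℍ | z.re ≤ c} ∩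
      {z : ℍ | 0 ≤ (z.re - a) * (z.re - b) + z.im ^ 2} ∩
      {z : ℍ | 0 ≤ (z.re - b) * (z.re - c) + z.im ^ 2} := by
    ext z; rw [mem_idealQuadrilateral hab hbc]; simp [and_assoc]
  rw [this]
  exact (((isClosed_le continuous_const c1).inter (isClosed_le c1 continuous_const)).inter
    (isClosed_le continuous_const (by fun_prop))).inter
    (isClosed_le continuous_const (by fun_prop))

/-! ### Elements of the group -/

lemma torusCongruence_iff_dvd {γ : SL(2, ℤ)} : TorusCongruence γ ↔
    (¬ 2 ∣ γ 0 0 + γ 1 1 ∨ 2 ∣ γ 0 1 ∧ 2 ∣ γ 1 0) ∧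
      (3 ∣ γ 0 0 + γ 1 1 ∨ 3 ∣ γ 0 1 ∧ 3 ∣ γ 1 0) := by
  have h2 : ∀ x : ZMod 2, x = 1 ↔ ¬ x = 0 := by decide
  have e2 : ∀ n : ℤ, (n : ZMod 2) = 0 ↔ 2 ∣ n := fun n ↦ by
    simpa using ZMod.intCast_zmod_eq_zero_iff_dvd n 2
  have e3 : ∀ n : ℤ, (n : ZMod 3) = 0 ↔ 3 ∣ n := fun n ↦ by
    simpa using ZMod.intCast_zmod_eq_zero_iff_dvd n 3
  unfold TorusCongruence
  rw [h2, ← Int.cast_add, ← Int.cast_add, e2, e2, e2, e3, e3, e3]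

lemma TorusCongruence.trace_ne_zero {γ : SL(2, ℤ)} (h : TorusCongruence γ) :
    γ 0 0 + γ 1 1 ≠ 0 := by
  intro h0
  have hdet := det_eq_one_int γ
  obtain ⟨h2, -⟩ := torusCongruence_iff_dvd.1 h
  rw [h0] at h2
  obtain ⟨⟨b, hb⟩, ⟨c, hc⟩⟩ := h2.resolve_left (by simp)
  have hd : γ 1 1 = -γ 0 0 := by linarith
  rw [hb, hc, hd] at hdet
  have h4 : (γ 0 0) ^ 2 % 4 = 0 ∨ (γ 0 0) ^ 2 % 4 = 1 := by
    have : γ 0 0 % 4 = 0 ∨ γ 0 0 % 4 = 1 ∨ γ 0 0 % 4 = 2 ∨ γ 0 0 % 4 = 3 := by omega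
    rcases this with h | h | h | h <;> simp [pow_two, Int.mul_emod, h]
  have : (γ 0 0) ^ 2 = 4 * (-(b * c)) - 1 := by linarith
  omega

lemma TorusCongruence.one_lt_abs_trace {γ : SL(2, ℤ)} (h : TorusCongruence γ) :
    1 < |γ 0 0 + γ 1 1| := by
  have h0 := h.trace_ne_zero
  by_contra! hle
  have hdet := det_eq_one_int γ
  obtain ⟨-, h3⟩ := torusCongruence_iff_dvd.1 h
  have h1 : γ 0 0 + γ 1 1 = 1 ∨ γ 0 0 + γ 1 1 = -1 := by
    rw [abs_le] at hle; omega
  obtain ⟨⟨b, hb⟩, ⟨c, hc⟩⟩ := h3.resolve_left (by omega)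
  rw [hb, hc] at hdet
  have key : ∀ a : ℤ, (a * (1 - a)) % 9 ≠ 1 ∧ (a * (-1 - a)) % 9 ≠ 1 := by
    intro a
    have : a % 9 = 0 ∨ a % 9 = 1 ∨ a % 9 = 2 ∨ a % 9 = 3 ∨ a % 9 = 4 ∨ a % 9 = 5 ∨
      a % 9 = 6 ∨ a % 9 = 7 ∨ a % 9 = 8 := by omega
    rcases this with h | h | h | h | h | h | h | h | h <;> simp [Int.mul_emod, Int.sub_emod, h]
  obtain ⟨k1, k2⟩ := key (γ 0 0)
  rcases h1 with h1 | h1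
  · have hd : γ 1 1 = 1 - γ 0 0 := by linarith
    rw [hd] at hdet
    have : γ 0 0 * (1 - γ 0 0) = 1 + 9 * (b * c) := by linarith
    omega
  · have hd : γ 1 1 = -1 - γ 0 0 := by linarith
    rw [hd] at hdet
    have : γ 0 0 * (-1 - γ 0 0) = 1 + 9 * (b * c) := by linarith
    omega

lemma mapGL_apply_real (γ : SL(2, ℤ)) (i j : Fin 2) : (mapGL ℝ γ) i j = (γ i j : ℝ) := by
  simp [mapGL]

lemma det_mapGL_real (γ : SL(2, ℤ)) : (mapGL ℝ γ).det.val = 1 := by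
  rw [det_val_eq]
  simp only [mapGL_apply_real]
  exact_mod_cast det_eq_one_int γ

lemma det_of_mem {g : GL (Fin 2) ℝ} (hg : g ∈ torusGL) : g.det.val = 1 := by
  obtain ⟨γ, -, rfl⟩ := hg
  exact det_mapGL_real γ

lemma det_pos_of_mem {g : GL (Fin 2) ℝ} (hg : g ∈ torusGL) : 0 < g.det.val := by
  rw [det_of_mem hg]; exact one_pos

instance : Countable SL(2, ℤ) := by
  have : Countable (Matrix (Fin 2) (Fin 2) ℤ) := inferInstanceAs (Countable (Fin 2 → Fin 2 → ℤ))
  exact Subtype.coe_injective.countable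

instance : Countable torusGL := by
  have : (Set.range fun γ : torusGroupPM ↦ mapGL ℝ (γ : SL(2, ℤ))).Countable :=
    Set.countable_range _
  refine (this.mono ?_).to_subtype
  rintro _ ⟨γ, hγ, rfl⟩
  exact ⟨⟨γ, hγ⟩, rfl⟩

lemma smul_of_eq_one_or_neg_one {g : GL (Fin 2) ℝ} (h : g = 1 ∨ g = -1) (z : ℍ) : g • z = z := by
  rcases h with rfl | rfl <;> simp [UpperHalfPlane.neg_smul]

lemma neg_smul_onePoint (g : GL (Fin 2) ℝ) (a : OnePoint ℝ) : (-g) • a = g • a := by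
  have e : ∀ i j, (-g) i j = -g i j := fun i j ↦ by simp
  induction a using OnePoint.rec with
  | infty => simp [OnePoint.smul_infty_eq_ite]
  | coe t =>
    rw [OnePoint.smul_some_eq_ite, OnePoint.smul_some_eq_ite, e, e, e, e]
    have h1 : -g 1 0 * t + -g 1 1 = -(g 1 0 * t + g 1 1) := by ring
    have h2 : -g 0 0 * t + -g 0 1 = -(g 0 0 * t + g 0 1) := by ring
    simp only [h1, h2, neg_div_neg_eq, neg_eq_zero]

lemma smul_onePoint_of_eq_one_or_neg_one {g : GL (Fin 2) ℝ} (h : g = 1 ∨ g = -1)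
    (a : OnePoint ℝ) : g • a = a := by
  rcases h with rfl | rfl <;> simp [neg_smul_onePoint]

lemma eq_one_or_neg_one_of_entries {γ : SL(2, ℤ)} (hb : γ 0 1 = 0) (hc : γ 1 0 = 0)
    (h : γ 0 0 = γ 1 1) : mapGL ℝ γ = 1 ∨ mapGL ℝ γ = -1 := by
  have hdet := det_eq_one_int γ
  rw [hb, h] at hdet
  have h1 : γ 1 1 = 1 ∨ γ 1 1 = -1 := by
    have : (γ 1 1 - 1) * (γ 1 1 + 1) = 0 := by linarith
    rcases mul_eq_zero.1 this with h | h
    · left; linarith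
    · right; linarith
  rcases h1 with h1 | h1
  · left
    ext i j
    rw [mapGL_apply_real]
    fin_cases i <;> fin_cases j <;> simp [h, h1, hb, hc]
  · right
    ext i j
    rw [mapGL_apply_real]
    fin_cases i <;> fin_cases j <;> simp [h, h1, hb, hc]

/-- The group acts freely on the half-plane, up to sign. -/
lemma eq_one_or_neg_one_of_smul_eq {g : GL (Fin 2) ℝ} (hg : g ∈ torusGL) {z : ℍ}
    (hz : g • z = z) : g = 1 ∨ g = -1 := by
  obtain ⟨γ, hγ, rfl⟩ := hg
  have hdet := det_eq_one_int γ
  have hre := congrArg UpperHalfPlane.re hz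
  have him := congrArg UpperHalfPlane.im hz
  have hD := denom_form_pos (mapGL ℝ γ) z
  have hy := z.im_pos
  rw [re_smul_eq] at hre
  rw [im_smul_eq, ← det_val_eq, det_mapGL_real, abs_one, one_mul,
    div_eq_iff hD.ne', eq_comm, mul_eq_left₀ hy.ne'] at him
  rw [him, div_one] at hre
  simp only [mapGL_apply_real] at hre him
  have hdetR : (γ 0 0 * γ 1 1 - γ 0 1 * γ 1 0 : ℝ) = 1 := by exact_mod_cast hdet
  generalize hx : z.re = x at *
  generalize hy' : z.im = y at *
  have h1 : (γ 0 0 : ℝ) - γ 1 1 = 2 * γ 1 0 * x := by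
    linear_combination (γ 1 0 : ℝ) * hre - (γ 0 0 : ℝ) * him + (γ 1 0 * x + γ 1 1 : ℝ) * hdetR
  by_cases hc : γ 1 0 = 0
  · rw [hc] at h1 hdetR hre him
    have hb : (γ 0 1 : ℝ) = 0 := by
      have hd : (γ 1 1 : ℝ) ≠ 0 := by
        rintro h; rw [h] at hdetR; simp at hdetR
      have : (γ 0 1 : ℝ) * γ 1 1 = 0 := by
        push_cast at hre hdetR
        linear_combination hre - x * hdetR
      exact (mul_eq_zero.1 this).resolve_right hd
    refine eq_one_or_neg_one_of_entries (by exact_mod_cast hb) hc ?_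
    push_cast at h1
    have : (γ 0 0 : ℝ) = γ 1 1 := by linarith
    exact_mod_cast this
  · exfalso
    have hlt : ((γ 0 0 + γ 1 1 : ℤ) : ℝ) ^ 2 < 4 := by
      have hcR : (γ 1 0 : ℝ) ≠ 0 := by exact_mod_cast hc
      have : 0 < ((γ 1 0 : ℝ) * y) ^ 2 := by positivity
      have e : ((γ 0 0 + γ 1 1 : ℤ) : ℝ) ^ 2 = 4 * ((γ 1 0 : ℝ) * x + γ 1 1) ^ 2 := by
        have : (γ 0 0 : ℝ) = γ 1 1 + 2 * γ 1 0 * x := by linarith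
        push_cast; rw [this]; ring
      rw [e]; linarith
    have hlt' : (γ 0 0 + γ 1 1) ^ 2 < 4 := by exact_mod_cast hlt
    have := TorusCongruence.one_lt_abs_trace hγ
    rw [← sq_abs] at hlt'
    nlinarith

/-- No element of the group swaps two ideal points. -/
lemma not_swap_of_mem {g : GL (Fin 2) ℝ} (hg : g ∈ torusGL) {a b : OnePoint ℝ} (hab : a ≠ b)
    (h1 : g • a = b) (h2 : g • b = a) : False := by
  obtain ⟨c, hc, hcx, hcy⟩ := ip_smul g a
  obtain ⟨d, hd, hdx, hdy⟩ := ip_smul g b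
  rw [h1] at hcx hcy
  rw [h2] at hdx hdy
  have hw : wedge a b ≠ 0 := fun h ↦ hab (wedge_eq_zero_iff.1 h)
  have : (g 0 0 + g 1 1) * wedge a b = 0 := by
    unfold wedge
    linear_combination ipX b * hcy - ipY b * hcx + ipY a * hdx - ipX a * hdy
  have ht := (mul_eq_zero.1 this).resolve_right hw
  obtain ⟨γ, hγ, rfl⟩ := hg
  simp only [mapGL_apply_real] at ht
  exact TorusCongruence.trace_ne_zero hγ (by exact_mod_cast ht)

/-! ### Translations and cusps -/

/-- The translation by `6 k`. -/
noncomputable def torusShift (k : ℤ) : GL (Fin 2) ℝ := mapGL ℝ (ModularGroup.T ^ (6 * k))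

lemma torusShift_mem (k : ℤ) : torusShift k ∈ torusGL :=
  ⟨_, torusCongruence_T_zpow.2 (dvd_mul_right 6 k), rfl⟩

lemma mapGL_T_zpow_smul_re (i : ℤ) (z : ℍ) : (mapGL ℝ (ModularGroup.T ^ i) • z).re = z.re + i :=
  ModularGroup.re_T_zpow_smul z i

lemma mapGL_T_zpow_smul_im (i : ℤ) (z : ℍ) : (mapGL ℝ (ModularGroup.T ^ i) • z).im = z.im :=
  ModularGroup.im_T_zpow_smul z i

lemma mapGL_T_zpow_smul_infty (i : ℤ) :
    mapGL ℝ (ModularGroup.T ^ i) • (OnePoint.infty : OnePoint ℝ) = OnePoint.infty := by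
  rw [OnePoint.smul_infty_eq_self_iff, mapGL_apply_real, ModularGroup.coe_T_zpow]
  simp

lemma mapGL_T_zpow_smul_coe (i : ℤ) (t : ℝ) :
    mapGL ℝ (ModularGroup.T ^ i) • (t : OnePoint ℝ) = ((t + i : ℝ) : OnePoint ℝ) := by
  rw [OnePoint.smul_some_eq_ite]
  simp only [mapGL_apply_real, ModularGroup.coe_T_zpow]
  simp

lemma torusShift_smul_re (k : ℤ) (z : ℍ) : (torusShift k • z).re = z.re + 6 * k := by
  rw [torusShift, mapGL_T_zpow_smul_re]; push_cast; rfl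

lemma torusShift_smul_infty (k : ℤ) :
    torusShift k • (OnePoint.infty : OnePoint ℝ) = OnePoint.infty :=
  mapGL_T_zpow_smul_infty _

lemma torusShift_smul_coe (k : ℤ) (t : ℝ) :
    torusShift k • (t : OnePoint ℝ) = ((t + 6 * k : ℝ) : OnePoint ℝ) := by
  rw [torusShift, mapGL_T_zpow_smul_coe]; push_cast; rfl

/-- The stabilizer of `∞` consists of translations by multiples of `6`, up to sign. -/
lemma eq_torusShift_of_smul_infty {g : GL (Fin 2) ℝ} (hg : g ∈ torusGL)
    (h : g • (OnePoint.infty : OnePoint ℝ) = OnePoint.infty) :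
    ∃ k : ℤ, g = torusShift k ∨ g = -torusShift k := by
  obtain ⟨γ, hγ, rfl⟩ := hg
  rw [OnePoint.smul_infty_eq_self_iff, mapGL_apply_real] at h
  have hc : γ 1 0 = 0 := by exact_mod_cast h
  obtain ⟨i, hi⟩ := ModularGroup.exists_eq_T_zpow_of_c_eq_zero hc
  have hγ' : γ = ModularGroup.T ^ i ∨ γ = -ModularGroup.T ^ i := by
    have hdet := det_eq_one_int γ
    have h1 : γ 1 1 = 1 ∨ γ 1 1 = -1 := by
      rw [hc, mul_zero, sub_zero, mul_comm] at hdet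
      exact Int.isUnit_iff.1 (IsUnit.of_mul_eq_one _ hdet)
    have h00 : γ 0 0 = γ 1 1 := by
      rw [hc] at hdet
      rcases h1 with h1 | h1 <;> rw [h1] at hdet ⊢ <;> linarith
    have hact := hi UpperHalfPlane.I
    have hre := congrArg UpperHalfPlane.re hact
    rw [ModularGroup.re_T_zpow_smul] at hre
    have hre' : (mapGL ℝ γ • UpperHalfPlane.I).re = UpperHalfPlane.I.re + i := hre
    rw [re_smul_eq] at hre'
    simp only [mapGL_apply_real, hc, h00, UpperHalfPlane.I_re, UpperHalfPlane.I_im] at hre'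
    rcases h1 with h1 | h1
    · left
      have : γ 0 1 = i := by
        simp [h1] at hre'; exact_mod_cast hre'
      apply sl2_ext_int <;> simp [ModularGroup.coe_T_zpow, *]
    · right
      have : γ 0 1 = -i := by
        simp [h1] at hre'
        have : (γ 0 1 : ℝ) = -i := by linarith
        exact_mod_cast this
      apply sl2_ext_int <;> simp [ModularGroup.coe_T_zpow, *]
  have hdvd : 6 ∣ i := by
    rw [← torusCongruence_T_zpow]
    rcases hγ' with rfl | rfl
    · exact hγ
    · exact (torusCongruence_neg _).1 hγ
  obtain ⟨k, rfl⟩ := hdvd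
  refine ⟨k, ?_⟩
  unfold torusShift
  rcases hγ' with rfl | rfl
  · left; rfl
  · right
    ext i j
    have e : (-mapGL ℝ (ModularGroup.T ^ (6 * k))) i j =
      -(mapGL ℝ (ModularGroup.T ^ (6 * k))) i j := by simp
    rw [e, mapGL_apply_real, mapGL_apply_real]
    simp

lemma exists_eq_mul_mapGL_T_zpow (η : SL(2, ℤ)) :
    ∃ g ∈ torusGL, ∃ i : ℤ, mapGL ℝ η = g * mapGL ℝ (ModularGroup.T ^ i) := by
  obtain ⟨g, hg, i, rfl⟩ := exists_eq_mul_T_zpow η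
  exact ⟨mapGL ℝ g, ⟨g, modularTorusGroup_le hg, rfl⟩, i, map_mul _ _ _⟩

lemma isTorusCusp_iff {c : OnePoint ℝ} :
    IsTorusCusp c ↔ ∃ g ∈ torusGL, g • (OnePoint.infty : OnePoint ℝ) = c := by
  constructor
  · intro h
    have h' : IsCusp c (mapGL ℝ : SL(2, ℤ) →* _).range :=
      IsCusp.mono (by rintro _ ⟨γ, -, rfl⟩; exact ⟨γ, rfl⟩) h
    obtain ⟨η, rfl⟩ := isCusp_SL2Z_iff'.1 h'
    obtain ⟨g, hg, i, hη⟩ := exists_eq_mul_mapGL_T_zpow η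
    exact ⟨g, hg, by rw [hη, mul_smul, mapGL_T_zpow_smul_infty]⟩
  · rintro ⟨_, ⟨γ, hγ, rfl⟩, rfl⟩
    have hT : (-(ModularGroup.T ^ 6) : SL(2, ℤ)) ^ 2 ∈ modularTorusGroup :=
      pow_mem neg_T_pow_six_mem 2
    have hT12 : (-(ModularGroup.T ^ 6) : SL(2, ℤ)) ^ 2 = ModularGroup.T ^ (12 : ℤ) := by
      rw [neg_sq, ← pow_mul]; rfl
    rw [hT12] at hT
    refine ⟨_, ⟨γ * ModularGroup.T ^ (12 : ℤ) * γ⁻¹, modularTorusGroup_normal.conj_mem _ hT _,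
      rfl⟩, ?_, ?_⟩
    · suffices (mapGL ℝ (ModularGroup.T ^ (12 : ℤ))).IsParabolic by simpa using this
      refine ⟨fun ⟨a, ha⟩ ↦ ?_, ?_⟩
      · have := congr_fun₂ ha 0 1
        rw [mapGL_apply_real, ModularGroup.coe_T_zpow] at this
        simp at this
      · rw [discr_fin_two, trace_fin_two, det_fin_two]
        simp only [mapGL_apply_real, ModularGroup.coe_T_zpow]
        norm_num
    · rw [map_mul, map_mul, mul_smul, mul_smul, map_inv, inv_smul_smul, mapGL_T_zpow_smul_infty]

/-! ### The Farey triangle -/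

/-- The Farey triangle with vertices `0, 1, ∞`, with the side from `0` to `∞` but without the other
two sides. -/
def fareyTriangle : Set ℍ := {z | 0 ≤ z.re ∧ z.re < 1 ∧ 0 < z.re * (z.re - 1) + z.im ^ 2}

lemma exists_smul_mem_fareyTriangle (z : ℍ) : ∃ η : SL(2, ℤ), mapGL ℝ η • z ∈ fareyTriangle := by
  obtain ⟨g, hg1, hg2⟩ := ModularGroup.exists_smul_mem_fd z
  rw [Complex.normSq_apply, UpperHalfPlane.coe_re, UpperHalfPlane.coe_im] at hg1
  rw [abs_le] at hg2
  by_cases h : 0 ≤ (g • z).re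
  · refine ⟨g, ?_⟩
    change 0 ≤ (g • z).re ∧ (g • z).re < 1 ∧ 0 < (g • z).re * ((g • z).re - 1) + (g • z).im ^ 2
    exact ⟨h, by linarith, by nlinarith⟩
  · refine ⟨ModularGroup.T * g, ?_⟩
    have e1 : (mapGL ℝ (ModularGroup.T * g) • z).re = (g • z).re + 1 := by
      rw [← ModularGroup.re_T_smul, ← mul_smul]; rfl
    have e2 : (mapGL ℝ (ModularGroup.T * g) • z).im = (g • z).im := by
      rw [← ModularGroup.im_T_smul (g • z), ← mul_smul]; rfl
    change 0 ≤ (mapGL ℝ (ModularGroup.T * g) • z).re ∧ _ < 1 ∧ 0 < _ * (_ - 1) + _ ^ 2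
    rw [e1, e2]
    exact ⟨by linarith, by linarith, by nlinarith⟩

lemma quadratic_form_smul (γ : SL(2, ℤ)) (u : ℍ) (r s : ℝ) :
    (((γ 0 0 * r + γ 0 1 * s) - (γ 1 0 * r + γ 1 1 * s) * (mapGL ℝ γ • u).re) ^ 2 +
      (γ 1 0 * r + γ 1 1 * s) ^ 2 * (mapGL ℝ γ • u).im ^ 2) * u.im =
    ((r - s * u.re) ^ 2 + s ^ 2 * u.im ^ 2) * (mapGL ℝ γ • u).im := by
  have hD := denom_form_pos (mapGL ℝ γ) u
  have hdet : (γ 0 0 * γ 1 1 - γ 0 1 * γ 1 0 : ℝ) = 1 := by exact_mod_cast det_eq_one_int γ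
  have := polar_transform (p := γ 0 0) (q := γ 0 1) (r := γ 1 0) (s := γ 1 1) (u₁ := r) (u₂ := s)
    (v₁ := r) (v₂ := s) (x := u.re) (y := u.im) (by simpa only [mapGL_apply_real] using hD.ne') rfl
  rw [hdet, one_mul] at this
  rw [re_smul_eq, im_smul_eq, ← det_val_eq, det_mapGL_real, abs_one, one_mul]
  simp only [mapGL_apply_real]
  rw [pow_two, pow_two ((γ 1 0 * r + γ 1 1 * s : ℝ)), this]
  ring

lemma two_le_sq_add_sq_add_sq {a b : ℤ} (h : a ≠ 0 ∨ b ≠ 0) :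
    2 ≤ a ^ 2 + b ^ 2 + (a + b) ^ 2 := by
  have h1 : a ^ 2 + b ^ 2 + (a + b) ^ 2 = 2 * (a ^ 2 + a * b + b ^ 2) := by ring
  have h2 : 0 < a ^ 2 + a * b + b ^ 2 := by
    rcases h with h | h
    · nlinarith [sq_nonneg (a + 2 * b), sq_pos_of_ne_zero h]
    · nlinarith [sq_nonneg (b + 2 * a), sq_pos_of_ne_zero h]
  omega

/-- Selling's inequality for the reduced forms attached to points of the Farey triangle. -/
lemma selling_le {γ : SL(2, ℤ)} {u : ℍ} (hv : mapGL ℝ γ • u ∈ fareyTriangle) :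
    u.im * ((mapGL ℝ γ • u).re ^ 2 + (mapGL ℝ γ • u).im ^ 2 - (mapGL ℝ γ • u).re + 1) ≤
      (mapGL ℝ γ • u).im * (u.re ^ 2 + u.im ^ 2 - u.re + 1) ∧
    ((mapGL ℝ γ • u).im * (u.re ^ 2 + u.im ^ 2 - u.re + 1) ≤
      u.im * ((mapGL ℝ γ • u).re ^ 2 + (mapGL ℝ γ • u).im ^ 2 - (mapGL ℝ γ • u).re + 1) →
      γ 0 0 ^ 2 + γ 0 1 ^ 2 + (γ 0 0 + γ 0 1) ^ 2 = 2 ∧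
      γ 1 0 ^ 2 + γ 1 1 ^ 2 + (γ 1 0 + γ 1 1) ^ 2 = 2 ∧
      (0 < (mapGL ℝ γ • u).re → (γ 0 0 - γ 1 0) ^ 2 + (γ 0 1 - γ 1 1) ^ 2 +
        ((γ 0 0 - γ 1 0) + (γ 0 1 - γ 1 1)) ^ 2 = 2)) := by
  have e1 := quadratic_form_smul γ u 1 0
  have e2 := quadratic_form_smul γ u 0 1
  have e3 := quadratic_form_smul γ u 1 1
  have hy := u.im_pos
  obtain ⟨hx0, hx1, hS⟩ := hv
  have hdet := det_eq_one_int γ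
  generalize (mapGL ℝ γ • u).re = x at *
  generalize (mapGL ℝ γ • u).im = y at *
  set a := γ 0 0
  set b := γ 0 1
  set c := γ 1 0
  set d := γ 1 1
  have r1 : 2 ≤ a ^ 2 + b ^ 2 + (a + b) ^ 2 := two_le_sq_add_sq_add_sq (by
    by_contra! h; rw [h.1, h.2] at hdet; simp at hdet)
  have r2 : 2 ≤ c ^ 2 + d ^ 2 + (c + d) ^ 2 := two_le_sq_add_sq_add_sq (by
    by_contra! h; rw [h.1, h.2] at hdet; simp at hdet)
  have r3 : 2 ≤ (a - c) ^ 2 + (b - d) ^ 2 + ((a - c) + (b - d)) ^ 2 := two_le_sq_add_sq_add_sq (by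
    by_contra! h
    have h1 : a = c := by linarith [h.1]
    have h2 : b = d := by linarith [h.2]
    rw [h1, h2] at hdet; linarith)
  have R1 : (2 : ℝ) ≤ a ^ 2 + b ^ 2 + (a + b) ^ 2 := by exact_mod_cast r1
  have R2 : (2 : ℝ) ≤ c ^ 2 + d ^ 2 + (c + d) ^ 2 := by exact_mod_cast r2
  have R3 : (2 : ℝ) ≤ (a - c) ^ 2 + (b - d) ^ 2 + ((a - c) + (b - d)) ^ 2 := by exact_mod_cast r3
  have key : y * (2 * (u.re ^ 2 + u.im ^ 2 - u.re + 1)) -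
      u.im * (2 * (x ^ 2 + y ^ 2 - x + 1)) =
      u.im * ((x * (x - 1) + y ^ 2) * (c ^ 2 + d ^ 2 + (c + d) ^ 2 - 2) +
        (1 - x) * (a ^ 2 + b ^ 2 + (a + b) ^ 2 - 2) +
        x * ((a - c) ^ 2 + (b - d) ^ 2 + ((a - c) + (b - d)) ^ 2 - 2)) := by
    linear_combination -e1 - e2 - e3
  have p1 : 0 ≤ (x * (x - 1) + y ^ 2) * (c ^ 2 + d ^ 2 + (c + d) ^ 2 - 2 : ℝ) :=
    mul_nonneg hS.le (by linarith)
  have p2 : 0 ≤ (1 - x) * (a ^ 2 + b ^ 2 + (a + b) ^ 2 - 2 : ℝ) :=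
    mul_nonneg (by linarith) (by linarith)
  have p3 : 0 ≤ x * ((a - c) ^ 2 + (b - d) ^ 2 + ((a - c) + (b - d)) ^ 2 - 2 : ℝ) :=
    mul_nonneg hx0 (by linarith)
  constructor
  · have := mul_nonneg hy.le (add_nonneg (add_nonneg p1 p2) p3)
    linarith
  · intro hle
    have h0 : u.im * ((x * (x - 1) + y ^ 2) * (c ^ 2 + d ^ 2 + (c + d) ^ 2 - 2) +
        (1 - x) * (a ^ 2 + b ^ 2 + (a + b) ^ 2 - 2) +
        x * ((a - c) ^ 2 + (b - d) ^ 2 + ((a - c) + (b - d)) ^ 2 - 2 : ℝ)) ≤ 0 := by linarith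
    have h0' := nonpos_of_mul_nonpos_right h0 hy
    have q1 : (x * (x - 1) + y ^ 2) * (c ^ 2 + d ^ 2 + (c + d) ^ 2 - 2 : ℝ) = 0 := by linarith
    have q2 : (1 - x) * (a ^ 2 + b ^ 2 + (a + b) ^ 2 - 2 : ℝ) = 0 := by linarith
    have q3 : x * ((a - c) ^ 2 + (b - d) ^ 2 + ((a - c) + (b - d)) ^ 2 - 2 : ℝ) = 0 := by linarith
    refine ⟨?_, ?_, fun hx ↦ ?_⟩
    · have := (mul_eq_zero.1 q2).resolve_left (by linarith)
      have : ((a ^ 2 + b ^ 2 + (a + b) ^ 2 : ℤ) : ℝ) = 2 := by push_cast; linarith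
      exact_mod_cast this
    · have := (mul_eq_zero.1 q1).resolve_left hS.ne'
      have : ((c ^ 2 + d ^ 2 + (c + d) ^ 2 : ℤ) : ℝ) = 2 := by push_cast; linarith
      exact_mod_cast this
    · have := (mul_eq_zero.1 q3).resolve_left hx.ne'
      have : (((a - c) ^ 2 + (b - d) ^ 2 + ((a - c) + (b - d)) ^ 2 : ℤ) : ℝ) = 2 := by
        push_cast; linarith
      exact_mod_cast this

lemma selling_eq {γ : SL(2, ℤ)} {u : ℍ} (hu : u ∈ fareyTriangle)
    (hv : mapGL ℝ γ • u ∈ fareyTriangle) :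
      γ 0 0 ^ 2 + γ 0 1 ^ 2 + (γ 0 0 + γ 0 1) ^ 2 = 2 ∧
      γ 1 0 ^ 2 + γ 1 1 ^ 2 + (γ 1 0 + γ 1 1) ^ 2 = 2 ∧
      (0 < (mapGL ℝ γ • u).re → (γ 0 0 - γ 1 0) ^ 2 + (γ 0 1 - γ 1 1) ^ 2 +
        ((γ 0 0 - γ 1 0) + (γ 0 1 - γ 1 1)) ^ 2 = 2) := by
  refine (selling_le hv).2 ?_
  have h : mapGL ℝ γ⁻¹ • mapGL ℝ γ • u = u := by rw [map_inv, inv_smul_smul]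
  have := (selling_le (γ := γ⁻¹) (u := mapGL ℝ γ • u) (by rwa [h])).1
  rwa [h] at this

lemma bounds_of_sq_sum {a b : ℤ} (h : a ^ 2 + b ^ 2 + (a + b) ^ 2 = 2) :
    -1 ≤ a ∧ a ≤ 1 ∧ -1 ≤ b ∧ b ≤ 1 := by
  refine ⟨?_, ?_, ?_, ?_⟩ <;> by_contra! hc <;> nlinarith [sq_nonneg (a + b)]

/-- A matrix that maps an interior point of the Farey triangle to another one is, up to sign, a
power of the rotation of the triangle. -/
lemma entries_of_mem_interior {γ : SL(2, ℤ)} {u : ℍ} (hu : u ∈ fareyTriangle)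
    (hv : mapGL ℝ γ • u ∈ fareyTriangle) (hv0 : 0 < (mapGL ℝ γ • u).re) :
    ∃ e : ℤ, (e = 1 ∨ e = -1) ∧
      ((γ 0 0 = e ∧ γ 0 1 = 0 ∧ γ 1 0 = 0 ∧ γ 1 1 = e) ∨
       (γ 0 0 = 0 ∧ γ 0 1 = e ∧ γ 1 0 = -e ∧ γ 1 1 = e) ∨
       (γ 0 0 = -e ∧ γ 0 1 = e ∧ γ 1 0 = -e ∧ γ 1 1 = 0)) := by
  obtain ⟨h1, h2, h3⟩ := selling_eq hu hv
  have h3 := h3 hv0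
  have hdet := det_eq_one_int γ
  obtain ⟨a1, a2, b1, b2⟩ := bounds_of_sq_sum h1
  obtain ⟨c1, c2, d1, d2⟩ := bounds_of_sq_sum h2
  clear hu hv hv0
  generalize γ 0 0 = a at *
  generalize γ 0 1 = b at *
  generalize γ 1 0 = c at *
  generalize γ 1 1 = d at *
  interval_cases a <;> interval_cases b <;> simp at h1 <;> interval_cases c <;>
    interval_cases d <;> simp at h2 h3 hdet <;> simp

/-- A matrix that maps a point of the side from `0` to `∞` into the Farey triangle is, up to sign,
the identity or `S`. -/
lemma entries_of_mem_side {γ : SL(2, ℤ)} {u : ℍ} (hu : u ∈ fareyTriangle) (hu0 : u.re = 0)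
    (hv : mapGL ℝ γ • u ∈ fareyTriangle) :
    (mapGL ℝ γ • u).re = 0 ∧ ∃ e : ℤ, (e = 1 ∨ e = -1) ∧
      ((γ 0 0 = e ∧ γ 0 1 = 0 ∧ γ 1 0 = 0 ∧ γ 1 1 = e) ∨
       (γ 0 0 = 0 ∧ γ 0 1 = -e ∧ γ 1 0 = e ∧ γ 1 1 = 0)) := by
  obtain ⟨h1, h2, -⟩ := selling_eq hu hv
  have hdet := det_eq_one_int γ
  have hdetR : (γ 0 0 * γ 1 1 - γ 0 1 * γ 1 0 : ℝ) = 1 := by exact_mod_cast hdet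
  obtain ⟨a1, a2, b1, b2⟩ := bounds_of_sq_sum h1
  obtain ⟨c1, c2, d1, d2⟩ := bounds_of_sq_sum h2
  have hD := denom_form_pos (mapGL ℝ γ) u
  obtain ⟨v1, v2, v3⟩ := hv
  have q := quadratic_form_smul γ u 0 1
  have q' := quadratic_form_smul γ u 1 0
  have hre := re_smul_eq (mapGL ℝ γ) u
  have him := im_smul_eq (mapGL ℝ γ) u
  rw [← det_val_eq, det_mapGL_real, abs_one, one_mul] at him
  have hy := u.im_pos
  rw [hu0] at hre him hD
  simp only [mapGL_apply_real] at hre him hD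
  generalize (mapGL ℝ γ • u).re = x at *
  generalize (mapGL ℝ γ • u).im = y at *
  have hy2 : 0 < u.im ^ 2 := by positivity
  generalize u.im = t at *
  clear hu hu0 q q'
  generalize γ 0 0 = a at *
  generalize γ 0 1 = b at *
  generalize γ 1 0 = c at *
  generalize γ 1 1 = d at *
  rw [eq_div_iff hD.ne'] at hre him
  interval_cases a <;> interval_cases b <;> simp at h1 <;> interval_cases c <;>
    interval_cases d <;> simp at h2 hdet <;> norm_num at hre him hD ⊢ <;>
    first
    | linarith
    | exact hre.resolve_right hy.ne'
    | (exfalso; nlinarith)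
    | (exfalso
       have e1 : (y - t * x) * (1 + t ^ 2) = 0 := by linear_combination him - t * hre
       have e2 : y = t * x := by linarith [(mul_eq_zero.1 e1).resolve_right hD.ne']
       have e3 : x * (x - 1) + (t * x) ^ 2 = 0 := by linear_combination x * hre
       rw [e2] at v3
       linarith)

/-! ### Strict fundamental domains -/

/-- The region between the vertical lines over `a` and `c` and above the geodesics from `a` to `b`
and from `b` to `c`, with the vertical lines but without these two geodesics. -/
def markovRegion (a b c : ℝ) : Set ℍ :=
  {z | a ≤ z.re ∧ z.re ≤ c ∧ 0 < (z.re - a) * (z.re - b) + z.im ^ 2 ∧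
    0 < (z.re - b) * (z.re - c) + z.im ^ 2}

/-- A set that contains exactly one point of every orbit. -/
def IsStrictDomain (F : Set ℍ) : Prop :=
  (∀ z : ℍ, ∃ g ∈ torusGL, g • z ∈ F) ∧ ∀ w ∈ F, ∀ g ∈ torusGL, g • w ∈ F → g • w = w

/-- The rotation of the Farey triangle. -/
def fareyRotation : SL(2, ℤ) := ⟨!![0, 1; -1, 1], by norm_num [Matrix.det_fin_two_of]⟩

lemma coe_fareyRotation : (fareyRotation : Matrix (Fin 2) (Fin 2) ℤ) = !![0, 1; -1, 1] := rfl

lemma fareyRotation_smul_mem {w : ℍ} (hw : w ∈ fareyTriangle) (h0 : 0 < w.re) :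
    mapGL ℝ fareyRotation • w ∈ fareyTriangle ∧ 0 < (mapGL ℝ fareyRotation • w).re := by
  obtain ⟨-, h1, h2⟩ := hw
  have hy := w.im_pos
  have e1 : (mapGL ℝ fareyRotation • w).re = (1 - w.re) / ((1 - w.re) ^ 2 + w.im ^ 2) := by
    rw [re_smul_eq]; simp only [mapGL_apply_real, coe_fareyRotation]
    simp; ring_nf
  have e2 : (mapGL ℝ fareyRotation • w).im = w.im / ((1 - w.re) ^ 2 + w.im ^ 2) := by
    rw [im_smul_eq]; simp only [mapGL_apply_real, coe_fareyRotation]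
    simp; ring_nf
  have hD : 0 < (1 - w.re) ^ 2 + w.im ^ 2 := by positivity
  have hpos : 0 < (1 - w.re) / ((1 - w.re) ^ 2 + w.im ^ 2) := div_pos (by linarith) hD
  refine ⟨⟨?_, ?_, ?_⟩, ?_⟩
  · rw [e1]; exact hpos.le
  · rw [e1, div_lt_one hD]; nlinarith
  · rw [e1, e2]
    have : (1 - w.re) / ((1 - w.re) ^ 2 + w.im ^ 2) *
        ((1 - w.re) / ((1 - w.re) ^ 2 + w.im ^ 2) - 1) +
        (w.im / ((1 - w.re) ^ 2 + w.im ^ 2)) ^ 2 = w.re / ((1 - w.re) ^ 2 + w.im ^ 2) := by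
      field_simp; ring
    rw [this]; positivity
  · rw [e1]; exact hpos

lemma S_smul_mem_fareyTriangle {w : ℍ} (h0 : w.re = 0) :
    mapGL ℝ ModularGroup.S • w ∈ fareyTriangle ∧ (mapGL ℝ ModularGroup.S • w).re = 0 := by
  have e1 : (mapGL ℝ ModularGroup.S • w).re = 0 := by
    rw [re_smul_eq]; simp only [mapGL_apply_real, ModularGroup.coe_S]
    simp [h0]
  refine ⟨⟨e1.ge, by rw [e1]; exact one_pos, ?_⟩, e1⟩
  rw [e1]
  have := (mapGL ℝ ModularGroup.S • w).im_pos
  simp only [zero_mul, zero_add]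
  positivity

lemma mem_markovRegion_of_mem_fareyTriangle {u : ℍ} (hu : u ∈ fareyTriangle) {n j : ℤ}
    (hj : j = n ∨ j = n + 1 ∨ (j = n + 2 ∧ u.re = 0)) :
    mapGL ℝ (ModularGroup.T ^ j) • u ∈ markovRegion n (n + 1) (n + 2) := by
  obtain ⟨h0, h1, h2⟩ := hu
  have hy := u.im_pos
  unfold markovRegion
  rw [Set.mem_ofPred_eq, mapGL_T_zpow_smul_re, mapGL_T_zpow_smul_im]
  rcases hj with rfl | rfl | ⟨rfl, h⟩
  · refine ⟨by linarith, by linarith, by nlinarith, by nlinarith⟩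
  · push_cast
    refine ⟨by linarith, by linarith, by nlinarith, by nlinarith⟩
  · push_cast
    rw [h]
    refine ⟨by linarith, by linarith, by nlinarith, by nlinarith⟩

lemma exists_of_mem_markovRegion {n : ℤ} {w : ℍ} (hw : w ∈ markovRegion n (n + 1) (n + 2)) :
    ∃ j : ℤ, ∃ u ∈ fareyTriangle, w = mapGL ℝ (ModularGroup.T ^ j) • u ∧
      (j = n ∨ j = n + 1 ∨ (j = n + 2 ∧ u.re = 0)) := by
  obtain ⟨h1, h2, h3, h4⟩ := hw
  have key : ∀ j : ℤ, (0 ≤ w.re - j ∧ w.re - j < 1 ∧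
      0 < (w.re - j) * (w.re - j - 1) + w.im ^ 2) →
      mapGL ℝ (ModularGroup.T ^ (-j)) • w ∈ fareyTriangle := by
    intro j hj
    unfold fareyTriangle
    rw [Set.mem_ofPred_eq, mapGL_T_zpow_smul_re, mapGL_T_zpow_smul_im]
    push_cast
    simpa [← sub_eq_add_neg] using hj
  have key2 : ∀ j : ℤ, w = mapGL ℝ (ModularGroup.T ^ j) • mapGL ℝ (ModularGroup.T ^ (-j)) • w := by
    intro j
    rw [← mul_smul, ← map_mul, ← _root_.zpow_add]; simp
  have hy := w.im_pos
  rcases lt_or_ge w.re (n + 1) with h | h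
  · exact ⟨n, _, key n ⟨by linarith, by linarith, by nlinarith⟩, key2 n, Or.inl rfl⟩
  rcases lt_or_ge w.re (n + 2) with h' | h'
  · refine ⟨n + 1, _, key (n + 1) ?_, key2 _, Or.inr (Or.inl rfl)⟩
    push_cast
    exact ⟨by linarith, by linarith, by nlinarith⟩
  · refine ⟨n + 2, _, key (n + 2) ?_, key2 _, Or.inr (Or.inr ⟨rfl, ?_⟩)⟩
    · push_cast
      exact ⟨by linarith, by linarith, by nlinarith⟩
    · rw [mapGL_T_zpow_smul_re]; push_cast; linarith

lemma sl2_mul_apply (g h : SL(2, ℤ)) (i k : Fin 2) :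
    (g * h) i k = g i 0 * h 0 k + g i 1 * h 1 k := by
  have : (g * h) i k = ((g : Matrix (Fin 2) (Fin 2) ℤ) * (h : Matrix (Fin 2) (Fin 2) ℤ)) i k := rfl
  rw [this, Matrix.mul_apply, Fin.sum_univ_two]

lemma torusCongruence_T_mul_mul_T (δ : SL(2, ℤ)) (i j : ℤ) :
    TorusCongruence (ModularGroup.T ^ j * δ * ModularGroup.T ^ (-i)) ↔
    (¬ 2 ∣ δ 0 0 + j * δ 1 0 + (δ 1 1 - i * δ 1 0) ∨
      2 ∣ δ 0 1 + j * δ 1 1 - i * (δ 0 0 + j * δ 1 0) ∧ 2 ∣ δ 1 0) ∧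
    (3 ∣ δ 0 0 + j * δ 1 0 + (δ 1 1 - i * δ 1 0) ∨
      3 ∣ δ 0 1 + j * δ 1 1 - i * (δ 0 0 + j * δ 1 0) ∧ 3 ∣ δ 1 0) := by
  have e00 : (ModularGroup.T ^ j * δ * ModularGroup.T ^ (-i)) 0 0 = δ 0 0 + j * δ 1 0 := by
    simp only [sl2_mul_apply, ModularGroup.coe_T_zpow]
    simp
  have e01 : (ModularGroup.T ^ j * δ * ModularGroup.T ^ (-i)) 0 1 =
      δ 0 1 + j * δ 1 1 - i * (δ 0 0 + j * δ 1 0) := by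
    simp only [sl2_mul_apply, ModularGroup.coe_T_zpow]
    simp
    ring
  have e10 : (ModularGroup.T ^ j * δ * ModularGroup.T ^ (-i)) 1 0 = δ 1 0 := by
    simp only [sl2_mul_apply, ModularGroup.coe_T_zpow]
    simp
  have e11 : (ModularGroup.T ^ j * δ * ModularGroup.T ^ (-i)) 1 1 = δ 1 1 - i * δ 1 0 := by
    simp only [sl2_mul_apply, ModularGroup.coe_T_zpow]
    simp
    ring
  rw [torusCongruence_iff_dvd, e00, e01, e10, e11]

lemma isStrictDomain_base (n : ℤ) : IsStrictDomain (markovRegion n (n + 1) (n + 2)) := by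
  constructor
  · intro z
    obtain ⟨η, hη⟩ := exists_smul_mem_fareyTriangle z
    obtain ⟨g, hg, i, hi⟩ := exists_eq_mul_T_zpow η⁻¹
    have hC : ModularGroup.T ^ i * η ∈ torusGroupPM := by
      have : ModularGroup.T ^ i * η = g⁻¹ := by
        rw [eq_inv_mul_of_mul_eq hi.symm]; simp
      rw [this]; exact inv_mem (modularTorusGroup_le hg)
    have key : ∀ (δ : SL(2, ℤ)) (j : ℤ),
        TorusCongruence (ModularGroup.T ^ j * δ * ModularGroup.T ^ (-i)) →
        mapGL ℝ δ • mapGL ℝ η • z ∈ fareyTriangle →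
        (j = n ∨ j = n + 1 ∨ (j = n + 2 ∧ (mapGL ℝ δ • mapGL ℝ η • z).re = 0)) →
        ∃ g ∈ torusGL, g • z ∈ markovRegion n (n + 1) (n + 2) := by
      intro δ j hδ hm hj
      refine ⟨_, ⟨_, mul_mem hδ hC, rfl⟩, ?_⟩
      have : ModularGroup.T ^ j * δ * ModularGroup.T ^ (-i) * (ModularGroup.T ^ i * η) =
          ModularGroup.T ^ j * δ * η := by simp [mul_assoc]
      rw [this, map_mul, map_mul, mul_smul, mul_smul]
      exact mem_markovRegion_of_mem_fareyTriangle hm hj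
    rcases hη.1.eq_or_lt with h0 | h0
    · have : ∃ j : ℤ, (j = n ∨ j = n + 1 ∨ j = n + 2) ∧ (6 ∣ j - i ∨ 6 ∣ j - i - 3) := by
        have : (n - i) % 3 = 0 ∨ (n - i) % 3 = 1 ∨ (n - i) % 3 = 2 := by omega
        rcases this with h | h | h
        · exact ⟨n, by simp, by omega⟩
        · exact ⟨n + 2, by simp, by omega⟩
        · exact ⟨n + 1, by simp, by omega⟩
      obtain ⟨j, hj, h | h⟩ := this
      · refine key 1 j ?_ (by simpa using hη) (by simpa [← h0] using hj)
        rw [torusCongruence_T_mul_mul_T]; simp; omega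
      · obtain ⟨hS1, hS2⟩ := S_smul_mem_fareyTriangle h0.symm
        refine key ModularGroup.S j ?_ hS1 (by simpa [hS2] using hj)
        rw [torusCongruence_T_mul_mul_T]; simp [ModularGroup.coe_S]; omega
    · have : ∃ j : ℤ, (j = n ∨ j = n + 1) ∧ (6 ∣ j - i ∨ 6 ∣ j - i - 4 ∨ 6 ∣ j - i - 2) := by
        have : (n - i) % 2 = 0 ∨ (n - i) % 2 = 1 := by omega
        rcases this with h | h
        · exact ⟨n, by simp, by omega⟩
        · exact ⟨n + 1, by simp, by omega⟩
      obtain ⟨hR, hR0⟩ := fareyRotation_smul_mem hη h0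
      obtain ⟨hRR, hRR0⟩ := fareyRotation_smul_mem hR hR0
      obtain ⟨j, hj, h | h | h⟩ := this
      · refine key 1 j ?_ (by simpa using hη) (by tauto)
        rw [torusCongruence_T_mul_mul_T]; simp; omega
      · refine key fareyRotation j ?_ hR (by tauto)
        rw [torusCongruence_T_mul_mul_T]; simp [coe_fareyRotation]; omega
      · refine key (fareyRotation * fareyRotation) j ?_ (by rwa [map_mul, mul_smul]) (by tauto)
        rw [torusCongruence_T_mul_mul_T]
        simp [coe_fareyRotation, Matrix.mul_apply, Fin.sum_univ_two]; omega
  · rintro w hw _ ⟨γ, hγ, rfl⟩ hγw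
    obtain ⟨i, u, hu, rfl, hi⟩ := exists_of_mem_markovRegion hw
    obtain ⟨j, v, hv, hv', hj⟩ := exists_of_mem_markovRegion hγw
    have e : mapGL ℝ (ModularGroup.T ^ (-j) * γ * ModularGroup.T ^ i) • u = v := by
      rw [map_mul, map_mul, mul_smul, mul_smul, hv', ← mul_smul, ← map_mul, ← _root_.zpow_add]
      simp
    have eγ : γ = ModularGroup.T ^ j * (ModularGroup.T ^ (-j) * γ * ModularGroup.T ^ i) *
        ModularGroup.T ^ (-i) := by simp [mul_assoc]
    generalize ModularGroup.T ^ (-j) * γ * ModularGroup.T ^ i = δ at *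
    subst e
    have hγ' : TorusCongruence γ := hγ
    rw [eγ, torusCongruence_T_mul_mul_T] at hγ'
    have fin : j = i → (δ 0 1 = 0 ∧ δ 1 0 = 0 ∧ δ 0 0 = δ 1 1) →
        mapGL ℝ γ • mapGL ℝ (ModularGroup.T ^ i) • u = mapGL ℝ (ModularGroup.T ^ i) • u := by
      rintro rfl ⟨h1, h2, h3⟩
      rw [hv', smul_of_eq_one_or_neg_one (eq_one_or_neg_one_of_entries h1 h2 h3)]
    rcases hu.1.eq_or_lt with h0 | h0
    · obtain ⟨hv0, ε, hε, ⟨h1, h2, h3, h4⟩ | ⟨h1, h2, h3, h4⟩⟩ := entries_of_mem_side hu h0.symm hv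
      · refine fin ?_ ⟨h2, h3, h1.trans h4.symm⟩
        rw [h1, h2, h3, h4] at hγ'
        rcases hε with rfl | rfl <;> simp at hγ' <;> omega
      · exfalso
        rw [h1, h2, h3, h4] at hγ'
        rcases hε with rfl | rfl <;> simp at hγ' <;> omega
    · have hv0 : 0 < (mapGL ℝ δ • u).re := by
        refine lt_of_le_of_ne hv.1 fun h ↦ h0.ne' ?_
        have h1 : mapGL ℝ δ⁻¹ • mapGL ℝ δ • u = u := by rw [map_inv, inv_smul_smul]
        have := (entries_of_mem_side (γ := δ⁻¹) hv h.symm (by rwa [h1])).1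
        rwa [h1] at this
      obtain ⟨ε, hε, ⟨h1, h2, h3, h4⟩ | ⟨h1, h2, h3, h4⟩ | ⟨h1, h2, h3, h4⟩⟩ :=
        entries_of_mem_interior hu hv hv0
      · refine fin ?_ ⟨h2, h3, h1.trans h4.symm⟩
        rw [h1, h2, h3, h4] at hγ'
        rcases hε with rfl | rfl <;> simp at hγ' <;> omega
      · exfalso
        rw [h1, h2, h3, h4] at hγ'
        have hi' : i = n ∨ i = n + 1 := by rcases hi with h | h | h <;> simp_all
        have hj' : j = n ∨ j = n + 1 := by rcases hj with h | h | h <;> simp_all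
        rcases hε with rfl | rfl <;> simp at hγ' <;> omega
      · exfalso
        rw [h1, h2, h3, h4] at hγ'
        have hi' : i = n ∨ i = n + 1 := by rcases hi with h | h | h <;> simp_all
        have hj' : j = n ∨ j = n + 1 := by rcases hj with h | h | h <;> simp_all
        rcases hε with rfl | rfl <;> simp at hγ' <;> omega

/-- Cutting off a piece of a strict domain and moving it by an element of the group. -/
lemma IsStrictDomain.of_cut {F F' P Q : Set ℍ} (hF' : IsStrictDomain F') (hF : F = P ∪ Q)
    {g : GL (Fin 2) ℝ} (hg : g ∈ torusGL) (hFF' : ∀ z, z ∈ F' ↔ z ∈ P ∨ g⁻¹ • z ∈ Q)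
    (hPQ : ∀ z ∈ P, g⁻¹ • z ∉ Q) : IsStrictDomain F := by
  subst hF
  have hQ : ∀ q ∈ Q, g • q ∈ F' := fun q hq ↦ (hFF' _).2 (Or.inr (by rwa [inv_smul_smul]))
  have hP : ∀ q ∈ P, q ∈ F' := fun q hq ↦ (hFF' _).2 (Or.inl hq)
  constructor
  · intro z
    obtain ⟨k, hk, h⟩ := hF'.1 z
    rcases (hFF' _).1 h with h | h
    · exact ⟨k, hk, Or.inl h⟩
    · exact ⟨g⁻¹ * k, mul_mem (inv_mem hg) hk, Or.inr (by rwa [mul_smul])⟩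
  · rintro w (hw | hw) k hk (hkw | hkw)
    · exact hF'.2 w (hP w hw) k hk (hP _ hkw)
    · have := hF'.2 w (hP w hw) (g * k) (mul_mem hg hk) (by rw [mul_smul]; exact hQ _ hkw)
      refine absurd ?_ (hPQ w hw)
      rw [← this, mul_smul, inv_smul_smul]; exact hkw
    · have h1 : (k * g⁻¹) • (g • w) = k • w := by rw [mul_smul, inv_smul_smul]
      have := hF'.2 (g • w) (hQ w hw) (k * g⁻¹) (mul_mem hk (inv_mem hg)) (by
        rw [h1]; exact hP _ hkw)
      rw [h1] at this
      refine absurd ?_ (hPQ _ hkw)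
      rw [this, inv_smul_smul]; exact hw
    · have h1 : (g * k * g⁻¹) • (g • w) = g • (k • w) := by
        rw [mul_smul, mul_smul, inv_smul_smul]
      have := hF'.2 (g • w) (hQ w hw) (g * k * g⁻¹) (mul_mem (mul_mem hg hk) (inv_mem hg)) (by
        rw [h1]; exact hQ _ hkw)
      rw [h1] at this
      exact smul_left_cancel _ this

/-! ### Markov numbers -/

/-- Hurwitz: `a² + b² + c² = 3 k a b c` has no positive solutions for `k ≥ 2`. -/
lemma hurwitz_of_max {k : ℤ} (hk : 2 ≤ k) {a b c : ℤ} (ha : 0 < a) (hb : 0 < b) (hc : 0 < c)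
    (h : a ^ 2 + b ^ 2 + c ^ 2 = 3 * k * (a * b * c)) (hac : a ≤ c) (hbc : b ≤ c) :
    0 < 3 * k * a * b - c ∧ 3 * k * a * b - c < c ∧
      a ^ 2 + b ^ 2 + (3 * k * a * b - c) ^ 2 = 3 * k * (a * b * (3 * k * a * b - c)) := by
  have hprod : c * (3 * k * a * b - c) = a ^ 2 + b ^ 2 := by linarith
  have hpos : 0 < 3 * k * a * b - c := by
    have : 0 < c * (3 * k * a * b - c) := by rw [hprod]; positivity
    exact pos_of_mul_pos_right this hc.le
  refine ⟨hpos, ?_, by linear_combination h⟩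
  by_contra! hle
  have key : ∀ m l : ℤ, 0 < l → l ≤ m → m ≤ c → l * m = a * b → m ^ 2 + l ^ 2 = a ^ 2 + b ^ 2 →
      False := by
    intro m l hl hlm hmc h1 h2
    have h3 : 0 ≤ (c - m) * ((3 * k * a * b - c) - m) :=
      mul_nonneg (by linarith) (by linarith)
    have h4 : (c - m) * ((3 * k * a * b - c) - m) = m ^ 2 + l ^ 2 - 3 * k * (l * m) * m + m ^ 2 := by
      linear_combination hprod - h2 + 3 * k * m * h1
    have h5 : m ^ 2 ≤ l * m * m := by nlinarith
    have h6 : 0 < m ^ 2 := pow_pos (by linarith) 2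
    have h7 : l ^ 2 ≤ m ^ 2 := by nlinarith
    nlinarith
  rcases le_total a b with hab | hab
  · exact key b a ha hab hbc rfl (by ring)
  · exact key a b hb hab hac (by ring) (by ring)

lemma hurwitz {k : ℤ} (hk : 2 ≤ k) (N : ℕ) : ∀ a b c : ℤ, 0 < a → 0 < b → 0 < c →
    a ^ 2 + b ^ 2 + c ^ 2 = 3 * k * (a * b * c) → (a + b + c).toNat ≤ N → False := by
  induction N with
  | zero => intro a b c ha hb hc _ h; omega
  | succ N ih =>
    intro a b c ha hb hc h hN
    by_cases h1 : a ≤ c ∧ b ≤ c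
    · obtain ⟨p1, p2, p3⟩ := hurwitz_of_max hk ha hb hc h h1.1 h1.2
      exact ih a b _ ha hb p1 p3 (by omega)
    by_cases h2 : a ≤ b ∧ c ≤ b
    · obtain ⟨p1, p2, p3⟩ := hurwitz_of_max hk ha hc hb (by linear_combination h) h2.1 h2.2
      exact ih a c _ ha hc p1 p3 (by omega)
    · obtain ⟨p1, p2, p3⟩ := hurwitz_of_max hk hb hc ha (by linear_combination h)
        (by omega) (by omega)
      exact ih b c _ hb hc p1 p3 (by omega)

/-- Integers `p₁, p₂, p₃, q₁, q₂, q₃` as in the definition of a rational Markov triple. -/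
structure IsMarkovData (p₁ p₂ p₃ q₁ q₂ q₃ : ℤ) : Prop where
  pos₁ : 0 < q₁
  pos₂ : 0 < q₂
  pos₃ : 0 < q₃
  markov : q₁ ^ 2 + q₂ ^ 2 + q₃ ^ 2 = 3 * q₁ * q₂ * q₃
  det₁₂ : p₂ * q₁ - p₁ * q₂ = q₃
  det₂₃ : p₃ * q₂ - p₂ * q₃ = q₁

namespace IsMarkovData

variable {p₁ p₂ p₃ q₁ q₂ q₃ : ℤ}

lemma det₁₃ (h : IsMarkovData p₁ p₂ p₃ q₁ q₂ q₃) : p₃ * q₁ - p₁ * q₃ = 3 * q₁ * q₃ - q₂ := by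
  have := h.pos₂
  have e : q₂ * (p₃ * q₁ - p₁ * q₃) = q₂ * (3 * q₁ * q₃ - q₂) := by
    linear_combination q₁ * h.det₂₃ + q₃ * h.det₁₂ + h.markov
  exact mul_left_cancel₀ this.ne' e

lemma rotate (h : IsMarkovData p₁ p₂ p₃ q₁ q₂ q₃) :
    IsMarkovData p₂ p₃ (p₁ + 3 * q₁) q₂ q₃ q₁ :=
  ⟨h.pos₂, h.pos₃, h.pos₁, by linear_combination h.markov, h.det₂₃, by
    linear_combination -h.det₁₃⟩

lemma prod_pos (h : IsMarkovData p₁ p₂ p₃ q₁ q₂ q₃) : 0 < 3 * q₁ * q₃ - q₂ := by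
  have := h.pos₁
  have := h.pos₂
  have e : q₂ * (3 * q₁ * q₃ - q₂) = q₁ ^ 2 + q₃ ^ 2 := by linear_combination -h.markov
  have : 0 < q₂ * (3 * q₁ * q₃ - q₂) := by rw [e]; positivity
  exact pos_of_mul_pos_right this h.pos₂.le

lemma flip (h : IsMarkovData p₁ p₂ p₃ q₁ q₂ q₃) :
    IsMarkovData (3 * p₁ * q₃ - p₂) p₁ p₃ (3 * q₁ * q₃ - q₂) q₁ q₃ :=
  ⟨h.prod_pos, h.pos₁, h.pos₃, by linear_combination h.markov, by
    linear_combination h.det₁₂, by linear_combination h.det₁₃⟩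

lemma flip_lt (h : IsMarkovData p₁ p₂ p₃ q₁ q₂ q₃) (h₁ : q₁ ≤ q₂) (h₃ : q₃ ≤ q₂)
    (hne : ¬ (q₁ = 1 ∧ q₂ = 1 ∧ q₃ = 1)) : 3 * q₁ * q₃ - q₂ < q₂ := by
  have hp1 := h.pos₁
  have hp3 := h.pos₃
  have hprod : q₂ * (3 * q₁ * q₃ - q₂) = q₁ ^ 2 + q₃ ^ 2 := by linear_combination -h.markov
  by_contra! hle
  have key : ∀ m l : ℤ, 0 < l → l ≤ m → m ≤ q₂ → l * m = q₁ * q₃ →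
      m ^ 2 + l ^ 2 = q₁ ^ 2 + q₃ ^ 2 → (m = 1 → q₁ = 1 ∧ q₃ = 1) → False := by
    intro m l hl hlm hmc h1 h2 hm1
    have h3 : 0 ≤ (q₂ - m) * ((3 * q₁ * q₃ - q₂) - m) :=
      mul_nonneg (by linarith) (by linarith)
    have h4 : (q₂ - m) * ((3 * q₁ * q₃ - q₂) - m) = m ^ 2 + l ^ 2 - 3 * (l * m) * m + m ^ 2 := by
      linear_combination hprod - h2 + 3 * m * h1
    have h5 : m ^ 2 ≤ l * m * m := by nlinarith
    have h6 : 0 < m ^ 2 := pow_pos (by linarith) 2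
    have h7 : l ^ 2 ≤ m ^ 2 := by nlinarith
    rcases eq_or_lt_of_le (show 1 ≤ m by linarith) with hm | hm
    · obtain ⟨rfl, rfl⟩ := hm1 hm.symm
      apply hne
      refine ⟨rfl, ?_, rfl⟩
      have : (q₂ - 1) * (q₂ - 2) = 0 := by linear_combination -hprod
      rcases mul_eq_zero.1 this with h | h <;> linarith
    · have : l ^ 2 < l * m * m ∨ l = m := by
        rcases eq_or_lt_of_le hlm with h | h
        · exact Or.inr h
        · left; nlinarith
      rcases this with h8 | rfl
      · linarith
      · nlinarith
  rcases le_total q₁ q₃ with h13 | h13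
  · exact key q₃ q₁ hp1 h13 h₃ rfl (by ring) (fun h ↦ ⟨by omega, h⟩)
  · exact key q₁ q₃ hp3 h13 h₁ (by ring) (by ring) (fun h ↦ ⟨h, by omega⟩)

lemma isCoprime₁₂ (h : IsMarkovData p₁ p₂ p₃ q₁ q₂ q₃) : IsCoprime q₁ q₂ := by
  have h1 := h.pos₁
  have h2 := h.pos₂
  have h3 := h.pos₃
  obtain ⟨a, ha⟩ := Int.gcd_dvd_left q₁ q₂
  obtain ⟨b, hb⟩ := Int.gcd_dvd_right q₁ q₂
  have hd : 0 < (Int.gcd q₁ q₂ : ℤ) := by exact_mod_cast Int.gcd_pos_of_ne_zero_left _ h1.ne'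
  rw [Int.isCoprime_iff_gcd_eq_one]
  have hm := h.markov
  have hdet := h.det₁₂
  generalize Int.gcd q₁ q₂ = d at *
  by_contra hd1
  have hd2 : 2 ≤ (d : ℤ) := by omega
  set c := p₂ * a - p₁ * b with hc
  have hq3 : q₃ = d * c := by rw [← hdet, ha, hb, hc]; ring
  have ha0 : 0 < a := pos_of_mul_pos_right (ha ▸ h1) hd.le
  have hb0 : 0 < b := pos_of_mul_pos_right (hb ▸ h2) hd.le
  have hc0 : 0 < c := pos_of_mul_pos_right (hq3 ▸ h3) hd.le
  refine hurwitz hd2 _ a b c ha0 hb0 hc0 ?_ le_rfl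
  rw [ha, hb, hq3] at hm
  have hd0 : (d : ℤ) ^ 2 ≠ 0 := by positivity
  refine mul_left_cancel₀ hd0 ?_
  linear_combination hm

lemma dvd₁ (h : IsMarkovData p₁ p₂ p₃ q₁ q₂ q₃) : q₁ ∣ p₁ ^ 2 + 1 := by
  have hcop : IsCoprime q₁ (q₂ ^ 2) := h.isCoprime₁₂.pow_right
  refine hcop.dvd_of_dvd_mul_left ?_
  have hm := h.markov
  have hd := h.det₁₂
  refine ⟨3 * q₂ * q₃ - q₁ + p₂ * (p₂ * q₁ - 2 * q₃), ?_⟩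
  linear_combination hm - (p₁ * q₂ + p₂ * q₁ - q₃) * hd

lemma dvd₃ (h : IsMarkovData p₁ p₂ p₃ q₁ q₂ q₃) : q₃ ∣ p₃ ^ 2 + 1 :=
  h.rotate.rotate.dvd₁

end IsMarkovData

/-! ### Side pairings -/

/-- For `q ∣ p² + 1` the group contains a map that takes `p / q` to `∞` and `∞` to `p / q + 3`. -/
lemma exists_side_pairing {p q : ℤ} (hq : 0 < q) (h : q ∣ p ^ 2 + 1) :
    ∃ g ∈ torusGL, ∃ b : ℤ, q * b = -(1 + p ^ 2 + 3 * p * q) ∧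
      g 0 0 = p + 3 * q ∧ g 0 1 = b ∧ g 1 0 = q ∧ g 1 1 = -p := by
  obtain ⟨m, hm⟩ := h
  have hdet : (p + 3 * q) * -p - (-(m + 3 * p)) * q = 1 := by linear_combination -hm
  let γ : SL(2, ℤ) := ⟨!![p + 3 * q, -(m + 3 * p); q, -p], by
    rw [Matrix.det_fin_two_of]; exact hdet⟩
  have e00 : γ 0 0 = p + 3 * q := rfl
  have e01 : γ 0 1 = -(m + 3 * p) := rfl
  have e10 : γ 1 0 = q := rfl
  have e11 : γ 1 1 = -p := rfl
  refine ⟨mapGL ℝ γ, ⟨γ, ?_, rfl⟩, -(m + 3 * p), by linear_combination hm, ?_, ?_, ?_, ?_⟩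
  · change TorusCongruence γ
    rw [torusCongruence_iff_dvd, e00, e01, e10, e11]
    refine ⟨?_, Or.inl ⟨q, by ring⟩⟩
    by_cases hq2 : 2 ∣ q
    · right
      refine ⟨?_, hq2⟩
      obtain ⟨r, rfl⟩ := hq2
      have hpodd : p % 2 = 1 := by
        rcases Int.emod_two_eq_zero_or_one p with h0 | h0
        · exfalso
          obtain ⟨s, rfl⟩ : 2 ∣ p := Int.dvd_of_emod_eq_zero h0
          have : 4 * s ^ 2 + 1 = 2 * (r * m) := by linear_combination hm
          omega
        · exact h0
      have hmodd : m % 2 = 1 := by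
        obtain ⟨s, hs⟩ : ∃ s, p = 2 * s + 1 := ⟨p / 2, by omega⟩
        have h1 : 2 * (s ^ 2 + s) + 1 = r * m := by
          rw [hs] at hm; nlinarith
        rcases Int.emod_two_eq_zero_or_one m with h0 | h0
        · exfalso
          obtain ⟨t, rfl⟩ : 2 ∣ m := Int.dvd_of_emod_eq_zero h0
          have : 2 * (s ^ 2 + s) + 1 = 2 * (r * t) := by linear_combination h1
          omega
        · exact h0
      omega
    · left; omega
  · rw [mapGL_apply_real, e00]; push_cast; ring
  · rw [mapGL_apply_real, e01]
  · rw [mapGL_apply_real, e10]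
  · rw [mapGL_apply_real, e11]; push_cast; ring

/-- The side pairing in coordinates. -/
lemma exists_side_pairing' {p q : ℤ} (hq : 0 < q) (h : q ∣ p ^ 2 + 1) :
    ∃ g ∈ torusGL, g • (((p : ℝ) / q : ℝ) : OnePoint ℝ) = OnePoint.infty ∧
      g • (OnePoint.infty : OnePoint ℝ) = (((p : ℝ) / q + 3 : ℝ) : OnePoint ℝ) ∧
      ∀ t : ℝ, t ≠ (p : ℝ) / q → g • (t : OnePoint ℝ) =
        (((p : ℝ) / q + 3 - 1 / ((q : ℝ) ^ 2 * (t - (p : ℝ) / q)) : ℝ) : OnePoint ℝ) := by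
  obtain ⟨g, hg, b, hb, h00, h01, h10, h11⟩ := exists_side_pairing hq h
  have hqR : (q : ℝ) ≠ 0 := by exact_mod_cast hq.ne'
  have hbR : (q : ℝ) * b = -(1 + p ^ 2 + 3 * p * q) := by exact_mod_cast hb
  refine ⟨g, hg, ?_, ?_, fun t ht ↦ ?_⟩
  · rw [OnePoint.smul_some_eq_ite, if_pos]
    rw [h10, h11]; field_simp; ring
  · rw [OnePoint.smul_infty_eq_ite, if_neg (by rw [h10]; exact hqR), h00, h10]
    congr 1; field_simp
  · have ht' : t - (p : ℝ) / q ≠ 0 := sub_ne_zero.2 ht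
    have hden : (q : ℝ) * t + -p ≠ 0 := by
      intro h0; apply ht'; field_simp; linarith
    have e : t - (p : ℝ) / q = (q * t + -p) / q := by field_simp; ring
    rw [OnePoint.smul_some_eq_ite, if_neg (by rw [h10, h11]; exact hden), h00, h01, h10, h11, e]
    congr 1
    rw [div_eq_iff hden]
    field_simp
    linear_combination hbR

/-! ### Rational Markov triples give ideal triangulations -/

lemma omega_inv_smul_neg_iff {g : GL (Fin 2) ℝ} (hg : 0 < g.det.val) {a b : OnePoint ℝ} {z : ℍ} :
    omega a b (g⁻¹ • z) < 0 ↔ omega (g • a) (g • b) z < 0 := by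
  rw [← omega_smul_neg_iff hg, smul_inv_smul]

lemma omega_inv_smul_nonpos_iff {g : GL (Fin 2) ℝ} (hg : 0 < g.det.val) {a b : OnePoint ℝ}
    {z : ℍ} : omega a b (g⁻¹ • z) ≤ 0 ↔ omega (g • a) (g • b) z ≤ 0 := by
  rw [← omega_smul_nonpos_iff hg, smul_inv_smul]

lemma omega_coe_coe_neg_iff {s t : ℝ} (h : s < t) {z : ℍ} :
    omega s t z < 0 ↔ 0 < (z.re - s) * (z.re - t) + z.im ^ 2 := by
  rw [omega_coe_coe]
  constructor <;> intro h' <;> nlinarith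

lemma IsStrictDomain.of_rotate {a b c d : ℝ} (hab : a < b) (hbc : b < c) (hcd : c < d)
    (h : IsStrictDomain (markovRegion b c d)) {g : GL (Fin 2) ℝ} (hg : g ∈ torusGL)
    (ha : g • (a : OnePoint ℝ) = OnePoint.infty) (hb : g • (b : OnePoint ℝ) = (c : OnePoint ℝ))
    (hi : g • (OnePoint.infty : OnePoint ℝ) = (d : OnePoint ℝ)) :
    IsStrictDomain (markovRegion a b c) := by
  have hdet := det_pos_of_mem hg
  have hQ : ∀ z : ℍ, g⁻¹ • z ∈ {u : ℍ | a ≤ u.re ∧ u.re < b ∧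
      0 < (u.re - a) * (u.re - b) + u.im ^ 2} ↔
      z.re ≤ d ∧ c < z.re ∧ 0 < (z.re - c) * (z.re - d) + z.im ^ 2 := by
    intro z
    have e1 := omega_inv_smul_nonpos_iff (a := OnePoint.infty) (b := a) (z := z) hdet
    have e2 := omega_inv_smul_neg_iff (a := a) (b := b) (z := z) hdet
    have e3 := omega_inv_smul_neg_iff (a := b) (b := OnePoint.infty) (z := z) hdet
    rw [ha, hi, omega_infty_coe, omega_coe_infty, sub_nonpos, sub_nonpos] at e1
    rw [ha, hb, omega_coe_coe_neg_iff hab, omega_infty_coe, sub_neg] at e2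
    rw [hi, hb, omega_coe_infty, omega_coe_coe_neg_iff hcd, sub_neg] at e3
    rw [Set.mem_ofPred_eq, e1, e2, e3]
    tauto
  refine h.of_cut (P := {z | b ≤ z.re ∧ z.re ≤ c ∧ 0 < (z.re - b) * (z.re - c) + z.im ^ 2})
    (Q := {u : ℍ | a ≤ u.re ∧ u.re < b ∧ 0 < (u.re - a) * (u.re - b) + u.im ^ 2}) ?_ hg ?_ ?_
  · ext z
    have hy := sq_pos_of_pos z.im_pos
    simp only [markovRegion, Set.mem_ofPred_eq, Set.mem_union]
    constructor
    · rintro ⟨h1, h2, h3, h4⟩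
      rcases lt_or_ge z.re b with hz | hz
      · exact Or.inr ⟨h1, hz, h3⟩
      · exact Or.inl ⟨hz, h2, h4⟩
    · rintro (⟨h1, h2, h3⟩ | ⟨h1, h2, h3⟩)
      · exact ⟨by linarith, h2, by nlinarith, h3⟩
      · exact ⟨h1, by linarith, h3, by nlinarith⟩
  · intro z
    have hy := sq_pos_of_pos z.im_pos
    rw [hQ]
    simp only [markovRegion, Set.mem_ofPred_eq]
    constructor
    · rintro ⟨h1, h2, h3, h4⟩
      rcases le_or_gt z.re c with hz | hz
      · exact Or.inl ⟨h1, hz, h3⟩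
      · exact Or.inr ⟨h2, hz, h4⟩
    · rintro (⟨h1, h2, h3⟩ | ⟨h1, h2, h3⟩)
      · exact ⟨h1, by linarith, h3, by nlinarith⟩
      · exact ⟨by linarith, h1, by nlinarith, h3⟩
  · rintro z ⟨-, h1, -⟩ hz
    exact absurd ((hQ z).1 hz).2.1 (not_lt.2 h1)

lemma IsStrictDomain.of_flip {o a b c : ℝ} (hoa : o < a) (hab : a < b) (hbc : b < c)
    (h : IsStrictDomain (markovRegion o a c)) {g : GL (Fin 2) ℝ} (hg : g ∈ torusGL)
    (ha : g • (a : OnePoint ℝ) = (o : OnePoint ℝ)) (hb : g • (b : OnePoint ℝ) = (a : OnePoint ℝ))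
    (hc : g • (c : OnePoint ℝ) = OnePoint.infty) :
    IsStrictDomain (markovRegion a b c) := by
  have hdet := det_pos_of_mem hg
  have hac := hab.trans hbc
  have hQ : ∀ z : ℍ, g⁻¹ • z ∈ {u : ℍ | (u.re - a) * (u.re - c) + u.im ^ 2 ≤ 0 ∧
      0 < (u.re - a) * (u.re - b) + u.im ^ 2 ∧ 0 < (u.re - b) * (u.re - c) + u.im ^ 2} ↔
      o ≤ z.re ∧ z.re < a ∧ 0 < (z.re - o) * (z.re - a) + z.im ^ 2 := by
    intro z
    have e1 := omega_inv_smul_nonpos_iff (a := c) (b := a) (z := z) hdet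
    have e2 := omega_inv_smul_neg_iff (a := a) (b := b) (z := z) hdet
    have e3 := omega_inv_smul_neg_iff (a := b) (b := c) (z := z) hdet
    have e1' : omega c a (g⁻¹ • z) ≤ 0 ↔
        ((g⁻¹ • z).re - a) * ((g⁻¹ • z).re - c) + (g⁻¹ • z).im ^ 2 ≤ 0 := by
      rw [omega_coe_coe]; constructor <;> intro h' <;> nlinarith
    rw [ha, hc, omega_infty_coe, sub_nonpos, e1'] at e1
    rw [ha, hb, omega_coe_coe_neg_iff hab, omega_coe_coe_neg_iff hoa] at e2
    rw [hc, hb, omega_coe_infty, omega_coe_coe_neg_iff hbc, sub_neg] at e3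
    rw [Set.mem_ofPred_eq, e1, e2, e3]
    tauto
  refine h.of_cut (P := {z | a ≤ z.re ∧ z.re ≤ c ∧ 0 < (z.re - a) * (z.re - c) + z.im ^ 2})
    (Q := {u : ℍ | (u.re - a) * (u.re - c) + u.im ^ 2 ≤ 0 ∧
      0 < (u.re - a) * (u.re - b) + u.im ^ 2 ∧ 0 < (u.re - b) * (u.re - c) + u.im ^ 2}) ?_ hg ?_ ?_
  · ext z
    have hy := sq_pos_of_pos z.im_pos
    simp only [markovRegion, Set.mem_ofPred_eq, Set.mem_union]
    constructor
    · rintro ⟨h1, h2, h3, h4⟩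
      rcases lt_or_ge 0 ((z.re - a) * (z.re - c) + z.im ^ 2) with hz | hz
      · exact Or.inl ⟨h1, h2, hz⟩
      · exact Or.inr ⟨hz, h3, h4⟩
    · rintro (⟨h1, h2, h3⟩ | ⟨h1, h2, h3⟩)
      · exact ⟨h1, h2, by nlinarith, by nlinarith⟩
      · refine ⟨?_, ?_, h2, h3⟩ <;> by_contra! <;> nlinarith
  · intro z
    have hy := sq_pos_of_pos z.im_pos
    rw [hQ]
    simp only [markovRegion, Set.mem_ofPred_eq]
    constructor
    · rintro ⟨h1, h2, h3, h4⟩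
      rcases le_or_gt a z.re with hz | hz
      · exact Or.inl ⟨hz, h2, h4⟩
      · exact Or.inr ⟨h1, hz, h3⟩
    · rintro (⟨h1, h2, h3⟩ | ⟨h1, h2, h3⟩)
      · exact ⟨by linarith, h2, by nlinarith, h3⟩
      · exact ⟨h1, by linarith, h3, by nlinarith⟩
  · rintro z ⟨h1, -, -⟩ hz
    exact absurd ((hQ z).1 hz).2.1 (not_lt.2 h1)

namespace IsMarkovData

variable {p₁ p₂ p₃ q₁ q₂ q₃ : ℤ}

lemma sub₁₂ (h : IsMarkovData p₁ p₂ p₃ q₁ q₂ q₃) :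
    (p₂ : ℝ) / q₂ - p₁ / q₁ = q₃ / (q₁ * q₂) := by
  have h1 : (q₁ : ℝ) ≠ 0 := by exact_mod_cast h.pos₁.ne'
  have h2 : (q₂ : ℝ) ≠ 0 := by exact_mod_cast h.pos₂.ne'
  have : (p₂ * q₁ - p₁ * q₂ : ℝ) = q₃ := by exact_mod_cast h.det₁₂
  field_simp; linarith

lemma sub₁₃ (h : IsMarkovData p₁ p₂ p₃ q₁ q₂ q₃) :
    (p₃ : ℝ) / q₃ - p₁ / q₁ = 3 - q₂ / (q₁ * q₃) := by
  have h1 : (q₁ : ℝ) ≠ 0 := by exact_mod_cast h.pos₁.ne'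
  have h2 : (q₃ : ℝ) ≠ 0 := by exact_mod_cast h.pos₃.ne'
  have : (p₃ * q₁ - p₁ * q₃ : ℝ) = 3 * q₁ * q₃ - q₂ := by exact_mod_cast h.det₁₃
  field_simp; linarith

lemma lt₁₂ (h : IsMarkovData p₁ p₂ p₃ q₁ q₂ q₃) : (p₁ : ℝ) / q₁ < p₂ / q₂ := by
  have h1 : (0 : ℝ) < q₁ := by exact_mod_cast h.pos₁
  have h2 : (0 : ℝ) < q₂ := by exact_mod_cast h.pos₂
  have h3 : (0 : ℝ) < q₃ := by exact_mod_cast h.pos₃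
  rw [← sub_pos, h.sub₁₂]; positivity

lemma lt₂₃ (h : IsMarkovData p₁ p₂ p₃ q₁ q₂ q₃) : (p₂ : ℝ) / q₂ < p₃ / q₃ := h.rotate.lt₁₂

/-- The pairing of the side over the first two vertices with the side over the third one. -/
lemma exists_pairing_first (h : IsMarkovData p₁ p₂ p₃ q₁ q₂ q₃) :
    ∃ g ∈ torusGL, g • (((p₁ : ℝ) / q₁ : ℝ) : OnePoint ℝ) = OnePoint.infty ∧
      g • (((p₂ : ℝ) / q₂ : ℝ) : OnePoint ℝ) = (((p₃ : ℝ) / q₃ : ℝ) : OnePoint ℝ) ∧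
      g • (OnePoint.infty : OnePoint ℝ) =
        ((((p₁ + 3 * q₁ : ℤ) : ℝ) / q₁ : ℝ) : OnePoint ℝ) := by
  obtain ⟨g, hg, h1, h2, h3⟩ := exists_side_pairing' h.pos₁ h.dvd₁
  have hq1 : (q₁ : ℝ) ≠ 0 := by exact_mod_cast h.pos₁.ne'
  have hq2 : (q₂ : ℝ) ≠ 0 := by exact_mod_cast h.pos₂.ne'
  have hq3 : (q₃ : ℝ) ≠ 0 := by exact_mod_cast h.pos₃.ne'
  refine ⟨g, hg, h1, ?_, ?_⟩
  · rw [h3 _ h.lt₁₂.ne', h.sub₁₂]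
    congr 1
    have := h.sub₁₃
    have e : 1 / ((q₁ : ℝ) ^ 2 * (q₃ / (q₁ * q₂))) = q₂ / (q₁ * q₃) := by field_simp
    rw [e]; linarith
  · rw [h2]; congr 1; push_cast; field_simp

/-- The pairing of the side over the last two vertices with the side over the first one. -/
lemma exists_pairing_last (h : IsMarkovData p₁ p₂ p₃ q₁ q₂ q₃) :
    ∃ g ∈ torusGL, g • (((p₁ : ℝ) / q₁ : ℝ) : OnePoint ℝ) =
        ((((3 * p₁ * q₃ - p₂ : ℤ) : ℝ) / ((3 * q₁ * q₃ - q₂ : ℤ) : ℝ) : ℝ) : OnePoint ℝ) ∧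
      g • (((p₂ : ℝ) / q₂ : ℝ) : OnePoint ℝ) = (((p₁ : ℝ) / q₁ : ℝ) : OnePoint ℝ) ∧
      g • (((p₃ : ℝ) / q₃ : ℝ) : OnePoint ℝ) = OnePoint.infty := by
  obtain ⟨g, hg, h1, h2, h3⟩ := exists_side_pairing' h.pos₃ h.dvd₃
  have hq1 : (q₁ : ℝ) ≠ 0 := by exact_mod_cast h.pos₁.ne'
  have hq2 : (q₂ : ℝ) ≠ 0 := by exact_mod_cast h.pos₂.ne'
  have hq3 : (q₃ : ℝ) ≠ 0 := by exact_mod_cast h.pos₃.ne'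
  have h13 := h.sub₁₃
  refine ⟨torusShift (-1) * g, mul_mem (torusShift_mem _) hg, ?_, ?_, ?_⟩
  · rw [mul_smul, h3 _ (h.lt₁₂.trans h.lt₂₃).ne, torusShift_smul_coe]
    congr 1
    have hf := h.flip.sub₁₂
    have hq0 : (3 * q₁ * q₃ - q₂ : ℝ) ≠ 0 := by exact_mod_cast h.prod_pos.ne'
    push_cast at hf ⊢
    have e : (p₁ : ℝ) / q₁ - p₃ / q₃ = -((3 * q₁ * q₃ - q₂) / (q₁ * q₃)) := by
      have : (3 * q₁ * q₃ - q₂ : ℝ) / (q₁ * q₃) = 3 - q₂ / (q₁ * q₃) := by field_simp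
      rw [this]; linarith
    have e2 : 1 / ((q₃ : ℝ) ^ 2 * ((p₁ : ℝ) / q₁ - p₃ / q₃)) =
        -(q₁ / (q₃ * (3 * q₁ * q₃ - q₂))) := by
      rw [e]; field_simp
    have e3 : (p₃ : ℝ) / q₃ - p₁ / q₁ = (3 * q₁ * q₃ - q₂) / (q₁ * q₃) := by linarith
    have e4 : (p₃ : ℝ) / q₃ = p₁ / q₁ + (3 * q₁ * q₃ - q₂) / (q₁ * q₃) := by linarith
    have e5 : (3 * p₁ * q₃ - p₂ : ℝ) / (3 * q₁ * q₃ - q₂) =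
      p₁ / q₁ - q₃ / ((3 * q₁ * q₃ - q₂) * q₁) := by linarith
    have hm : (q₁ ^ 2 + q₂ ^ 2 + q₃ ^ 2 : ℝ) = 3 * q₁ * q₂ * q₃ := by exact_mod_cast h.markov
    rw [e2, e4, e5]
    generalize hq : (3 * q₁ * q₃ - q₂ : ℝ) = q₀ at hq0 ⊢
    have hm' : (q₀ ^ 2 + q₁ ^ 2 + q₃ ^ 2 : ℝ) = 3 * q₀ * q₁ * q₃ := by
      rw [← hq]; linear_combination hm
    field_simp
    linear_combination hm'
  · rw [mul_smul, h3 _ h.lt₂₃.ne, torusShift_smul_coe]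
    congr 1
    have h23 := h.rotate.sub₁₂
    have e : (p₂ : ℝ) / q₂ - p₃ / q₃ = -(q₁ / (q₂ * q₃)) := by linarith
    have e2 : 1 / ((q₃ : ℝ) ^ 2 * ((p₂ : ℝ) / q₂ - p₃ / q₃)) = -(q₂ / (q₁ * q₃)) := by
      rw [e]; field_simp
    rw [e2]; push_cast; linarith
  · rw [mul_smul, h1, torusShift_smul_infty]

lemma isStrictDomain_of_rotate (h : IsMarkovData p₁ p₂ p₃ q₁ q₂ q₃)
    (hr : IsStrictDomain (markovRegion ((p₂ : ℝ) / q₂) ((p₃ : ℝ) / q₃)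
      (((p₁ + 3 * q₁ : ℤ) : ℝ) / q₁))) :
    IsStrictDomain (markovRegion ((p₁ : ℝ) / q₁) ((p₂ : ℝ) / q₂) ((p₃ : ℝ) / q₃)) := by
  obtain ⟨g, hg, h1, h2, h3⟩ := h.exists_pairing_first
  exact hr.of_rotate h.lt₁₂ h.lt₂₃ h.rotate.lt₂₃ hg h1 h2 h3

lemma isStrictDomain_of_flip (h : IsMarkovData p₁ p₂ p₃ q₁ q₂ q₃)
    (hr : IsStrictDomain (markovRegion
      (((3 * p₁ * q₃ - p₂ : ℤ) : ℝ) / ((3 * q₁ * q₃ - q₂ : ℤ) : ℝ))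
      ((p₁ : ℝ) / q₁) ((p₃ : ℝ) / q₃))) :
    IsStrictDomain (markovRegion ((p₁ : ℝ) / q₁) ((p₂ : ℝ) / q₂) ((p₃ : ℝ) / q₃)) := by
  obtain ⟨g, hg, h1, h2, h3⟩ := h.exists_pairing_last
  exact hr.of_flip h.flip.lt₁₂ h.lt₁₂ h.lt₂₃ hg h1 h2 h3

lemma isStrictDomain_aux (N : ℕ) : ∀ p₁ p₂ p₃ q₁ q₂ q₃ : ℤ, IsMarkovData p₁ p₂ p₃ q₁ q₂ q₃ →
    (q₁ + q₂ + q₃).toNat ≤ N →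
    IsStrictDomain (markovRegion ((p₁ : ℝ) / q₁) ((p₂ : ℝ) / q₂) ((p₃ : ℝ) / q₃)) := by
  induction N with
  | zero =>
    intro _ _ _ _ _ _ h hN
    have := h.pos₁; have := h.pos₂; have := h.pos₃; omega
  | succ N ih =>
    have step : ∀ p₁ p₂ p₃ q₁ q₂ q₃ : ℤ, IsMarkovData p₁ p₂ p₃ q₁ q₂ q₃ → q₁ ≤ q₂ → q₃ ≤ q₂ →
        (q₁ + q₂ + q₃).toNat ≤ N + 1 →
        IsStrictDomain (markovRegion ((p₁ : ℝ) / q₁) ((p₂ : ℝ) / q₂) ((p₃ : ℝ) / q₃)) := by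
      intro p₁ p₂ p₃ q₁ q₂ q₃ h h1 h3 hN
      by_cases hone : q₁ = 1 ∧ q₂ = 1 ∧ q₃ = 1
      · obtain ⟨rfl, rfl, rfl⟩ := hone
        have h12 := h.det₁₂
        have h23 := h.det₂₃
        have e2 : p₂ = p₁ + 1 := by linarith
        have e3 : p₃ = p₁ + 2 := by linarith
        have := isStrictDomain_base p₁
        rw [e2, e3]
        simpa using this
      · refine h.isStrictDomain_of_flip (ih _ _ _ _ _ _ h.flip ?_)
        have := h.flip_lt h1 h3 hone
        have := h.pos₁; have := h.pos₂; have := h.pos₃; have := h.prod_pos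
        omega
    intro p₁ p₂ p₃ q₁ q₂ q₃ h hN
    by_cases c2 : q₁ ≤ q₂ ∧ q₃ ≤ q₂
    · exact step _ _ _ _ _ _ h c2.1 c2.2 hN
    by_cases c3 : q₂ ≤ q₃ ∧ q₁ ≤ q₃
    · exact h.isStrictDomain_of_rotate (step _ _ _ _ _ _ h.rotate c3.1 c3.2 (by omega))
    · exact h.isStrictDomain_of_rotate (h.rotate.isStrictDomain_of_rotate
        (step _ _ _ _ _ _ h.rotate.rotate (by omega) (by omega) (by omega)))

lemma isStrictDomain (h : IsMarkovData p₁ p₂ p₃ q₁ q₂ q₃) :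
    IsStrictDomain (markovRegion ((p₁ : ℝ) / q₁) ((p₂ : ℝ) / q₂) ((p₃ : ℝ) / q₃)) :=
  isStrictDomain_aux _ _ _ _ _ _ _ h le_rfl

end IsMarkovData

lemma IsStrictDomain.injOn {F : Set ℍ} (hF : IsStrictDomain F) : Set.InjOn torusProj F := by
  intro z hz w hw h
  obtain ⟨g, hg, rfl⟩ := torusProj_eq_iff.1 h
  exact (hF.2 z hz g hg hw).symm

lemma image_torusProj_idealGeodesic_smul {g : GL (Fin 2) ℝ} (hg : g ∈ torusGL)
    (a b : OnePoint ℝ) :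
    torusProj '' idealGeodesic (g • a) (g • b) = torusProj '' idealGeodesic a b := by
  ext x
  constructor
  · rintro ⟨z, hz, rfl⟩
    refine ⟨g⁻¹ • z, ?_, torusProj_eq_iff.2 ⟨g, hg, smul_inv_smul _ _⟩⟩
    rw [← smul_mem_idealGeodesic_iff g, smul_inv_smul]; exact hz
  · rintro ⟨z, hz, rfl⟩
    exact ⟨g • z, (smul_mem_idealGeodesic_iff g).2 hz,
      torusProj_eq_iff.2 ⟨g⁻¹, inv_mem hg, inv_smul_smul _ _⟩⟩

/-- The geodesics from the vertices to `∞`, and the interiors of the two triangles. -/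
def markovPiece (a b c : ℝ) : Fin 5 → Set ℍ :=
  ![idealGeodesic a OnePoint.infty, idealGeodesic b OnePoint.infty,
    idealGeodesic c OnePoint.infty, interior (idealTriangle a b OnePoint.infty),
    interior (idealTriangle b c OnePoint.infty)]

lemma markovPiece_properties {a b c : ℝ} (hab : a < b) (hbc : b < c) :
    (⋃ i, markovPiece a b c i) = markovRegion a b c ∧
    (∀ i, (markovPiece a b c i).Nonempty) ∧
    ∀ i j, i ≠ j → Disjoint (markovPiece a b c i) (markovPiece a b c j) := by
  refine ⟨?_, ?_, ?_⟩
  · ext z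
    have hy := sq_pos_of_pos z.im_pos
    simp only [markovPiece, Set.mem_iUnion, Fin.exists_fin_succ, Matrix.cons_val_zero,
      Matrix.cons_val_succ, mem_idealGeodesic_coe_infty, mem_interior_idealTriangle hab,
      mem_interior_idealTriangle hbc, IsEmpty.exists_iff, or_false, markovRegion,
      Set.mem_ofPred_eq]
    constructor
    · rintro (h | h | h | ⟨h1, h2, h3⟩ | ⟨h1, h2, h3⟩)
      · rw [h]; exact ⟨le_rfl, by linarith, by nlinarith, by nlinarith⟩
      · rw [h]; exact ⟨by linarith, by linarith, by nlinarith, by nlinarith⟩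
      · rw [h]; exact ⟨by linarith, by linarith, by nlinarith, by nlinarith⟩
      · exact ⟨by linarith, by linarith, h3, by nlinarith⟩
      · exact ⟨by linarith, by linarith, by nlinarith, h3⟩
    · rintro ⟨h1, h2, h3, h4⟩
      rcases h1.eq_or_lt with h | h
      · exact Or.inl h.symm
      rcases h2.eq_or_lt with h' | h'
      · exact Or.inr (Or.inr (Or.inl h'))
      rcases lt_trichotomy z.re b with h5 | h5 | h5
      · exact Or.inr (Or.inr (Or.inr (Or.inl ⟨h, h5, h3⟩)))
      · exact Or.inr (Or.inl h5)
      · exact Or.inr (Or.inr (Or.inr (Or.inr ⟨h5, h', h4⟩)))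
  · have tri : ∀ s t : ℝ, s < t → (interior (idealTriangle s t OnePoint.infty)).Nonempty := by
      intro s t hst
      refine ⟨hpt ((s + t) / 2) (t - s) (by linarith), (mem_interior_idealTriangle hst).2 ?_⟩
      simp only [hpt_re, hpt_im]
      exact ⟨by linarith, by linarith, by nlinarith⟩
    have geo : ∀ t : ℝ, (idealGeodesic t OnePoint.infty).Nonempty := fun t ↦
      ⟨hpt t 1 one_pos, mem_idealGeodesic_coe_infty.2 rfl⟩
    intro i
    fin_cases i
    · exact geo a
    · exact geo b
    · exact geo c
    · exact tri a b hab
    · exact tri b c hbc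
  · intro i j hij
    rw [Set.disjoint_left]
    intro z
    fin_cases i <;> fin_cases j <;> first
      | exact absurd rfl hij
      | (simp [markovPiece, mem_idealGeodesic_coe_infty, mem_interior_idealTriangle hab,
          mem_interior_idealTriangle hbc]
         intros; linarith)

theorem exists_triangulation_of_isMarkovData {p₁ p₂ p₃ q₁ q₂ q₃ : ℤ}
    (h : IsMarkovData p₁ p₂ p₃ q₁ q₂ q₃) {x₁ x₂ x₃ : ℝ} (hx₁ : x₁ = (p₁ : ℝ) / q₁)
    (hx₂ : x₂ = (p₂ : ℝ) / q₂) (hx₃ : x₃ = (p₃ : ℝ) / q₃) :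
    ∃ T : TorusIdealTriangulation,
      torusProj '' interior (idealTriangle x₁ x₂ OnePoint.infty) ≠
        torusProj '' interior (idealTriangle x₂ x₃ OnePoint.infty) ∧
      T.triangles =
        {torusProj '' interior (idealTriangle x₁ x₂ OnePoint.infty),
          torusProj '' interior (idealTriangle x₂ x₃ OnePoint.infty)} := by
  have h₁₂ : x₁ < x₂ := by rw [hx₁, hx₂]; exact h.lt₁₂
  have h₂₃ : x₂ < x₃ := by rw [hx₂, hx₃]; exact h.lt₂₃
  have hstrict := h.isStrictDomain
  obtain ⟨g, hg, hg1, hg2, hg3⟩ := h.exists_pairing_first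
  obtain ⟨k, hk, -, hk2, hk3⟩ := h.exists_pairing_last
  rw [← hx₁, ← hx₂, ← hx₃] at hstrict
  rw [← hx₁] at hg1 hk2
  rw [← hx₂] at hg2 hk2
  rw [← hx₃] at hg2 hk3
  obtain ⟨hU, hne, hdis⟩ := markovPiece_properties h₁₂ h₂₃
  set S := markovPiece x₁ x₂ x₃ with hS
  have hinj := hstrict.injOn
  have hsub : ∀ i, S i ⊆ markovRegion x₁ x₂ x₃ := fun i ↦ hU ▸ Set.subset_iUnion S i
  have hdis' : ∀ i j, i ≠ j → Disjoint (torusProj '' S i) (torusProj '' S j) := by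
    intro i j hij
    rw [Set.disjoint_left]
    rintro _ ⟨z, hz, rfl⟩ ⟨w, hw, hzw⟩
    have := hinj (hsub j hw) (hsub i hz) hzw
    subst this
    exact Set.disjoint_left.1 (hdis i j hij) hz hw
  have hne' : ∀ i j, i ≠ j → torusProj '' S i ≠ torusProj '' S j := by
    intro i j hij he
    have := hdis' i j hij
    rw [he, disjoint_self] at this
    exact ((hne j).image torusProj).ne_empty this
  have cusp : ∀ z : OnePoint ℝ, z = OnePoint.infty ∨ z = x₁ ∨ z = x₂ ∨ z = x₃ →
      IsTorusCusp z := by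
    have c1 : IsTorusCusp x₁ := isTorusCusp_iff.2 ⟨g⁻¹, inv_mem hg, by
      rw [← hg1, inv_smul_smul]⟩
    have c3 : IsTorusCusp x₃ := isTorusCusp_iff.2 ⟨k⁻¹, inv_mem hk, by
      rw [← hk3, inv_smul_smul]⟩
    obtain ⟨l, hl, hl'⟩ := isTorusCusp_iff.1 c3
    have c2 : IsTorusCusp x₂ := isTorusCusp_iff.2 ⟨g⁻¹ * l, mul_mem (inv_mem hg) hl, by
      rw [mul_smul, hl', ← hg2, inv_smul_smul]⟩
    rintro z (rfl | rfl | rfl | rfl)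
    · exact isTorusCusp_iff.2 ⟨1, one_mem _, one_smul _ _⟩
    · exact c1
    · exact c2
    · exact c3
  have e12 : torusProj '' idealGeodesic x₁ x₂ = torusProj '' S 2 := by
    rw [← image_torusProj_idealGeodesic_smul hg, hg1, hg2, idealGeodesic_comm]; rfl
  have e23 : torusProj '' idealGeodesic x₂ x₃ = torusProj '' S 0 := by
    rw [← image_torusProj_idealGeodesic_smul hk, hk2, hk3]; rfl
  have s0 : S 0 = idealGeodesic x₁ OnePoint.infty := rfl
  have s1 : S 1 = idealGeodesic x₂ OnePoint.infty := rfl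
  have s2 : S 2 = idealGeodesic x₃ OnePoint.infty := rfl
  have s3 : S 3 = interior (idealTriangle x₁ x₂ OnePoint.infty) := rfl
  have s4 : S 4 = interior (idealTriangle x₂ x₃ OnePoint.infty) := rfl
  have coe_ne : ∀ s t : ℝ, s < t → (s : OnePoint ℝ) ≠ t := fun s t hst he ↦
    hst.ne (OnePoint.coe_injective he)
  have mem : ∀ e ∈ ({torusProj '' S 0, torusProj '' S 1, torusProj '' S 2} ∪
      {torusProj '' S 3, torusProj '' S 4} : Set (Set ModularTorus)),
      ∃ i, e = torusProj '' S i := by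
    rintro e ((rfl | rfl | rfl) | (rfl | rfl)) <;> exact ⟨_, rfl⟩
  refine ⟨{ edges := {torusProj '' S 0, torusProj '' S 1, torusProj '' S 2}
            triangles := {torusProj '' S 3, torusProj '' S 4}
            edges_finite := by simp
            triangles_finite := by simp
            isIdealArc_of_mem := ?_
            triangle_of_mem := ?_
            edges_disjoint_triangles := ?_
            pairwiseDisjoint := ?_
            cover := ?_ }, hne' 3 4 (by decide), rfl⟩
  · rintro e (rfl | rfl | rfl)
    · exact ⟨x₁, OnePoint.infty, OnePoint.coe_ne_infty _, cusp _ (by simp), cusp _ (by simp),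
        hinj.mono (hsub 0), rfl⟩
    · exact ⟨x₂, OnePoint.infty, OnePoint.coe_ne_infty _, cusp _ (by simp), cusp _ (by simp),
        hinj.mono (hsub 1), rfl⟩
    · exact ⟨x₃, OnePoint.infty, OnePoint.coe_ne_infty _, cusp _ (by simp), cusp _ (by simp),
        hinj.mono (hsub 2), rfl⟩
  · rintro t (rfl | rfl)
    · refine ⟨x₁, x₂, OnePoint.infty, coe_ne _ _ h₁₂, OnePoint.coe_ne_infty _,
        OnePoint.infty_ne_coe _, hinj.mono (hsub 3), rfl, ?_, ?_, ?_⟩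
      · rw [e12]; simp
      · rw [← s1]; simp
      · rw [idealGeodesic_comm, ← s0]; simp
    · refine ⟨x₂, x₃, OnePoint.infty, coe_ne _ _ h₂₃, OnePoint.coe_ne_infty _,
        OnePoint.infty_ne_coe _, hinj.mono (hsub 4), rfl, ?_, ?_, ?_⟩
      · rw [e23]; simp
      · rw [← s2]; simp
      · rw [idealGeodesic_comm, ← s1]; simp
  · rw [Set.disjoint_left]
    rintro e (rfl | rfl | rfl) (h | h) <;> exact hne' _ _ (by decide) h
  · intro e he f hf hef
    obtain ⟨i, rfl⟩ := mem e he
    obtain ⟨j, rfl⟩ := mem f hf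
    exact hdis' i j fun hij ↦ hef (by rw [hij])
  · rw [Set.eq_univ_iff_forall]
    intro x
    obtain ⟨z, rfl⟩ : ∃ z, torusProj z = x := Quotient.exists_rep x
    obtain ⟨l, hl, hlz⟩ := hstrict.1 z
    rw [← hU, Set.mem_iUnion] at hlz
    obtain ⟨i, hi⟩ := hlz
    refine ⟨torusProj '' S i, ?_, l • z, hi, torusProj_eq_iff.2 ⟨l⁻¹, inv_mem hl,
      inv_smul_smul _ _⟩⟩
    fin_cases i <;> simp

/-! ### Ideal points and geodesics in general position -/

lemma exists_smul_eq_infty_zero {a b : OnePoint ℝ} (h : a ≠ b) :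
    ∃ g : GL (Fin 2) ℝ, 0 < g.det.val ∧ g • a = OnePoint.infty ∧ g • b = ((0 : ℝ) : OnePoint ℝ) := by
  have trans : ∀ t : ℝ, ∃ g : GL (Fin 2) ℝ, 0 < g.det.val ∧
      g • (OnePoint.infty : OnePoint ℝ) = OnePoint.infty ∧
      g • (t : OnePoint ℝ) = ((0 : ℝ) : OnePoint ℝ) := by
    intro t
    have hd : (!![1, -t; 0, 1] : Matrix (Fin 2) (Fin 2) ℝ).det ≠ 0 := by simp [Matrix.det_fin_two]
    refine ⟨GeneralLinearGroup.mkOfDetNeZero _ hd, ?_, ?_, ?_⟩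
    · rw [det_val_eq]; simp [GeneralLinearGroup.mkOfDetNeZero]
    · rw [OnePoint.smul_infty_eq_self_iff]; simp [GeneralLinearGroup.mkOfDetNeZero]
    · rw [OnePoint.smul_some_eq_ite]; simp [GeneralLinearGroup.mkOfDetNeZero]
  induction a using OnePoint.rec with
  | infty =>
    induction b using OnePoint.rec with
    | infty => exact absurd rfl h
    | coe t => exact trans t
  | coe s =>
    have hd : (!![0, -1; 1, -s] : Matrix (Fin 2) (Fin 2) ℝ).det ≠ 0 := by simp [Matrix.det_fin_two]
    set k : GL (Fin 2) ℝ := GeneralLinearGroup.mkOfDetNeZero _ hd with hk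
    have hkd : 0 < k.det.val := by rw [det_val_eq, hk]; simp [GeneralLinearGroup.mkOfDetNeZero]
    have hks : k • (s : OnePoint ℝ) = OnePoint.infty := by
      rw [OnePoint.smul_some_eq_ite, hk]; simp [GeneralLinearGroup.mkOfDetNeZero]
    obtain ⟨t, ht⟩ : ∃ t : ℝ, k • b = t := by
      have : k • b ≠ OnePoint.infty := fun he ↦ h (smul_left_cancel k (hks.trans he.symm))
      obtain ⟨t, ht⟩ := OnePoint.ne_infty_iff_exists.1 this
      exact ⟨t, ht.symm⟩
    obtain ⟨g, hg, h1, h2⟩ := trans t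
    refine ⟨g * k, ?_, by rw [mul_smul, hks, h1], by rw [mul_smul, ht, h2]⟩
    rw [map_mul, Units.val_mul]; exact mul_pos hg hkd

lemma omega_axis (s t : ℝ) {y : ℝ} (hy : 0 < y) :
    omega s t (hpt 0 y hy) = (s - t) * (s * t + y ^ 2) := by
  rw [omega_coe_coe]; simp

/-- Geodesics that cross each other change sides. -/
lemma frequently_omega_neg {a b c d : OnePoint ℝ} (hab : a ≠ b) (hcd : c ≠ d) {z : ℍ}
    (h₁ : z ∈ idealGeodesic a b) (h₂ : z ∈ idealGeodesic c d)
    (hne : idealGeodesic a b ≠ idealGeodesic c d) :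
    ∃ᶠ w in nhds z, w ∈ idealGeodesic c d ∧ omega a b w < 0 := by
  obtain ⟨g, hg, hgc, hgd⟩ := exists_smul_eq_infty_zero hcd
  intro hev
  have hmem : ∀ w : ℍ, w ∈ idealGeodesic c d ↔ (g • w).re = 0 := by
    intro w
    rw [← smul_mem_idealGeodesic_iff g, hgc, hgd, idealGeodesic_comm, mem_idealGeodesic_coe_infty]
  rw [mem_idealGeodesic_iff hab, ← omega_smul_eq_zero_iff hg] at h₁
  rw [hmem] at h₂
  have hab' : g • a ≠ g • b := fun h ↦ hab (smul_left_cancel g h)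
  have hcont : Filter.Tendsto (fun w : ℍ ↦ g⁻¹ • w) (nhds (g • z)) (nhds z) := by
    have : ContinuousAt (fun w : ℍ ↦ g⁻¹ • w) (g • z) := (continuous_const_smul _).continuousAt
    simpa [ContinuousAt] using this
  have hev' := hcont.eventually hev
  obtain ⟨ε, hε, hball⟩ := eventually_nhds_iff_re_im.1 hev'
  have key : ∀ y (hy : 0 < y), |y - (g • z).im| < ε → 0 ≤ omega (g • a) (g • b) (hpt 0 y hy) := by
    intro y hy hlt
    by_contra hneg
    refine hball (hpt 0 y hy) (by simpa [h₂] using hε) (by simpa using hlt) ⟨?_, ?_⟩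
    · rw [hmem]; simp
    · rw [← omega_smul_neg_iff hg]; simpa using hneg
  obtain ⟨y₀, hy0, hz0⟩ : ∃ (y₀ : ℝ) (hy : 0 < y₀), g • z = hpt 0 y₀ hy := by
    refine ⟨(g • z).im, (g • z).im_pos, ?_⟩
    ext
    apply Complex.ext
    · simpa using h₂
    · rfl
  have key : ∀ y (hy : 0 < y), |y - y₀| < ε → 0 ≤ omega (g • a) (g • b) (hpt 0 y hy) := by
    simpa [hz0] using key
  rw [hz0] at h₁
  clear hball hev' hev hcont hmem h₂ hz0
  have same : g • a = g • c ∧ g • b = g • d ∨ g • a = g • d ∧ g • b = g • c → False := by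
    rintro (⟨h1, h2⟩ | ⟨h1, h2⟩)
    · exact hne (by rw [smul_left_cancel g h1, smul_left_cancel g h2])
    · exact hne (by rw [smul_left_cancel g h1, smul_left_cancel g h2, idealGeodesic_comm])
  rw [hgc, hgd] at same
  generalize g • a = a' at *
  generalize g • b = b' at *
  induction a' using OnePoint.rec with
  | infty =>
    induction b' using OnePoint.rec with
    | infty => exact hab' rfl
    | coe t =>
      rw [omega_infty_coe] at h₁
      have : t = 0 := by simpa using h₁
      exact same (Or.inl ⟨rfl, by rw [this]⟩)
  | coe s =>
    induction b' using OnePoint.rec with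
    | infty =>
      rw [omega_coe_infty] at h₁
      have : s = 0 := by simpa using h₁
      exact same (Or.inr ⟨by rw [this], rfl⟩)
    | coe t =>
      have hst : s ≠ t := fun h ↦ hab' (by rw [h])
      rw [omega_axis] at h₁
      have hst' : s * t = -y₀ ^ 2 := by
        have := (mul_eq_zero.1 h₁).resolve_left (sub_ne_zero.2 hst); linarith
      set δ := min (ε / 2) (y₀ / 2) with hδ
      have hδ0 : 0 < δ := by positivity
      have hδ1 : δ ≤ ε / 2 := min_le_left _ _
      have hδ2 : δ ≤ y₀ / 2 := min_le_right _ _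
      rcases hst.lt_or_gt with h | h
      · have := key (y₀ + δ) (by linarith) (by rw [add_sub_cancel_left, abs_of_pos hδ0]; linarith)
        rw [omega_axis, hst'] at this
        nlinarith [mul_pos (sub_pos.2 h) hδ0, mul_pos (mul_pos (sub_pos.2 h) hδ0) hy0]
      · have := key (y₀ - δ) (by linarith) (by
          rw [sub_sub_cancel_left, abs_neg, abs_of_pos hδ0]; linarith)
        rw [omega_axis, hst'] at this
        have : (s - t) * (δ * (2 * y₀ - δ)) ≤ 0 := by nlinarith
        have h3 : 0 < (s - t) * (δ * (2 * y₀ - δ)) :=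
          mul_pos (sub_pos.2 h) (mul_pos hδ0 (by linarith))
        linarith

lemma eq_of_idealGeodesic_eq {a b c d : OnePoint ℝ} (hab : a ≠ b) (hcd : c ≠ d)
    (h : idealGeodesic a b = idealGeodesic c d) : a = c ∧ b = d ∨ a = d ∧ b = c := by
  obtain ⟨g, hg, hgc, hgd⟩ := exists_smul_eq_infty_zero hcd
  have hab' : g • a ≠ g • b := fun h ↦ hab (smul_left_cancel g h)
  have key : ∀ y (hy : 0 < y), omega (g • a) (g • b) (hpt 0 y hy) = 0 := by
    intro y hy
    rw [← mem_idealGeodesic_iff hab']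
    have : g⁻¹ • hpt 0 y hy ∈ idealGeodesic a b := by
      rw [h, ← smul_mem_idealGeodesic_iff g, hgc, hgd, idealGeodesic_comm,
        mem_idealGeodesic_coe_infty]
      simp
    rw [← smul_mem_idealGeodesic_iff g] at this
    simpa using this
  have h1 := key 1 one_pos
  have h2 := key 2 two_pos
  suffices g • a = g • c ∧ g • b = g • d ∨ g • a = g • d ∧ g • b = g • c from
    this.imp (fun h ↦ ⟨smul_left_cancel g h.1, smul_left_cancel g h.2⟩)
      fun h ↦ ⟨smul_left_cancel g h.1, smul_left_cancel g h.2⟩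
  rw [hgc, hgd]
  generalize g • a = a' at *
  generalize g • b = b' at *
  induction a' using OnePoint.rec with
  | infty =>
    induction b' using OnePoint.rec with
    | infty => exact absurd rfl hab'
    | coe t =>
      rw [omega_infty_coe] at h1
      have : t = 0 := by simpa using h1
      exact Or.inl ⟨rfl, by rw [this]⟩
  | coe s =>
    induction b' using OnePoint.rec with
    | infty =>
      rw [omega_coe_infty] at h1
      have : s = 0 := by simpa using h1
      exact Or.inr ⟨by rw [this], rfl⟩
    | coe t =>
      have hst : s ≠ t := fun h ↦ hab' (by rw [h])
      rw [omega_axis] at h1 h2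
      have := (mul_eq_zero.1 h1).resolve_left (sub_ne_zero.2 hst)
      have := (mul_eq_zero.1 h2).resolve_left (sub_ne_zero.2 hst)
      linarith

/-! ### Connectedness -/

lemma isPreconnected_of_convex {s : Set ℍ} (h : Convex ℝ ((fun z : ℍ ↦ (z : ℂ)) '' s)) :
    IsPreconnected s :=
  (UpperHalfPlane.isOpenEmbedding_coe.isInducing.isPreconnected_image).1 h.isPreconnected

lemma IsPreconnected.subset_of_cover {X ι : Type*} [TopologicalSpace X] {s : Set X}
    (hs : IsPreconnected s) {O : ι → Set X} (hO : ∀ i, IsOpen (O i))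
    (heq : ∀ i j, (O i ∩ O j).Nonempty → O i = O j) (hcov : s ⊆ ⋃ i, O i) {i : ι}
    (hi : (s ∩ O i).Nonempty) : s ⊆ O i := by
  refine hs.subset_left_of_subset_union (hO i)
    (isOpen_iUnion fun j ↦ isOpen_iUnion fun _ : O j ≠ O i ↦ hO j) ?_ ?_ hi
  · simp only [Set.disjoint_iUnion_right]
    intro j hj
    rw [Set.disjoint_iff_inter_eq_empty]
    by_contra hne
    exact hj (heq _ _ (Set.nonempty_iff_ne_empty.2 hne)).symm
  · intro x hx
    obtain ⟨j, hj⟩ := Set.mem_iUnion.1 (hcov hx)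
    by_cases h : O j = O i
    · exact Or.inl (h ▸ hj)
    · exact Or.inr (Set.mem_iUnion₂.2 ⟨j, h, hj⟩)

/-- If the points near `z` on one side of the vertical line through `z` are covered by disjoint open
sets, then one of these sets suffices. -/
lemma exists_eventually_mem_of_side {ι : Type*} {O : ι → Set ℍ} (hO : ∀ i, IsOpen (O i))
    (heq : ∀ i j, (O i ∩ O j).Nonempty → O i = O j) {z : ℍ} {e : ℝ} (he : e ≠ 0)
    (hcov : ∀ᶠ w in nhds z, 0 < e * (w.re - z.re) → ∃ i, w ∈ O i) :
    ∃ i, ∀ᶠ w in nhds z, 0 < e * (w.re - z.re) → w ∈ O i := by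
  obtain ⟨ε, hε, hball⟩ := eventually_nhds_iff_re_im.1 hcov
  set R : Set ℍ := {w | 0 < e * (w.re - z.re) ∧ |w.re - z.re| < ε ∧ |w.im - z.im| < ε} with hR
  have hRc : IsPreconnected R := by
    apply isPreconnected_of_convex
    have himg : (fun z : ℍ ↦ (z : ℂ)) '' R =
        {w : ℂ | 0 < w.im} ∩ ({w : ℂ | e * z.re < e * w.re} ∩ ({w : ℂ | w.re < z.re + ε} ∩
          ({w : ℂ | z.re - ε < w.re} ∩ ({w : ℂ | w.im < z.im + ε} ∩
            {w : ℂ | z.im - ε < w.im})))) := by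
      ext w
      simp only [hR, Set.mem_image, Set.mem_ofPred_eq, Set.mem_inter_iff, abs_lt]
      constructor
      · rintro ⟨w, ⟨h1, h2, h3⟩, rfl⟩
        have := w.im_pos
        simp only [UpperHalfPlane.coe_im, UpperHalfPlane.coe_re]
        refine ⟨this, ?_, ?_, ?_, ?_, ?_⟩ <;> linarith
      · rintro ⟨h1, h2, h3, h4, h5, h6⟩
        refine ⟨⟨w, h1⟩, ⟨?_, ⟨?_, ?_⟩, ⟨?_, ?_⟩⟩, rfl⟩
        · change 0 < e * (w.re - z.re); linarith
        · change -ε < w.re - z.re; linarith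
        · change w.re - z.re < ε; linarith
        · change -ε < w.im - z.im; linarith
        · change w.im - z.im < ε; linarith
    rw [himg]
    have hre : IsLinearMap ℝ (fun w : ℂ ↦ w.re) := Complex.reLm.isLinear
    have him : IsLinearMap ℝ (fun w : ℂ ↦ w.im) := Complex.imLm.isLinear
    have here : IsLinearMap ℝ (fun w : ℂ ↦ e * w.re) := (e • Complex.reLm).isLinear
    exact (convex_halfSpace_gt him _).inter ((convex_halfSpace_gt here _).inter
      ((convex_halfSpace_lt hre _).inter ((convex_halfSpace_gt hre _).inter
        ((convex_halfSpace_lt him _).inter (convex_halfSpace_gt him _)))))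
  have hRcov : R ⊆ ⋃ i, O i := fun w hw ↦ Set.mem_iUnion.2 (hball w hw.2.1 hw.2.2 hw.1)
  set w₀ := hpt (z.re + ε / 2 * (e / |e|)) z.im z.im_pos with hw₀
  have he' : 0 < |e| := abs_pos.2 he
  have hw₀R : w₀ ∈ R := by
    refine ⟨?_, ?_, ?_⟩
    · have : e * (w₀.re - z.re) = ε / 2 * |e| := by
        simp only [hw₀, hpt_re, add_sub_cancel_left]
        field_simp
        exact (sq_abs e).symm
      rw [this]; positivity
    · simp only [hw₀, hpt_re, add_sub_cancel_left, abs_mul, abs_div, abs_abs]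
      rw [div_self he'.ne', mul_one, abs_of_pos hε, abs_of_pos two_pos]; linarith
    · simpa [hw₀] using hε
  obtain ⟨i, hi⟩ := Set.mem_iUnion.1 (hRcov hw₀R)
  refine ⟨i, eventually_nhds_iff_re_im.2 ⟨ε, hε, fun w h1 h2 h3 ↦ ?_⟩⟩
  exact hRc.subset_of_cover hO heq hRcov ⟨w₀, hw₀R, hi⟩ ⟨h3, h1, h2⟩

/-- A connected, locally connected space in which closed sets are Baire is not a disjoint union of
countably many closed sets, other than trivially. -/
lemma exists_eq_univ_of_iUnion_isClosed {X ι : Type*} [TopologicalSpace X] [PreconnectedSpace X]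
    [LocallyConnectedSpace X] [LocallyCompactSpace X] [T2Space X] [Nonempty X] [Countable ι]
    {A : ι → Set X} (hA : ∀ i, IsClosed (A i)) (hdis : Pairwise fun i j ↦ Disjoint (A i) (A j))
    (hcov : ⋃ i, A i = Set.univ) : ∃ i, A i = Set.univ := by
  have hunique : ∀ {i j x}, x ∈ A i → x ∈ A j → i = j := by
    intro i j x hi hj
    by_contra hij
    exact Set.disjoint_left.1 (hdis hij) hi hj
  set E : Set X := (⋃ i, interior (A i))ᶜ with hE
  have hEc : IsClosed E := (isOpen_iUnion fun _ ↦ isOpen_interior).isClosed_compl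
  rcases E.eq_empty_or_nonempty with hempty | hne
  · have hU : ⋃ i, interior (A i) = Set.univ := Set.compl_empty_iff.1 hempty
    obtain ⟨x⟩ := ‹Nonempty X›
    obtain ⟨i, hi⟩ := Set.mem_iUnion.1 (hU.symm ▸ Set.mem_univ x)
    refine ⟨i, Set.eq_univ_of_univ_subset ?_⟩
    have := isPreconnected_univ.subset_of_cover (O := fun i ↦ interior (A i))
      (fun _ ↦ isOpen_interior) (fun i j ⟨y, h1, h2⟩ ↦ by
        rw [hunique (interior_subset h1) (interior_subset h2)]) hU.ge (i := i)
        ⟨x, Set.mem_univ x, hi⟩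
    exact this.trans interior_subset
  · exfalso
    have : LocallyCompactSpace E := hEc.isClosedEmbedding_subtypeVal.locallyCompactSpace
    have : Nonempty E := hne.to_subtype
    obtain ⟨i, x, hx⟩ := nonempty_interior_of_iUnion_of_closed (X := E)
      (f := fun i ↦ (Subtype.val ⁻¹' A i : Set E))
      (fun i ↦ (hA i).preimage continuous_subtype_val) (by
        rw [← Set.preimage_iUnion, hcov, Set.preimage_univ])
    rw [mem_interior_iff_mem_nhds, nhds_subtype, Filter.mem_comap] at hx
    obtain ⟨V, hV, hVsub⟩ := hx
    obtain ⟨J, ⟨hJo, hxJ, hJc⟩, hJV⟩ :=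
      (LocallyConnectedSpace.open_connected_basis (x : X)).mem_iff.1 hV
    have hJE : ∀ y ∈ J, y ∈ E → y ∈ A i := fun y hy hyE ↦
      hVsub (show (⟨y, hyE⟩ : E) ∈ Subtype.val ⁻¹' V from hJV hy)
    have hxA : (x : X) ∈ A i := hJE x hxJ x.2
    have hsub : J ⊆ A i := by
      by_contra hnot
      obtain ⟨y, hyJ, hyi⟩ := Set.not_subset.1 hnot
      obtain ⟨m, hm⟩ := Set.mem_iUnion.1 (hcov.symm ▸ Set.mem_univ y)
      have hmi : m ≠ i := fun h ↦ hyi (h ▸ hm)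
      have hint : ∀ w ∈ J, w ∈ A m → w ∈ interior (A m) := by
        intro w hwJ hwm
        by_cases hwE : w ∈ E
        · exact absurd (hunique hwm (hJE w hwJ hwE)) hmi
        · obtain ⟨k, hk⟩ := Set.mem_iUnion.1 (not_not.1 hwE)
          rwa [hunique hwm (interior_subset hk)]
      have := hJc.isPreconnected.subset_left_of_subset_union (u := interior (A m)) (v := (A m)ᶜ)
        isOpen_interior (hA m).isOpen_compl
        (Set.disjoint_left.2 fun w h1 h2 ↦ h2 (interior_subset h1))
        (fun w hw ↦ by
          by_cases h : w ∈ A m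
          · exact Or.inl (hint w hw h)
          · exact Or.inr h) ⟨y, hyJ, hint y hyJ hm⟩
      exact hmi (hunique (interior_subset (this hxJ)) hxA)
    exact x.2 (Set.mem_iUnion.2 ⟨i, mem_interior.2 ⟨J, hsub, hJo, hxJ⟩⟩)

/-! ### Isolation of geodesics that end in a cusp -/

lemma torusShift_smul_of_smul_infty {g : GL (Fin 2) ℝ} (hg : g ∈ torusGL)
    (h : g • (OnePoint.infty : OnePoint ℝ) = OnePoint.infty) :
    ∃ k : ℤ, ∀ a : OnePoint ℝ, g • a = torusShift k • a := by
  obtain ⟨k, rfl | rfl⟩ := eq_torusShift_of_smul_infty hg h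
  · exact ⟨k, fun _ ↦ rfl⟩
  · exact ⟨k, fun a ↦ neg_smul_onePoint _ a⟩

lemma eventually_eq_of_infty_orbit (a b : OnePoint ℝ) (y : ℝ) :
    ∀ᶠ x : ℝ in nhds y, (∃ g ∈ torusGL, g • a = OnePoint.infty ∧ g • b = (x : OnePoint ℝ)) →
      x = y := by
  set Y : Set ℝ := {x | ∃ g ∈ torusGL, g • a = OnePoint.infty ∧ g • b = (x : OnePoint ℝ)} with hY
  have hsep : ∀ s ∈ Y, ∀ t ∈ Y, |t - s| < 6 → t = s := by
    rintro s ⟨g, hg, hga, hgb⟩ t ⟨h, hh, hha, hhb⟩ hst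
    obtain ⟨k, hk⟩ := torusShift_smul_of_smul_infty (mul_mem hh (inv_mem hg)) (by
      rw [mul_smul, ← hga, inv_smul_smul, hha, hga])
    have := hk s
    rw [mul_smul, ← hgb, inv_smul_smul, hhb, hgb, torusShift_smul_coe] at this
    have ht : t = s + 6 * k := OnePoint.coe_injective this
    rw [ht, add_sub_cancel_left, abs_mul, abs_of_pos (by norm_num : (0 : ℝ) < 6)] at hst
    have : |(k : ℝ)| < 1 := by linarith
    have : |k| < 1 := by exact_mod_cast this
    rw [Int.abs_lt_one_iff] at this
    rw [ht, this]; simp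
  by_cases hex : ∃ s ∈ Y, |s - y| < 3 ∧ s ≠ y
  · obtain ⟨s, hs, hs3, hsy⟩ := hex
    have hpos : 0 < |s - y| := abs_pos.2 (sub_ne_zero.2 hsy)
    filter_upwards [Metric.ball_mem_nhds y hpos] with x hx hxY
    rw [Metric.mem_ball, Real.dist_eq] at hx
    have hxs : x = s := hsep s hs x hxY (by
      have := abs_sub_le x y s
      rw [abs_sub_comm y s] at this; linarith)
    rw [hxs] at hx
    exact absurd hx (lt_irrefl _)
  · filter_upwards [Metric.ball_mem_nhds y (by norm_num : (0 : ℝ) < 3)] with x hx hxY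
    rw [Metric.mem_ball, Real.dist_eq] at hx
    by_contra hne
    exact hex ⟨x, hxY, hx, hne⟩

/-- Geodesics of a family that is invariant under the group, without crossings, do not accumulate at
a geodesic of the family that ends at `∞`. -/
lemma eventually_re_eq_of_mem {ι : Type*} [Finite ι] {a b : ι → OnePoint ℝ}
    (hne : ∀ i, a i ≠ b i)
    (hdis : ∀ i j, ∀ g ∈ torusGL, ∀ w, w ∈ idealGeodesic (a i) (b i) →
      w ∈ idealGeodesic (g • a j) (g • b j) →
      idealGeodesic (a i) (b i) = idealGeodesic (g • a j) (g • b j))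
    {i : ι} {h : GL (Fin 2) ℝ} (hh : h ∈ torusGL) {y : ℝ}
    (hy : idealGeodesic (h • a i) (h • b i) = idealGeodesic y OnePoint.infty)
    {z : ℍ} (hz : z.re = y) :
    ∀ᶠ w in nhds z, ∀ j, ∀ g ∈ torusGL, w ∈ idealGeodesic (g • a j) (g • b j) → w.re = y := by
  have H : ∀ (k : ℤ) j, ∀ g ∈ torusGL, ∀ w ∈ idealGeodesic (g • a j) (g • b j),
      w.re = y + 6 * k → ∀ w' : ℍ, w'.re = y + 6 * k →
      w' ∈ idealGeodesic (g • a j) (g • b j) := by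
    intro k j g hg w hw hwk w' hw'k
    set f := h⁻¹ * torusShift (-k) with hf
    have hfm : f ∈ torusGL := mul_mem (inv_mem hh) (torusShift_mem _)
    have hmem : ∀ u : ℍ, u.re = y + 6 * k → f • u ∈ idealGeodesic (a i) (b i) := by
      intro u hu
      rw [← smul_mem_idealGeodesic_iff h, hf, mul_smul, smul_inv_smul, hy,
        mem_idealGeodesic_coe_infty, torusShift_smul_re, hu]
      push_cast; ring
    have hmem' : ∀ u : ℍ, f • u ∈ idealGeodesic ((f * g) • a j) ((f * g) • b j) ↔
        u ∈ idealGeodesic (g • a j) (g • b j) := by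
      intro u
      rw [mul_smul f g (a j), mul_smul f g (b j), smul_mem_idealGeodesic_iff]
    rw [← hmem', ← hdis i j (f * g) (mul_mem hfm hg) (f • w) (hmem w hwk) ((hmem' w).2 hw)]
    exact hmem w' hw'k
  have c1 := UpperHalfPlane.continuous_re.tendsto z
  rw [hz] at c1
  have e1 : ∀ᶠ w : ℍ in nhds z, |w.re - y| < 6 := by
    have : Filter.Tendsto (fun w : ℍ ↦ |w.re - y|) (nhds z) (nhds |y - y|) :=
      (c1.sub_const y).abs
    exact this.eventually_lt_const (by simp)
  have e2 : ∀ᶠ w : ℍ in nhds z, 6 * |w.re - y| < w.im ^ 2 := by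
    have t1 : Filter.Tendsto (fun w : ℍ ↦ 6 * |w.re - y|) (nhds z) (nhds (6 * |y - y|)) :=
      ((c1.sub_const y).abs).const_mul 6
    have t2 : Filter.Tendsto (fun w : ℍ ↦ w.im ^ 2) (nhds z) (nhds (z.im ^ 2)) :=
      (UpperHalfPlane.continuous_im.tendsto z).pow 2
    exact t1.eventually_lt t2 (by simpa using pow_pos z.im_pos 2)
  have e3 := Filter.eventually_all.2 fun j ↦
    (c1.eventually (eventually_eq_of_infty_orbit (a j) (b j) y)).and
      (c1.eventually (eventually_eq_of_infty_orbit (b j) (a j) y))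
  filter_upwards [e1, e2, e3] with w h1 h2 h3 j g hg hw
  have hne' : g • a j ≠ g • b j := fun he ↦ hne j (smul_left_cancel g he)
  have H' := fun k ↦ H k j g hg
  obtain ⟨h3a, h3b⟩ := h3 j
  have h3a' := fun hc hd ↦ h3a ⟨g, hg, hc, hd⟩
  have h3b' := fun hc hd ↦ h3b ⟨g, hg, hc, hd⟩
  clear h3a h3b h3 e1 e2 e3 H
  generalize g • a j = c at *
  generalize g • b j = d at *
  have semi : ∀ s t : ℝ, s < t → (∀ (k : ℤ), ∀ w ∈ idealGeodesic s t,
      w.re = y + 6 * k → ∀ w' : ℍ, w'.re = y + 6 * k → w' ∈ idealGeodesic s t) →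
      w ∈ idealGeodesic s t → w.re = y := by
    intro s t hst H hw
    have out : ∀ k : ℤ, 0 ≤ (y + 6 * k - s) * (y + 6 * k - t) := by
      intro k
      by_contra hneg
      rw [not_le] at hneg
      have hv : 0 < Real.sqrt (-((y + 6 * k - s) * (y + 6 * k - t))) := Real.sqrt_pos.2 (by linarith)
      have hv2 := Real.sq_sqrt (show 0 ≤ -((y + 6 * k - s) * (y + 6 * k - t)) by linarith)
      generalize Real.sqrt (-((y + 6 * k - s) * (y + 6 * k - t))) = v at hv hv2
      have := H k (hpt (y + 6 * k) v hv) (by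
        rw [mem_idealGeodesic_of_lt hst]; simp; linarith) rfl (hpt (y + 6 * k) (2 * v)
          (by linarith)) rfl
      rw [mem_idealGeodesic_of_lt hst] at this
      simp only [hpt_re, hpt_im] at this
      nlinarith
    rw [mem_idealGeodesic_of_lt hst] at hw
    have hi := pow_pos w.im_pos 2
    have o0 := out 0
    have o1 := out 1
    have o2 := out (-1)
    push_cast at o0 o1 o2
    rw [abs_lt] at h1
    generalize w.re = x at *
    generalize w.im ^ 2 = v at *
    have hsx : s < x := by
      by_contra hc
      nlinarith [mul_nonneg (show 0 ≤ s - x by linarith) (show 0 ≤ t - x by linarith)]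
    have hxt : x < t := by
      by_contra hc
      nlinarith [mul_nonneg (show 0 ≤ x - s by linarith) (show 0 ≤ x - t by linarith)]
    rcases lt_trichotomy x y with hxy | hxy | hxy
    · exfalso
      rw [abs_of_neg (by linarith)] at h2
      have ht : t ≤ y := by
        by_contra hc
        nlinarith [mul_pos (show 0 < y - s by linarith) (show 0 < t - y by linarith)]
      have hs : y - 6 ≤ s := by
        by_contra hc
        nlinarith [mul_pos (show 0 < y - 6 - s by linarith) (show 0 < t - (y - 6) by linarith)]
      nlinarith [mul_nonneg (show 0 ≤ x - s by linarith) (show 0 ≤ y - t by linarith),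
        mul_nonneg (show 0 ≤ y - x by linarith) (show 0 ≤ 6 - (x - s) by linarith)]
    · exact hxy
    · exfalso
      rw [abs_of_pos (by linarith)] at h2
      have hs : y ≤ s := by
        by_contra hc
        nlinarith [mul_pos (show 0 < y - s by linarith) (show 0 < t - y by linarith)]
      have ht : t ≤ y + 6 := by
        by_contra hc
        nlinarith [mul_pos (show 0 < y + 6 - s by linarith) (show 0 < t - (y + 6) by linarith)]
      nlinarith [mul_nonneg (show 0 ≤ t - x by linarith) (show 0 ≤ s - y by linarith),
        mul_nonneg (show 0 ≤ x - y by linarith) (show 0 ≤ 6 - (t - x) by linarith)]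
  induction c using OnePoint.rec with
  | infty =>
    induction d using OnePoint.rec with
    | infty => exact absurd rfl hne'
    | coe t =>
      rw [idealGeodesic_comm, mem_idealGeodesic_coe_infty] at hw
      exact h3a' rfl (by rw [hw])
  | coe s =>
    induction d using OnePoint.rec with
    | infty =>
      rw [mem_idealGeodesic_coe_infty] at hw
      exact h3b' rfl (by rw [hw])
    | coe t =>
      have hst : s ≠ t := fun he ↦ hne' (by rw [he])
      rcases hst.lt_or_gt with hlt | hlt
      · exact semi s t hlt H' hw
      · simp only [idealGeodesic_comm (s : OnePoint ℝ) t] at H' hw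
        exact semi t s hlt H' hw

/-! ### Triangulations and their fundamental domains -/

lemma exists_im_le_of_mem_idealTriangle (a b c : ℝ) :
    ∃ C : ℝ, ∀ z ∈ idealTriangle a b c, z.im ≤ C := by
  set s := min a (min b c) with hs
  set t := max a (max b c) with ht
  have hsa : s ≤ a := min_le_left _ _
  have hsb : s ≤ b := (min_le_right _ _).trans (min_le_left _ _)
  have hsc : s ≤ c := (min_le_right _ _).trans (min_le_right _ _)
  have hta : a ≤ t := le_max_left _ _
  have htb : b ≤ t := (le_max_left _ _).trans (le_max_right _ _)
  have htc : c ≤ t := (le_max_right _ _).trans (le_max_right _ _)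
  clear_value s t
  refine ⟨t - s + 1, fun z hz ↦ ?_⟩
  have := mem_halfPlane_of_mem_idealHull hz 1 (-s) (-1) (t + 1) (by intro h; linarith) (by
    intro r hr
    simp only [Set.mem_insert_iff, Set.mem_singleton_iff] at hr
    rcases hr with rfl | rfl | rfl <;> simp <;> exact mul_nonneg (by linarith) (by linarith))
  have hz := z.im_pos
  nlinarith [sq_nonneg (z.re - s - (t + 1 - z.re))]

lemma infty_mem_of_unbounded {a b c : OnePoint ℝ}
    (h : ∀ C : ℝ, ∃ z ∈ idealTriangle a b c, C < z.im) :
    OnePoint.infty ∈ ({a, b, c} : Set (OnePoint ℝ)) := by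
  induction a using OnePoint.rec with
  | infty => simp
  | coe a =>
    induction b using OnePoint.rec with
    | infty => simp
    | coe b =>
      induction c using OnePoint.rec with
      | infty => simp
      | coe c =>
        obtain ⟨C, hC⟩ := exists_im_le_of_mem_idealTriangle a b c
        obtain ⟨z, hz, hlt⟩ := h C
        exact absurd (hC z hz) (not_le.2 hlt)

lemma vertices_mem_of_interior_subset {x y : ℝ} (hxy : x < y) {a b c : OnePoint ℝ}
    (h : interior (idealTriangle x y OnePoint.infty) ⊆ idealTriangle a b c) :
    OnePoint.infty ∈ ({a, b, c} : Set (OnePoint ℝ)) ∧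
      (y : OnePoint ℝ) ∈ ({a, b, c} : Set (OnePoint ℝ)) := by
  have hL : 0 < y - x := sub_pos.2 hxy
  constructor
  · refine infty_mem_of_unbounded fun C ↦ ?_
    have hpos : 0 < |C| + (y - x) := by positivity
    refine ⟨hpt ((x + y) / 2) (|C| + (y - x)) hpos, h ((mem_interior_idealTriangle hxy).2 ?_), ?_⟩
    · simp only [hpt_re, hpt_im]
      refine ⟨by linarith, by linarith, ?_⟩
      nlinarith [abs_nonneg C, mul_nonneg (abs_nonneg C) hL.le, sq_nonneg |C|]
    · simp only [hpt_im]; linarith [le_abs_self C]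
  · obtain ⟨g, hg, hgy, hg0⟩ := exists_smul_eq_infty_zero (OnePoint.coe_ne_infty y)
    have hmem : OnePoint.infty ∈ ({g • a, g • b, g • c} : Set (OnePoint ℝ)) := by
      refine infty_mem_of_unbounded fun C ↦ ?_
      have h00 : g 0 0 = 0 := by
        rw [OnePoint.smul_infty_eq_ite] at hg0
        split_ifs at hg0 with h1
        · exact absurd hg0 (OnePoint.infty_ne_coe _)
        · have := OnePoint.coe_injective hg0
          rw [div_eq_zero_iff] at this
          exact this.resolve_right h1
      have h11 : g 1 1 = -(g 1 0 * y) := by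
        rw [OnePoint.smul_some_eq_ite] at hgy
        split_ifs at hgy with h1
        · linarith
        · exact absurd hgy (OnePoint.coe_ne_infty _)
      have hdet := det_val_eq g
      rw [h00, zero_mul, zero_sub] at hdet
      rw [hdet] at hg
      have h10 : g 1 0 ≠ 0 := fun h0 ↦ by simp [h0] at hg
      set K := -(g 0 1 * g 1 0) / (g 1 0) ^ 2 with hK
      have hKpos : 0 < K := by positivity
      set v := min ((y - x) / 2) (K / (2 * (|C| + 1))) with hv
      have hC : 0 < |C| + 1 := by positivity
      have hvpos : 0 < v := by positivity
      have hv1 : v ≤ (y - x) / 2 := min_le_left _ _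
      have hv2 : v ≤ K / (2 * (|C| + 1)) := min_le_right _ _
      set δ := v ^ 2 / (y - x) with hδ
      have hδpos : 0 < δ := by positivity
      have hδv : δ * (y - x) = v ^ 2 := by rw [hδ]; field_simp
      have hδle : δ ≤ v := by
        rw [hδ, div_le_iff₀ hL]; nlinarith
      refine ⟨g • hpt (y - δ) v hvpos, (smul_mem_idealTriangle_iff g).2
        (h ((mem_interior_idealTriangle hxy).2 ?_)), ?_⟩
      · simp only [hpt_re, hpt_im]
        exact ⟨by linarith, by linarith, by nlinarith⟩
      · rw [im_smul_eq, h00, h11]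
        simp only [hpt_re, hpt_im, zero_mul, zero_sub]
        rw [abs_of_pos hg]
        have e : -(g 0 1 * g 1 0) * v / ((g 1 0 * (y - δ) + -(g 1 0 * y)) ^ 2 + (g 1 0 * v) ^ 2) =
            K * v / (δ ^ 2 + v ^ 2) := by
          rw [hK]
          have : (g 1 0 * (y - δ) + -(g 1 0 * y)) ^ 2 + (g 1 0 * v) ^ 2 =
            g 1 0 ^ 2 * (δ ^ 2 + v ^ 2) := by ring
          rw [this]; field_simp
        rw [e, lt_div_iff₀ (by positivity)]
        rw [le_div_iff₀ (by positivity)] at hv2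
        have h1 : C * (δ ^ 2 + v ^ 2) ≤ |C| * (2 * v ^ 2) := by
          have : C * (δ ^ 2 + v ^ 2) ≤ |C| * (δ ^ 2 + v ^ 2) :=
            mul_le_mul_of_nonneg_right (le_abs_self C) (by positivity)
          nlinarith [abs_nonneg C, mul_nonneg (abs_nonneg C) (show 0 ≤ v ^ 2 - δ ^ 2 by nlinarith)]
        nlinarith [mul_le_mul_of_nonneg_right hv2 hvpos.le, pow_pos hvpos 2]
    have : g • (y : OnePoint ℝ) ∈ ((g • ·) '' {a, b, c} : Set (OnePoint ℝ)) := by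
      rw [Set.image_insert_eq, Set.image_pair, hgy]; exact hmem
    exact (MulAction.injective g).mem_set_image.1 this

lemma isPreconnected_interior_idealTriangle {a b : ℝ} (hab : a < b) :
    IsPreconnected (interior (idealTriangle a b OnePoint.infty)) := by
  rw [← UpperHalfPlane.isOpenEmbedding_coe.isInducing.isPreconnected_image]
  set F : ℝ × ℝ → ℂ := fun p ↦ (p.1 : ℂ) + (Real.sqrt ((p.1 - a) * (b - p.1) + p.2) : ℂ) * Complex.I
    with hF
  have hFc : Continuous F := by rw [hF]; fun_prop
  have himg : ((↑) : ℍ → ℂ) '' interior (idealTriangle a b OnePoint.infty) =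
      F '' (Set.Ioo a b ×ˢ Set.Ioi 0) := by
    ext w
    constructor
    · rintro ⟨z, hz, rfl⟩
      obtain ⟨h1, h2, h3⟩ := (mem_interior_idealTriangle hab).1 hz
      refine ⟨(z.re, (z.re - a) * (z.re - b) + z.im ^ 2), ⟨⟨h1, h2⟩, h3⟩, ?_⟩
      have e : (z.re - a) * (b - z.re) + ((z.re - a) * (z.re - b) + z.im ^ 2) = z.im ^ 2 := by ring
      simp only [hF, e, Real.sqrt_sq z.im_pos.le]
      apply Complex.ext <;> simp
    · rintro ⟨⟨x, v⟩, ⟨⟨h1, h2⟩, h3⟩, rfl⟩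
      have hv : 0 < v := h3
      have hpos : 0 < (x - a) * (b - x) + v := by
        have := mul_pos (sub_pos.2 h1) (sub_pos.2 h2); simp only at this; linarith
      refine ⟨hpt x (Real.sqrt ((x - a) * (b - x) + v)) (Real.sqrt_pos.2 hpos),
        (mem_interior_idealTriangle hab).2 ⟨h1, h2, ?_⟩, ?_⟩
      · simp only [hpt_re, hpt_im]
        rw [Real.sq_sqrt hpos.le]; linarith
      · simp only [hF]
        apply Complex.ext <;> simp [hpt]
  rw [himg]
  exact (isPreconnected_Ioo.prod isPreconnected_Ioi).image _ hFc.continuousOn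

lemma translate_eq_of_inter_nonempty {U : Set ℍ} (hU : Set.InjOn torusProj U) {g k : torusGL}
    (h : ({z | (g : GL (Fin 2) ℝ)⁻¹ • z ∈ U} ∩ {z | (k : GL (Fin 2) ℝ)⁻¹ • z ∈ U}).Nonempty) :
    {z | (g : GL (Fin 2) ℝ)⁻¹ • z ∈ U} = {z | (k : GL (Fin 2) ℝ)⁻¹ • z ∈ U} := by
  obtain ⟨z, h1, h2⟩ := h
  have := hU h1 h2 ((torusProj_eq_iff.2 ⟨g, g.2, smul_inv_smul (g : GL (Fin 2) ℝ) z⟩).trans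
    (torusProj_eq_iff.2 ⟨(k : GL (Fin 2) ℝ)⁻¹, inv_mem k.2, rfl⟩))
  have hfix : (k * g⁻¹ : GL (Fin 2) ℝ) • z = z := by
    rw [Subgroup.coe_inv, mul_smul, this, smul_inv_smul]
  have hpm := eq_one_or_neg_one_of_smul_eq (mul_mem k.2 (g⁻¹).2) hfix
  ext w
  have := smul_of_eq_one_or_neg_one hpm w
  rw [Subgroup.coe_inv, mul_smul, smul_eq_iff_eq_inv_smul] at this
  rw [Set.mem_ofPred_eq, Set.mem_ofPred_eq, this]

lemma isOpen_translate {U : Set ℍ} (hU : IsOpen U) (g : torusGL) :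
    IsOpen {z | (g : GL (Fin 2) ℝ)⁻¹ • z ∈ U} :=
  hU.preimage (continuous_const_smul (g : GL (Fin 2) ℝ)⁻¹)

lemma mem_of_eventually_side {F : Set ℍ} (hF : IsClosed F) {z : ℍ} {e : ℝ} (he : e ≠ 0)
    (h : ∀ᶠ w in nhds z, 0 < e * (w.re - z.re) → w ∈ F) : z ∈ F := by
  by_contra hz
  obtain ⟨ε, hε, hball⟩ := eventually_nhds_iff_re_im.1
    (h.and (hF.isOpen_compl.mem_nhds hz : ∀ᶠ w in nhds z, w ∈ Fᶜ))
  have he' : 0 < |e| := abs_pos.2 he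
  obtain ⟨h1, h2⟩ := hball (hpt (z.re + ε / 2 * (e / |e|)) z.im z.im_pos) (by
    simp only [hpt_re, add_sub_cancel_left, abs_mul, abs_div, abs_abs]
    rw [div_self he'.ne', mul_one, abs_of_pos hε, abs_of_pos two_pos]; linarith) (by simpa using hε)
  refine h2 (h1 ?_)
  have : e * (z.re + ε / 2 * (e / |e|) - z.re) = ε / 2 * |e| := by
    rw [add_sub_cancel_left]
    field_simp
    exact (sq_abs e).symm
  rw [hpt_re, this]; positivity

namespace TorusIdealTriangulation

variable (T : TorusIdealTriangulation)

lemma eq_of_mem_of_mem {s t : Set ModularTorus} (hs : s ∈ T.edges ∪ T.triangles)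
    (ht : t ∈ T.edges ∪ T.triangles) {x : ModularTorus} (hxs : x ∈ s) (hxt : x ∈ t) : s = t := by
  by_contra hne
  exact Set.disjoint_left.1 (T.pairwiseDisjoint hs ht hne) hxs hxt

lemma injOn_and_side_mem_edges {x y : ℝ} (hxy : x < y)
    (h : torusProj '' interior (idealTriangle x y OnePoint.infty) ∈ T.triangles) :
    Set.InjOn torusProj (interior (idealTriangle x y OnePoint.infty)) ∧
      torusProj '' idealGeodesic y OnePoint.infty ∈ T.edges := by
  obtain ⟨a, b, c, hab, hbc, hca, hinj, ht, hab', hbc', hca'⟩ := T.triangle_of_mem _ h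
  set O : torusGL → Set ℍ :=
    fun g ↦ {z | (g : GL (Fin 2) ℝ)⁻¹ • z ∈ interior (idealTriangle a b c)} with hO
  have hOo : ∀ g, IsOpen (O g) := isOpen_translate isOpen_interior
  have hOeq : ∀ g k, (O g ∩ O k).Nonempty → O g = O k := fun g k ↦
    translate_eq_of_inter_nonempty hinj
  have hcov : interior (idealTriangle x y OnePoint.infty) ⊆ ⋃ g, O g := by
    intro z hz
    have : torusProj z ∈ torusProj '' interior (idealTriangle a b c) := ht ▸ ⟨z, hz, rfl⟩
    obtain ⟨w, hw, hwz⟩ := this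
    obtain ⟨g, hg, rfl⟩ := torusProj_eq_iff.1 hwz
    exact Set.mem_iUnion.2 ⟨⟨g, hg⟩, by simpa [hO] using hw⟩
  obtain ⟨z, hz⟩ : (interior (idealTriangle x y OnePoint.infty)).Nonempty := by
    refine ⟨hpt ((x + y) / 2) (y - x) (by linarith), (mem_interior_idealTriangle hxy).2 ?_⟩
    simp only [hpt_re, hpt_im]
    exact ⟨by linarith, by linarith, by nlinarith⟩
  obtain ⟨⟨g, hg⟩, hgz⟩ := Set.mem_iUnion.1 (hcov hz)
  have hsub := (isPreconnected_interior_idealTriangle hxy).subset_of_cover hOo hOeq hcov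
    ⟨z, hz, hgz⟩
  constructor
  · intro z hz w hw hzw
    refine smul_left_cancel g⁻¹ (hinj (hsub hz) (hsub hw) ?_)
    simp only
    rw [torusProj_eq_iff.2 ⟨g, hg, smul_inv_smul g z⟩, hzw,
      torusProj_eq_iff.2 ⟨g, hg, smul_inv_smul g w⟩]
  · have hvert := vertices_mem_of_interior_subset hxy (a := g • a) (b := g • b) (c := g • c) (by
      intro w hw
      have := interior_subset (hsub hw)
      rwa [← smul_mem_idealTriangle_iff g, smul_inv_smul] at this)
    rw [← image_torusProj_idealGeodesic_smul hg] at hab' hbc' hca'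
    simp only [Set.mem_insert_iff, Set.mem_singleton_iff] at hvert
    have hne : (y : OnePoint ℝ) ≠ OnePoint.infty := OnePoint.coe_ne_infty y
    rcases hvert with ⟨h1 | h1 | h1, h2 | h2 | h2⟩
    all_goals first
      | exact absurd (h2.trans h1.symm) hne
      | (rw [h1, h2]; assumption)
      | (rw [h1, h2, idealGeodesic_comm]; assumption)

/-- After a motion that moves an end of an edge to `∞`, other edges stay away from it locally. -/
lemma exists_eventually_re_eq {z : ℍ} (hz : torusProj z ∈ ⋃₀ T.edges) :
    ∃ k ∈ torusGL, ∀ᶠ w in nhds (k • z), torusProj w ∈ ⋃₀ T.edges → w.re = (k • z).re := by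
  have : Finite T.edges := T.edges_finite.to_subtype
  choose a b hab ha hb hinj he using fun e : T.edges ↦ T.isIdealArc_of_mem e e.2
  have hdis : ∀ i j, ∀ g ∈ torusGL, ∀ w, w ∈ idealGeodesic (a i) (b i) →
      w ∈ idealGeodesic (g • a j) (g • b j) →
      idealGeodesic (a i) (b i) = idealGeodesic (g • a j) (g • b j) := by
    intro i j g hg w hw hwg
    have hij : (i : Set ModularTorus) = j := by
      refine T.eq_of_mem_of_mem (x := torusProj w) (Or.inl i.2) (Or.inl j.2) ?_ ?_
      · rw [he i]; exact ⟨w, hw, rfl⟩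
      · rw [he j, ← image_torusProj_idealGeodesic_smul hg]; exact ⟨w, hwg, rfl⟩
    obtain rfl : i = j := Subtype.ext hij
    have hmem : g⁻¹ • w ∈ idealGeodesic (a i) (b i) := by
      rwa [← smul_mem_idealGeodesic_iff g, smul_inv_smul]
    have := hinj i hw hmem (torusProj_eq_iff.2 ⟨g⁻¹, inv_mem hg, rfl⟩)
    have hpm := eq_one_or_neg_one_of_smul_eq hg (z := w) (by rw [← eq_inv_smul_iff]; exact this)
    rw [smul_onePoint_of_eq_one_or_neg_one hpm, smul_onePoint_of_eq_one_or_neg_one hpm]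
  have hmem : ∀ w : ℍ, torusProj w ∈ ⋃₀ T.edges →
      ∃ j, ∃ g ∈ torusGL, w ∈ idealGeodesic (g • a j) (g • b j) := by
    rintro w ⟨e, heT, hwe⟩
    obtain ⟨u, hu, huw⟩ := (he ⟨e, heT⟩).subset hwe
    obtain ⟨g, hg, rfl⟩ := torusProj_eq_iff.1 huw
    exact ⟨_, g, hg, (smul_mem_idealGeodesic_iff g).2 hu⟩
  obtain ⟨i, g, hg, hzg⟩ := hmem z hz
  obtain ⟨f, hf, hfa⟩ := isTorusCusp_iff.1 (ha i)
  have hk : f⁻¹ * g⁻¹ ∈ torusGL := mul_mem (inv_mem hf) (inv_mem hg)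
  have hka : (f⁻¹ * g⁻¹ * g) • a i = OnePoint.infty := by
    rw [inv_mul_cancel_right, ← hfa, inv_smul_smul]
  obtain ⟨y, hy⟩ : ∃ y : ℝ, (y : OnePoint ℝ) = (f⁻¹ * g⁻¹ * g) • b i :=
    OnePoint.ne_infty_iff_exists.1 fun h ↦ hab i (smul_left_cancel _ (hka.trans h.symm))
  have hgeo : idealGeodesic ((f⁻¹ * g⁻¹ * g) • a i) ((f⁻¹ * g⁻¹ * g) • b i) =
      idealGeodesic y OnePoint.infty := by rw [hka, ← hy, idealGeodesic_comm]
  have hre : ((f⁻¹ * g⁻¹) • z).re = y := by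
    rw [← mem_idealGeodesic_coe_infty, ← hgeo, mul_smul _ g, mul_smul _ g,
      smul_mem_idealGeodesic_iff]
    exact hzg
  refine ⟨f⁻¹ * g⁻¹, hk, ?_⟩
  rw [hre]
  filter_upwards [eventually_re_eq_of_mem hab hdis (mul_mem hk hg) hgeo hre] with w hw hwe
  obtain ⟨j, k, hk, hwk⟩ := hmem w hwe
  exact hw j k hk hwk

/-- The union of two ideal triangles with a common side that project to the triangles of an ideal
triangulation is a fundamental domain. -/
theorem isTorusFundamentalDomain {x₁ x₂ x₃ : ℝ} (h₁₂ : x₁ < x₂) (h₂₃ : x₂ < x₃)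
    (hne : torusProj '' interior (idealTriangle x₁ x₂ OnePoint.infty) ≠
      torusProj '' interior (idealTriangle x₂ x₃ OnePoint.infty))
    (hT : T.triangles = {torusProj '' interior (idealTriangle x₁ x₂ OnePoint.infty),
      torusProj '' interior (idealTriangle x₂ x₃ OnePoint.infty)}) :
    IsTorusFundamentalDomain (idealQuadrilateral x₁ x₂ x₃ OnePoint.infty) := by
  set D := idealQuadrilateral x₁ x₂ x₃ OnePoint.infty with hD
  set U₁ := interior (idealTriangle x₁ x₂ OnePoint.infty) with hU₁
  set U₂ := interior (idealTriangle x₂ x₃ OnePoint.infty) with hU₂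
  set E := idealGeodesic (x₂ : OnePoint ℝ) OnePoint.infty with hE
  have m₁ : torusProj '' U₁ ∈ T.triangles := by rw [hT]; simp
  have m₂ : torusProj '' U₂ ∈ T.triangles := by rw [hT]; simp
  obtain ⟨inj₁, mE⟩ := T.injOn_and_side_mem_edges h₁₂ m₁
  obtain ⟨inj₂, -⟩ := T.injOn_and_side_mem_edges h₂₃ m₂
  have hET : ∀ t ∈ T.triangles, ∀ z ∈ E, torusProj z ∉ t := by
    intro t ht z hz hzt
    have := T.eq_of_mem_of_mem (Or.inl mE) (Or.inr ht) ⟨z, hz, rfl⟩ hzt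
    exact Set.disjoint_left.1 T.edges_disjoint_triangles mE (this ▸ ht)
  have hint : ∀ z ∈ interior D, z ∈ U₁ ∨ z ∈ U₂ ∨ z ∈ E := by
    intro z hz
    obtain ⟨h1, h2, h3, h4⟩ := (mem_interior_idealQuadrilateral h₁₂ h₂₃).1 hz
    rcases lt_trichotomy z.re x₂ with h | h | h
    · exact Or.inl ((mem_interior_idealTriangle h₁₂).2 ⟨h1, h, h3⟩)
    · exact Or.inr (Or.inr (mem_idealGeodesic_coe_infty.2 h))
    · exact Or.inr (Or.inl ((mem_interior_idealTriangle h₂₃).2 ⟨h, h2, h4⟩))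
  have hED : ∀ z ∈ E, ∀ᶠ w in nhds z, w ∈ U₁ ∨ w ∈ U₂ ∨ w ∈ E := by
    intro z hz
    have hz' : z.re = x₂ := mem_idealGeodesic_coe_infty.1 hz
    have hzint : z ∈ interior D := by
      rw [hD, mem_interior_idealQuadrilateral h₁₂ h₂₃, hz']
      have := pow_pos z.im_pos 2
      exact ⟨h₁₂, h₂₃, by simpa using this, by simpa using this⟩
    filter_upwards [isOpen_interior.mem_nhds hzint] with w hw using hint w hw
  have injE : Set.InjOn torusProj E := by
    intro z hz w hw hzw
    obtain ⟨g, hg, rfl⟩ := torusProj_eq_iff.1 hzw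
    by_cases heq : E = idealGeodesic (g • (x₂ : OnePoint ℝ)) (g • OnePoint.infty)
    · rcases eq_of_idealGeodesic_eq (OnePoint.coe_ne_infty _)
        (fun h ↦ OnePoint.coe_ne_infty x₂ (smul_left_cancel g h)) heq with ⟨h1, h2⟩ | ⟨h1, h2⟩
      · obtain ⟨k, hk⟩ := eq_torusShift_of_smul_infty hg h2.symm
        have h3 : (torusShift k) • (x₂ : OnePoint ℝ) = x₂ := by
          rcases hk with rfl | rfl
          · exact h1.symm
          · rw [neg_smul_onePoint] at h1; exact h1.symm
        rw [torusShift_smul_coe] at h3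
        have h4 := OnePoint.coe_injective h3
        have h5 : k = 0 := by
          have : (k : ℝ) = 0 := by linarith
          exact_mod_cast this
        subst h5
        have : g = 1 ∨ g = -1 := by simpa [torusShift] using hk
        exact (smul_of_eq_one_or_neg_one this z).symm
      · exact (not_swap_of_mem hg (OnePoint.coe_ne_infty _) h2.symm h1.symm).elim
    · exfalso
      have := (frequently_omega_neg (OnePoint.coe_ne_infty x₂)
        (fun h ↦ OnePoint.coe_ne_infty x₂ (smul_left_cancel g h)) hw
        ((smul_mem_idealGeodesic_iff g).2 hz) heq).and_eventually (hED _ hw)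
      obtain ⟨w, ⟨h1, h2⟩, h3⟩ := this.exists
      have hu : g⁻¹ • w ∈ E := by
        rw [hE, ← smul_mem_idealGeodesic_iff g, smul_inv_smul]; exact h1
      have hp : torusProj (g⁻¹ • w) = torusProj w :=
        torusProj_eq_iff.2 ⟨g, hg, smul_inv_smul g w⟩
      rcases h3 with h3 | h3 | h3
      · exact hET _ m₁ _ hu (hp ▸ ⟨w, h3, rfl⟩)
      · exact hET _ m₂ _ hu (hp ▸ ⟨w, h3, rfl⟩)
      · rw [hE, mem_idealGeodesic_iff (OnePoint.coe_ne_infty _)] at h3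
        exact h2.ne h3
  have h12 : ∀ z ∈ U₁, ∀ w ∈ U₂, torusProj z ≠ torusProj w := fun z hz w hw h ↦
    hne (T.eq_of_mem_of_mem (Or.inr m₁) (Or.inr m₂) ⟨z, hz, rfl⟩ ⟨w, hw, h.symm⟩)
  have h1E : ∀ z ∈ U₁, ∀ w ∈ E, torusProj z ≠ torusProj w := fun z hz w hw h ↦
    hET _ m₁ w hw ⟨z, hz, h⟩
  have h2E : ∀ z ∈ U₂, ∀ w ∈ E, torusProj z ≠ torusProj w := fun z hz w hw h ↦
    hET _ m₂ w hw ⟨z, hz, h⟩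
  have hsub₁ : U₁ ⊆ D := by
    intro z hz
    obtain ⟨h1, h2, h3⟩ := (mem_interior_idealTriangle h₁₂).1 hz
    exact (mem_idealQuadrilateral h₁₂ h₂₃).2 ⟨h1.le, by linarith, h3.le, by
      nlinarith [pow_pos z.im_pos 2, mul_pos (sub_pos.2 h2) (sub_pos.2 (h2.trans h₂₃))]⟩
  have hsub₂ : U₂ ⊆ D := by
    intro z hz
    obtain ⟨h1, h2, h3⟩ := (mem_interior_idealTriangle h₂₃).1 hz
    exact (mem_idealQuadrilateral h₁₂ h₂₃).2 ⟨by linarith, h2.le, by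
      nlinarith [pow_pos z.im_pos 2, mul_pos (sub_pos.2 h1) (sub_pos.2 (h₁₂.trans h1))], h3.le⟩
  have hDc : IsClosed D := isClosed_idealQuadrilateral h₁₂ h₂₃
  refine ⟨hDc, ?_, ?_⟩
  · intro p _
    obtain ⟨z, rfl⟩ : ∃ z, torusProj z = p := Quotient.exists_rep p
    have hcov : ∀ w : ℍ, torusProj w ∈ ⋃₀ T.edges ∨ torusProj w ∈ torusProj '' U₁ ∨
        torusProj w ∈ torusProj '' U₂ := by
      intro w
      obtain ⟨s, hs | hs, hws⟩ := T.cover.symm.subset (Set.mem_univ (torusProj w))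
      · exact Or.inl ⟨s, hs, hws⟩
      · rw [hT] at hs
        rcases hs with rfl | rfl
        · exact Or.inr (Or.inl hws)
        · exact Or.inr (Or.inr hws)
    rcases hcov z with hz | ⟨w, hw, hwz⟩ | ⟨w, hw, hwz⟩
    · obtain ⟨k, hk, hev⟩ := T.exists_eventually_re_eq hz
      set O : torusGL × Bool → Set ℍ :=
        fun i ↦ {w | (i.1 : GL (Fin 2) ℝ)⁻¹ • w ∈ bif i.2 then U₁ else U₂} with hO
      have hOo : ∀ i, IsOpen (O i) := by
        rintro ⟨g, _ | _⟩
        · exact isOpen_translate isOpen_interior g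
        · exact isOpen_translate isOpen_interior g
      have hp : ∀ (g : torusGL) (w : ℍ), torusProj ((g : GL (Fin 2) ℝ)⁻¹ • w) = torusProj w :=
        fun g w ↦ torusProj_eq_iff.2 ⟨g, g.2, smul_inv_smul _ w⟩
      have hOeq : ∀ i j, (O i ∩ O j).Nonempty → O i = O j := by
        rintro ⟨g, _ | _⟩ ⟨k, _ | _⟩ ⟨w, h1, h2⟩
        · exact translate_eq_of_inter_nonempty inj₂ ⟨w, h1, h2⟩
        · exact (h12 _ h2 _ h1 ((hp _ _).trans (hp _ _).symm)).elim
        · exact (h12 _ h1 _ h2 ((hp _ _).trans (hp _ _).symm)).elim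
        · exact translate_eq_of_inter_nonempty inj₁ ⟨w, h1, h2⟩
      obtain ⟨⟨g, b⟩, hi⟩ := exists_eventually_mem_of_side (e := 1) hOo hOeq one_ne_zero (z := k • z) (by
        filter_upwards [hev] with w hw hlt
        rcases hcov w with h | ⟨u, hu, huw⟩ | ⟨u, hu, huw⟩
        · exact absurd (hw h) (by intro h; rw [h] at hlt; simp at hlt)
        · obtain ⟨g, hg, rfl⟩ := torusProj_eq_iff.1 huw
          exact ⟨(⟨g, hg⟩, true), by simpa [hO] using hu⟩
        · obtain ⟨g, hg, rfl⟩ := torusProj_eq_iff.1 huw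
          exact ⟨(⟨g, hg⟩, false), by simpa [hO] using hu⟩)
      have hmem : k • z ∈ {w | (g : GL (Fin 2) ℝ)⁻¹ • w ∈ D} := by
        refine mem_of_eventually_side (hDc.preimage (continuous_const_smul _)) one_ne_zero ?_
        filter_upwards [hi] with w hw hlt
        cases b
        · exact hsub₂ (hw hlt)
        · exact hsub₁ (hw hlt)
      exact ⟨_, hmem, (hp g _).trans (torusProj_eq_iff.2 ⟨k, hk, rfl⟩).symm⟩
    · exact ⟨w, hsub₁ hw, hwz⟩
    · exact ⟨w, hsub₂ hw, hwz⟩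
  · intro z hz w hw hzw
    rcases hint z hz with h | h | h <;> rcases hint w hw with h' | h' | h'
    · exact inj₁ h h' hzw
    · exact (h12 _ h _ h' hzw).elim
    · exact (h1E _ h _ h' hzw).elim
    · exact (h12 _ h' _ h hzw.symm).elim
    · exact inj₂ h h' hzw
    · exact (h2E _ h _ h' hzw).elim
    · exact (h1E _ h' _ h hzw.symm).elim
    · exact (h2E _ h' _ h hzw.symm).elim
    · exact injE h h' hzw

end TorusIdealTriangulation

/-! ### Sides of a fundamental quadrilateral -/

/-- The vertices of an ideal quadrilateral in cyclic order. -/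
def quadVertex (x₁ x₂ x₃ : ℝ) : Fin 4 → OnePoint ℝ := ![OnePoint.infty, x₁, x₂, x₃]

section quadVertex

variable {x₁ x₂ x₃ : ℝ}

lemma quadVertex_injective (h₁₂ : x₁ < x₂) (h₂₃ : x₂ < x₃) :
    Function.Injective (quadVertex x₁ x₂ x₃) := by
  have h₁₃ := h₁₂.trans h₂₃
  intro i j h
  fin_cases i <;> fin_cases j <;> first
    | rfl
    | (exfalso; revert h; simp [quadVertex, h₁₂.ne, h₁₂.ne', h₂₃.ne, h₂₃.ne', h₁₃.ne, h₁₃.ne'])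

/-- A function that is negative exactly on the inner side of a side of the quadrilateral. -/
noncomputable def quadForm (x₁ x₂ x₃ : ℝ) (i : Fin 4) (z : ℍ) : ℝ :=
  omega (quadVertex x₁ x₂ x₃ i) (quadVertex x₁ x₂ x₃ (i + 1)) z

lemma quadForm_zero (z : ℍ) : quadForm x₁ x₂ x₃ 0 z = x₁ - z.re := omega_infty_coe _ _

lemma quadForm_one (z : ℍ) :
    quadForm x₁ x₂ x₃ 1 z = (x₁ - x₂) * ((z.re - x₁) * (z.re - x₂) + z.im ^ 2) :=
  omega_coe_coe _ _ _

lemma quadForm_two (z : ℍ) :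
    quadForm x₁ x₂ x₃ 2 z = (x₂ - x₃) * ((z.re - x₂) * (z.re - x₃) + z.im ^ 2) :=
  omega_coe_coe _ _ _

lemma quadForm_three (z : ℍ) : quadForm x₁ x₂ x₃ 3 z = z.re - x₃ := omega_coe_infty _ _

lemma continuous_quadForm (i : Fin 4) : Continuous (quadForm x₁ x₂ x₃ i) := by
  unfold quadForm; exact continuous_omega _ _

lemma mem_idealQuadrilateral_iff_quadForm (h₁₂ : x₁ < x₂) (h₂₃ : x₂ < x₃) {z : ℍ} :
    z ∈ idealQuadrilateral x₁ x₂ x₃ OnePoint.infty ↔ ∀ i, quadForm x₁ x₂ x₃ i z ≤ 0 := by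
  rw [mem_idealQuadrilateral h₁₂ h₂₃]
  simp only [Fin.forall_fin_succ, IsEmpty.forall_iff, and_true]
  rw [show Fin.succ (0 : Fin 3) = 1 from rfl, show (Fin.succ (Fin.succ 0) : Fin 4) = 2 from rfl,
    show (Fin.succ (Fin.succ (Fin.succ 0)) : Fin 4) = 3 from rfl, quadForm_zero, quadForm_one,
    quadForm_two, quadForm_three]
  constructor
  · rintro ⟨h1, h2, h3, h4⟩
    exact ⟨by linarith, mul_nonpos_of_nonpos_of_nonneg (by linarith) h3,
      mul_nonpos_of_nonpos_of_nonneg (by linarith) h4, by linarith⟩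
  · rintro ⟨h1, h2, h3, h4⟩
    exact ⟨by linarith, by linarith, nonneg_of_mul_nonpos_right h2 (by linarith),
      nonneg_of_mul_nonpos_right h3 (by linarith)⟩

lemma mem_interior_iff_quadForm (h₁₂ : x₁ < x₂) (h₂₃ : x₂ < x₃) {z : ℍ} :
    z ∈ interior (idealQuadrilateral x₁ x₂ x₃ OnePoint.infty) ↔
      ∀ i, quadForm x₁ x₂ x₃ i z < 0 := by
  rw [mem_interior_idealQuadrilateral h₁₂ h₂₃]
  simp only [Fin.forall_fin_succ, IsEmpty.forall_iff, and_true]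
  rw [show Fin.succ (0 : Fin 3) = 1 from rfl, show (Fin.succ (Fin.succ 0) : Fin 4) = 2 from rfl,
    show (Fin.succ (Fin.succ (Fin.succ 0)) : Fin 4) = 3 from rfl, quadForm_zero, quadForm_one,
    quadForm_two, quadForm_three]
  constructor
  · rintro ⟨h1, h2, h3, h4⟩
    exact ⟨by linarith, mul_neg_of_neg_of_pos (by linarith) h3,
      mul_neg_of_neg_of_pos (by linarith) h4, by linarith⟩
  · rintro ⟨h1, h2, h3, h4⟩
    exact ⟨by linarith, by linarith, pos_of_mul_neg_right h2 (by linarith),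
      pos_of_mul_neg_right h3 (by linarith)⟩

lemma quadForm_neg_of_eq_zero (h₁₂ : x₁ < x₂) (h₂₃ : x₂ < x₃) {z : ℍ} {i : Fin 4}
    (h : quadForm x₁ x₂ x₃ i z = 0) {j : Fin 4} (hj : j ≠ i) : quadForm x₁ x₂ x₃ j z < 0 := by
  have hy := pow_pos z.im_pos 2
  have e0 := quadForm_zero (x₁ := x₁) (x₂ := x₂) (x₃ := x₃) z
  have e1 := quadForm_one (x₁ := x₁) (x₂ := x₂) (x₃ := x₃) z
  have e2 := quadForm_two (x₁ := x₁) (x₂ := x₂) (x₃ := x₃) z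
  have e3 := quadForm_three (x₁ := x₁) (x₂ := x₂) (x₃ := x₃) z
  have i0 : quadForm x₁ x₂ x₃ 0 z = 0 → quadForm x₁ x₂ x₃ 1 z < 0 ∧ quadForm x₁ x₂ x₃ 2 z < 0 ∧
      quadForm x₁ x₂ x₃ 3 z < 0 := by
    rw [e0, e1, e2, e3]
    intro h
    have hx : z.re = x₁ := by linarith
    rw [hx]
    refine ⟨mul_neg_of_neg_of_pos (by linarith) (by simpa using hy),
      mul_neg_of_neg_of_pos (by linarith) ?_, by linarith⟩
    nlinarith
  have i3 : quadForm x₁ x₂ x₃ 3 z = 0 → quadForm x₁ x₂ x₃ 0 z < 0 ∧ quadForm x₁ x₂ x₃ 1 z < 0 ∧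
      quadForm x₁ x₂ x₃ 2 z < 0 := by
    rw [e0, e1, e2, e3]
    intro h
    have hx : z.re = x₃ := by linarith
    rw [hx]
    refine ⟨by linarith, mul_neg_of_neg_of_pos (by linarith) ?_,
      mul_neg_of_neg_of_pos (by linarith) (by simpa using hy)⟩
    nlinarith
  have i1 : quadForm x₁ x₂ x₃ 1 z = 0 → quadForm x₁ x₂ x₃ 0 z < 0 ∧ quadForm x₁ x₂ x₃ 2 z < 0 ∧
      quadForm x₁ x₂ x₃ 3 z < 0 := by
    rw [e0, e1, e2, e3]
    intro h
    have h' := (mul_eq_zero.1 h).resolve_left (by linarith)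
    have hx1 : x₁ < z.re := by
      by_contra hc
      nlinarith [mul_nonneg (show 0 ≤ x₁ - z.re by linarith) (show 0 ≤ x₂ - z.re by linarith)]
    have hx2 : z.re < x₂ := by
      by_contra hc
      nlinarith [mul_nonneg (show 0 ≤ z.re - x₁ by linarith) (show 0 ≤ z.re - x₂ by linarith)]
    refine ⟨by linarith, mul_neg_of_neg_of_pos (by linarith) ?_, by linarith⟩
    nlinarith [mul_pos (show 0 < x₂ - z.re by linarith) (show 0 < x₃ - z.re by linarith)]
  have i2 : quadForm x₁ x₂ x₃ 2 z = 0 → quadForm x₁ x₂ x₃ 0 z < 0 ∧ quadForm x₁ x₂ x₃ 1 z < 0 ∧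
      quadForm x₁ x₂ x₃ 3 z < 0 := by
    rw [e0, e1, e2, e3]
    intro h
    have h' := (mul_eq_zero.1 h).resolve_left (by linarith)
    have hx1 : x₂ < z.re := by
      by_contra hc
      nlinarith [mul_nonneg (show 0 ≤ x₂ - z.re by linarith) (show 0 ≤ x₃ - z.re by linarith)]
    have hx2 : z.re < x₃ := by
      by_contra hc
      nlinarith [mul_nonneg (show 0 ≤ z.re - x₂ by linarith) (show 0 ≤ z.re - x₃ by linarith)]
    refine ⟨by linarith, mul_neg_of_neg_of_pos (by linarith) ?_, by linarith⟩
    nlinarith [mul_pos (show 0 < z.re - x₁ by linarith) (show 0 < z.re - x₂ by linarith)]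
  clear e0 e1 e2 e3
  fin_cases i <;> fin_cases j <;> first
    | exact absurd rfl hj
    | exact (i0 h).1
    | exact (i0 h).2.1
    | exact (i0 h).2.2
    | exact (i1 h).1
    | exact (i1 h).2.1
    | exact (i1 h).2.2
    | exact (i2 h).1
    | exact (i2 h).2.1
    | exact (i2 h).2.2
    | exact (i3 h).1
    | exact (i3 h).2.1
    | exact (i3 h).2.2

end quadVertex

lemma frequently_neg_of_omega_eq_zero {a b : OnePoint ℝ} (hab : a ≠ b) {z : ℍ}
    (h : omega a b z = 0) : ∃ᶠ w in nhds z, omega a b w < 0 := by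
  obtain ⟨g, hg, hga, hgb⟩ := exists_smul_eq_infty_zero hab
  have hom : ∀ w, omega a b w < 0 ↔ 0 < (g • w).re := by
    intro w
    rw [← omega_smul_neg_iff hg, hga, hgb, omega_infty_coe]
    simp
  have hz : (g • z).re = 0 := by
    rw [← omega_smul_eq_zero_iff hg, hga, hgb, omega_infty_coe] at h
    linarith
  intro hev
  have hcont : Filter.Tendsto (fun w : ℍ ↦ g⁻¹ • w) (nhds (g • z)) (nhds z) := by
    have : ContinuousAt (fun w : ℍ ↦ g⁻¹ • w) (g • z) := (continuous_const_smul _).continuousAt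
    simpa [ContinuousAt] using this
  obtain ⟨ε, hε, hball⟩ := eventually_nhds_iff_re_im.1 (hcont.eventually hev)
  refine hball (hpt (ε / 2) (g • z).im (g • z).im_pos) ?_ (by simpa using hε) ?_
  · rw [hz, hpt_re, sub_zero, abs_of_pos (by linarith)]; linarith
  · exact (hom _).2 (by rw [smul_inv_smul]; exact half_pos hε)

lemma exists_omega_eq_zero {a b : OnePoint ℝ} (hab : a ≠ b) : ∃ z, omega a b z = 0 := by
  obtain ⟨g, hg, hga, hgb⟩ := exists_smul_eq_infty_zero hab
  refine ⟨g⁻¹ • hpt 0 1 one_pos, ?_⟩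
  rw [← omega_smul_eq_zero_iff hg, hga, hgb, smul_inv_smul, omega_infty_coe]
  simp

/-- A fundamental domain that is an ideal quadrilateral with a vertex `∞`. -/
structure IsFundamentalQuad (x₁ x₂ x₃ : ℝ) : Prop where
  lt₁₂ : x₁ < x₂
  lt₂₃ : x₂ < x₃
  isFundamentalDomain : IsTorusFundamentalDomain (idealQuadrilateral x₁ x₂ x₃ OnePoint.infty)

/-- A motion in the group maps one side of the quadrilateral to another one and exchanges the inner
and the outer side. -/
def IsSidePairing (x₁ x₂ x₃ : ℝ) (g : GL (Fin 2) ℝ) (i j : Fin 4) : Prop :=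
  g ∈ torusGL ∧ g • quadVertex x₁ x₂ x₃ j = quadVertex x₁ x₂ x₃ (i + 1) ∧
    g • quadVertex x₁ x₂ x₃ (j + 1) = quadVertex x₁ x₂ x₃ i

lemma IsSidePairing.inv {x₁ x₂ x₃ : ℝ} {g : GL (Fin 2) ℝ} {i j : Fin 4}
    (h : IsSidePairing x₁ x₂ x₃ g i j) : IsSidePairing x₁ x₂ x₃ g⁻¹ j i :=
  ⟨inv_mem h.1, by rw [← h.2.2, inv_smul_smul], by rw [← h.2.1, inv_smul_smul]⟩

namespace IsFundamentalQuad

variable {x₁ x₂ x₃ : ℝ}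

lemma vertex_ne (h : IsFundamentalQuad x₁ x₂ x₃) (i : Fin 4) :
    quadVertex x₁ x₂ x₃ i ≠ quadVertex x₁ x₂ x₃ (i + 1) := fun he ↦ by
  have := quadVertex_injective h.lt₁₂ h.lt₂₃ he
  clear he h
  revert i; decide

lemma smul_vertex_ne (h : IsFundamentalQuad x₁ x₂ x₃) (g : GL (Fin 2) ℝ) (i : Fin 4) :
    g • quadVertex x₁ x₂ x₃ i ≠ g • quadVertex x₁ x₂ x₃ (i + 1) := fun he ↦
  h.vertex_ne i (smul_left_cancel g he)

lemma mem_side_iff (h : IsFundamentalQuad x₁ x₂ x₃) {i : Fin 4} {z : ℍ} :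
    z ∈ idealGeodesic (quadVertex x₁ x₂ x₃ i) (quadVertex x₁ x₂ x₃ (i + 1)) ↔
      quadForm x₁ x₂ x₃ i z = 0 :=
  mem_idealGeodesic_iff (h.vertex_ne i)

lemma eq_one_or_neg_one (h : IsFundamentalQuad x₁ x₂ x₃) {g : GL (Fin 2) ℝ} (hg : g ∈ torusGL) {z : ℍ}
    (hz : z ∈ interior (idealQuadrilateral x₁ x₂ x₃ OnePoint.infty))
    (hgz : g • z ∈ interior (idealQuadrilateral x₁ x₂ x₃ OnePoint.infty)) : g = 1 ∨ g = -1 :=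
  eq_one_or_neg_one_of_smul_eq hg
    (h.isFundamentalDomain.injOn hz hgz (torusProj_eq_iff.2 ⟨g, hg, rfl⟩)).symm

lemma eventually_mem_interior (h : IsFundamentalQuad x₁ x₂ x₃) {i : Fin 4} {z : ℍ} (hz : quadForm x₁ x₂ x₃ i z = 0) :
    ∀ᶠ w in nhds z, quadForm x₁ x₂ x₃ i w < 0 →
      w ∈ interior (idealQuadrilateral x₁ x₂ x₃ OnePoint.infty) := by
  have : ∀ j, ∀ᶠ w in nhds z, j ≠ i → quadForm x₁ x₂ x₃ j w < 0 := by
    intro j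
    by_cases hj : j = i
    · exact Filter.Eventually.of_forall fun _ hj' ↦ absurd hj hj'
    · filter_upwards [(continuous_quadForm j).continuousAt.eventually_lt_const
        (quadForm_neg_of_eq_zero h.lt₁₂ h.lt₂₃ hz hj)] with w hw _ using hw
  filter_upwards [Filter.eventually_all.2 this] with w hw hwi
  rw [mem_interior_iff_quadForm h.lt₁₂ h.lt₂₃]
  intro j
  by_cases hj : j = i
  · rwa [hj]
  · exact hw j hj

lemma not_mem_interior (h : IsFundamentalQuad x₁ x₂ x₃) {i : Fin 4} {z : ℍ} (hz : quadForm x₁ x₂ x₃ i z = 0) :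
    z ∉ interior (idealQuadrilateral x₁ x₂ x₃ OnePoint.infty) := fun hm ↦
  ((mem_interior_iff_quadForm h.lt₁₂ h.lt₂₃).1 hm i).ne hz

lemma frequently_mem_interior (h : IsFundamentalQuad x₁ x₂ x₃) {i : Fin 4} {z : ℍ} (hz : quadForm x₁ x₂ x₃ i z = 0) :
    ∃ᶠ w in nhds z, quadForm x₁ x₂ x₃ i w < 0 ∧
      w ∈ interior (idealQuadrilateral x₁ x₂ x₃ OnePoint.infty) := by
  refine ((frequently_neg_of_omega_eq_zero (h.vertex_ne i) hz).and_eventually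
    (h.eventually_mem_interior hz)).mono ?_
  rintro w ⟨h1, h2⟩
  exact ⟨h1, h2 h1⟩

lemma tendsto_smul (g : GL (Fin 2) ℝ) (z : ℍ) :
    Filter.Tendsto (fun w : ℍ ↦ g • w) (nhds z) (nhds (g • z)) :=
  (continuous_const_smul g).continuousAt

lemma eq_one_or_neg_one_of_smul_side (h : IsFundamentalQuad x₁ x₂ x₃) {g : GL (Fin 2) ℝ} (hg : g ∈ torusGL) {i j : Fin 4}
    (h1 : g • quadVertex x₁ x₂ x₃ i = quadVertex x₁ x₂ x₃ j)
    (h2 : g • quadVertex x₁ x₂ x₃ (i + 1) = quadVertex x₁ x₂ x₃ (j + 1)) : g = 1 ∨ g = -1 := by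
  obtain ⟨z, hz⟩ := exists_omega_eq_zero (h.vertex_ne i)
  have hgz : quadForm x₁ x₂ x₃ j (g • z) = 0 := by
    unfold quadForm
    rw [← h1, ← h2, omega_smul_eq_zero_iff (det_pos_of_mem hg)]; exact hz
  obtain ⟨w, ⟨hw1, hw2⟩, hw3⟩ := ((h.frequently_mem_interior hz).and_eventually
    ((tendsto_smul g z).eventually (h.eventually_mem_interior hgz))).exists
  refine h.eq_one_or_neg_one hg hw2 (hw3 ?_)
  unfold quadForm
  rw [← h1, ← h2, omega_smul_neg_iff (det_pos_of_mem hg)]; exact hw1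

lemma smul_not_mem_interior (h : IsFundamentalQuad x₁ x₂ x₃) {g : GL (Fin 2) ℝ} (hg : g ∈ torusGL) {i : Fin 4} {z : ℍ}
    (hz : quadForm x₁ x₂ x₃ i z = 0) :
    g • z ∉ interior (idealQuadrilateral x₁ x₂ x₃ OnePoint.infty) := by
  intro hgz
  obtain ⟨w, ⟨-, hw2⟩, hw3⟩ := ((h.frequently_mem_interior hz).and_eventually
    ((tendsto_smul g z).eventually (isOpen_interior.mem_nhds hgz))).exists
  have := h.eq_one_or_neg_one hg hw2 hw3
  rw [smul_of_eq_one_or_neg_one this] at hgz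
  exact h.not_mem_interior hz hgz

/-- Different translates of sides are disjoint. -/
lemma side_eq (h : IsFundamentalQuad x₁ x₂ x₃) {g : GL (Fin 2) ℝ} (hg : g ∈ torusGL) {i j : Fin 4} {z : ℍ}
    (h1 : z ∈ idealGeodesic (quadVertex x₁ x₂ x₃ i) (quadVertex x₁ x₂ x₃ (i + 1)))
    (h2 : z ∈ idealGeodesic (g • quadVertex x₁ x₂ x₃ j) (g • quadVertex x₁ x₂ x₃ (j + 1))) :
    idealGeodesic (quadVertex x₁ x₂ x₃ i) (quadVertex x₁ x₂ x₃ (i + 1)) =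
      idealGeodesic (g • quadVertex x₁ x₂ x₃ j) (g • quadVertex x₁ x₂ x₃ (j + 1)) := by
  by_contra hne
  obtain ⟨w, ⟨hw1, hw2⟩, hw3⟩ := ((frequently_omega_neg (h.vertex_ne i) (h.smul_vertex_ne g j)
    h1 h2 hne).and_eventually (h.eventually_mem_interior (h.mem_side_iff.1 h1))).exists
  have hw4 : quadForm x₁ x₂ x₃ j (g⁻¹ • w) = 0 := by
    rw [← h.mem_side_iff, ← smul_mem_idealGeodesic_iff g, smul_inv_smul]; exact hw1
  have := h.smul_not_mem_interior hg hw4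
  rw [smul_inv_smul] at this
  exact this (hw3 hw2)

lemma eq_or_isSidePairing (h : IsFundamentalQuad x₁ x₂ x₃) {g : GL (Fin 2) ℝ} (hg : g ∈ torusGL) {i j : Fin 4} {z : ℍ}
    (h1 : quadForm x₁ x₂ x₃ i z = 0) (h2 : quadForm x₁ x₂ x₃ j (g⁻¹ • z) = 0) :
    (g = 1 ∨ g = -1) ∨ IsSidePairing x₁ x₂ x₃ g i j := by
  rw [← h.mem_side_iff] at h1 h2
  rw [← smul_mem_idealGeodesic_iff g, smul_inv_smul] at h2
  rcases eq_of_idealGeodesic_eq (h.vertex_ne i) (h.smul_vertex_ne g j)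
    (h.side_eq hg h1 h2) with ⟨e1, e2⟩ | ⟨e1, e2⟩
  · exact Or.inl (h.eq_one_or_neg_one_of_smul_side hg e1.symm e2.symm)
  · exact Or.inr ⟨hg, e2.symm, e1.symm⟩

lemma isSidePairing_irrefl (h : IsFundamentalQuad x₁ x₂ x₃) {g : GL (Fin 2) ℝ} {i : Fin 4} :
    ¬ IsSidePairing x₁ x₂ x₃ g i i := fun ⟨hg, h1, h2⟩ ↦
  not_swap_of_mem hg (h.vertex_ne i) h1 h2

lemma isSidePairing_unique (h : IsFundamentalQuad x₁ x₂ x₃) {g k : GL (Fin 2) ℝ} {i j l : Fin 4}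
    (hg : IsSidePairing x₁ x₂ x₃ g i j) (hk : IsSidePairing x₁ x₂ x₃ k i l) : j = l := by
  have h1 : (k⁻¹ * g) • quadVertex x₁ x₂ x₃ j = quadVertex x₁ x₂ x₃ l := by
    rw [mul_smul, hg.2.1, ← hk.2.1, inv_smul_smul]
  have h2 : (k⁻¹ * g) • quadVertex x₁ x₂ x₃ (j + 1) = quadVertex x₁ x₂ x₃ (l + 1) := by
    rw [mul_smul, hg.2.2, ← hk.2.2, inv_smul_smul]
  have := h.eq_one_or_neg_one_of_smul_side (mul_mem (inv_mem hk.1) hg.1) h1 h2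
  rw [smul_onePoint_of_eq_one_or_neg_one this] at h1
  exact quadVertex_injective h.lt₁₂ h.lt₂₃ h1

lemma exists_smul_mem (h : IsFundamentalQuad x₁ x₂ x₃) (z : ℍ) :
    ∃ g ∈ torusGL, g • z ∈ interior (idealQuadrilateral x₁ x₂ x₃ OnePoint.infty) ∨
      ∃ i, quadForm x₁ x₂ x₃ i (g • z) = 0 := by
  obtain ⟨w, hw, hwz⟩ := h.isFundamentalDomain.surjOn (Set.mem_univ (torusProj z))
  obtain ⟨g, hg, rfl⟩ := torusProj_eq_iff.1 hwz.symm
  refine ⟨g, hg, ?_⟩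
  rw [mem_interior_iff_quadForm h.lt₁₂ h.lt₂₃]
  rw [mem_idealQuadrilateral_iff_quadForm h.lt₁₂ h.lt₂₃] at hw
  by_contra! hc
  obtain ⟨⟨i, hi⟩, hc⟩ := hc
  exact hc i (le_antisymm (hw i) hi)

lemma exists_isSidePairing_of_vertical (h : IsFundamentalQuad x₁ x₂ x₃) {i : Fin 4} {y e : ℝ} (he : e ≠ 0)
    (hy : idealGeodesic (quadVertex x₁ x₂ x₃ i) (quadVertex x₁ x₂ x₃ (i + 1)) =
      idealGeodesic y OnePoint.infty)
    (hside : ∀ w ∈ interior (idealQuadrilateral x₁ x₂ x₃ OnePoint.infty),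
      ¬ 0 < e * (w.re - y)) :
    ∃ g j, IsSidePairing x₁ x₂ x₃ g i j := by
  set z := hpt y 1 one_pos with hz
  have hzy : z.re = y := rfl
  have hzi : quadForm x₁ x₂ x₃ i z = 0 := by
    rw [← h.mem_side_iff, hy, mem_idealGeodesic_coe_infty]; rfl
  have hiso := eventually_re_eq_of_mem (a := quadVertex x₁ x₂ x₃)
    (b := fun i ↦ quadVertex x₁ x₂ x₃ (i + 1)) h.vertex_ne
    (fun i j g hg w h1 h2 ↦ h.side_eq hg h1 h2) (one_mem torusGL) (i := i) (y := y)
    (by simpa using hy) hzy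
  set O : torusGL → Set ℍ := fun g ↦ {w | (g : GL (Fin 2) ℝ)⁻¹ • w ∈
    interior (idealQuadrilateral x₁ x₂ x₃ OnePoint.infty)} with hO
  obtain ⟨⟨g, hg⟩, hgO⟩ := exists_eventually_mem_of_side (O := O) (z := z)
    (isOpen_translate isOpen_interior)
    (fun g k ↦ translate_eq_of_inter_nonempty h.isFundamentalDomain.injOn) he (by
      filter_upwards [hiso] with w hw hlt
      obtain ⟨k, hk, hk' | ⟨j, hj⟩⟩ := h.exists_smul_mem w
      · exact ⟨⟨k⁻¹, inv_mem hk⟩, by simpa [hO] using hk'⟩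
      · exfalso
        have := hw j k⁻¹ (inv_mem hk) (by
          rw [← smul_mem_idealGeodesic_iff k, smul_inv_smul, smul_inv_smul, h.mem_side_iff]
          exact hj)
        rw [hzy, this, sub_self, mul_zero] at hlt
        exact lt_irrefl _ hlt)
  have hmem : z ∈ {w | g⁻¹ • w ∈ idealQuadrilateral x₁ x₂ x₃ OnePoint.infty} := by
    refine mem_of_eventually_side (h.isFundamentalDomain.isClosed.preimage
      (continuous_const_smul _)) he ?_
    filter_upwards [hgO] with w hw hlt
    have : g⁻¹ • w ∈ interior (idealQuadrilateral x₁ x₂ x₃ OnePoint.infty) := hw hlt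
    exact Set.mem_preimage.2 (interior_subset this)
  obtain ⟨j, hj⟩ : ∃ j, quadForm x₁ x₂ x₃ j (g⁻¹ • z) = 0 := by
    by_contra! hc
    refine h.smul_not_mem_interior (inv_mem hg) hzi
      ((mem_interior_iff_quadForm h.lt₁₂ h.lt₂₃).2 fun j ↦ ?_)
    exact lt_of_le_of_ne ((mem_idealQuadrilateral_iff_quadForm h.lt₁₂ h.lt₂₃).1 hmem j) (hc j)
  rcases h.eq_or_isSidePairing hg hzi hj with hpm | hpair
  · exfalso
    have hempty : z ∈ (∅ : Set ℍ) := by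
      refine mem_of_eventually_side isClosed_empty he ?_
      filter_upwards [hgO] with w hw hlt
      have := hw hlt
      simp only [hO, Set.mem_ofPred_eq] at this
      rw [smul_of_eq_one_or_neg_one (by rcases hpm with rfl | rfl <;> simp)] at this
      exact absurd hlt (hside w this)
    exact hempty
  · exact ⟨g, j, hpair⟩

lemma exists_isSidePairing_zero (h : IsFundamentalQuad x₁ x₂ x₃) : ∃ g j, IsSidePairing x₁ x₂ x₃ g 0 j := by
  refine h.exists_isSidePairing_of_vertical (y := x₁) (e := -1) (by norm_num) ?_ ?_
  · exact idealGeodesic_comm _ _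
  · intro w hw hlt
    have := ((mem_interior_idealQuadrilateral h.lt₁₂ h.lt₂₃).1 hw).1
    linarith

lemma exists_isSidePairing_three (h : IsFundamentalQuad x₁ x₂ x₃) : ∃ g j, IsSidePairing x₁ x₂ x₃ g 3 j := by
  refine h.exists_isSidePairing_of_vertical (y := x₃) (e := 1) (by norm_num) rfl ?_
  intro w hw hlt
  have := ((mem_interior_idealQuadrilateral h.lt₁₂ h.lt₂₃).1 hw).2.1
  linarith

end IsFundamentalQuad

/-! ### Stabilizers of vertices -/

lemma eq_of_omega_hpt_eq_zero {c d : OnePoint ℝ} (hcd : c ≠ d) {r s t : ℝ}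
    (hr : omega c d (hpt r 1 one_pos) = 0) (hs : omega c d (hpt s 1 one_pos) = 0)
    (ht : omega c d (hpt t 1 one_pos) = 0) : r = s ∨ s = t ∨ r = t := by
  induction c using OnePoint.rec with
  | infty =>
    induction d using OnePoint.rec with
    | infty => exact absurd rfl hcd
    | coe b =>
      rw [omega_infty_coe, hpt_re] at *
      left; linarith
  | coe a =>
    induction d using OnePoint.rec with
    | infty =>
      rw [omega_coe_infty, hpt_re] at *
      left; linarith
    | coe b =>
      have hab : a - b ≠ 0 := sub_ne_zero.2 fun h ↦ hcd (by rw [h])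
      rw [omega_coe_coe, mul_eq_zero, or_iff_right hab, hpt_re, hpt_im] at *
      by_contra! hne
      obtain ⟨h1, h2, h3⟩ := hne
      have e1 : r + s = a + b := by
        refine mul_left_cancel₀ (sub_ne_zero.2 h1) ?_; linear_combination hr - hs
      have e2 : s + t = a + b := by
        refine mul_left_cancel₀ (sub_ne_zero.2 h2) ?_; linear_combination hs - ht
      exact h3 (by linarith)

namespace IsFundamentalQuad

variable {x₁ x₂ x₃ : ℝ}

/-- A point on a translate of a side. -/
def OnSide (x₁ x₂ x₃ : ℝ) (z : ℍ) : Prop :=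
  ∃ g ∈ torusGL, ∃ i, quadForm x₁ x₂ x₃ i (g • z) = 0

lemma OnSide.smul {z : ℍ} (hz : OnSide x₁ x₂ x₃ z) {g : GL (Fin 2) ℝ} (hg : g ∈ torusGL) :
    OnSide x₁ x₂ x₃ (g • z) := by
  obtain ⟨k, hk, i, hi⟩ := hz
  exact ⟨k * g⁻¹, mul_mem hk (inv_mem hg), i, by rwa [mul_smul, inv_smul_smul]⟩

lemma not_onSide_of_mem_interior (h : IsFundamentalQuad x₁ x₂ x₃) {g : GL (Fin 2) ℝ} (hg : g ∈ torusGL) {z : ℍ}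
    (hz : g • z ∈ interior (idealQuadrilateral x₁ x₂ x₃ OnePoint.infty)) :
    ¬ OnSide x₁ x₂ x₃ z := by
  rintro ⟨k, hk, i, hi⟩
  have := h.smul_not_mem_interior (mul_mem hg (inv_mem hk)) hi
  rw [mul_smul, inv_smul_smul] at this
  exact this hz

lemma eventually_quadForm_eq_zero (h : IsFundamentalQuad x₁ x₂ x₃) {i j : Fin 4} {k : GL (Fin 2) ℝ}
    (hk : IsSidePairing x₁ x₂ x₃ k i j) {z : ℍ} (hz : quadForm x₁ x₂ x₃ i z = 0) :
    ∀ᶠ w in nhds z, OnSide x₁ x₂ x₃ w → quadForm x₁ x₂ x₃ i w = 0 := by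
  have hform : ∀ w, omega (quadVertex x₁ x₂ x₃ (i + 1)) (quadVertex x₁ x₂ x₃ i) w < 0 ↔
      quadForm x₁ x₂ x₃ j (k⁻¹ • w) < 0 := by
    intro w
    rw [← hk.2.1, ← hk.2.2]
    exact (omega_inv_smul_neg_iff (det_pos_of_mem hk.1)).symm
  have hz' : quadForm x₁ x₂ x₃ j (k⁻¹ • z) = 0 := by
    rw [← h.mem_side_iff] at hz ⊢
    rw [← smul_mem_idealGeodesic_iff k, smul_inv_smul, hk.2.1, hk.2.2, idealGeodesic_comm]
    exact hz
  filter_upwards [h.eventually_mem_interior hz,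
    (tendsto_smul k⁻¹ z).eventually (h.eventually_mem_interior hz')] with w h1 h2 hw
  by_contra hne
  rcases lt_or_gt_of_ne hne with hlt | hgt
  · exact h.not_onSide_of_mem_interior (one_mem _) (by rw [one_smul]; exact h1 hlt) hw
  · refine h.not_onSide_of_mem_interior (inv_mem hk.1) (h2 ((hform w).1 ?_)) hw
    rw [omega_swap]; exact neg_neg_of_pos hgt

/-- If all sides are paired, then their translates are locally finite. -/
lemma exists_eventually_mem_idealGeodesic (h : IsFundamentalQuad x₁ x₂ x₃) (hpair : ∀ i, ∃ k j, IsSidePairing x₁ x₂ x₃ k i j)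
    (z : ℍ) : ∃ c d : OnePoint ℝ, c ≠ d ∧
      ∀ᶠ w in nhds z, OnSide x₁ x₂ x₃ w → w ∈ idealGeodesic c d := by
  obtain ⟨g, hg, hgz | ⟨i, hi⟩⟩ := h.exists_smul_mem z
  · refine ⟨_, _, h.vertex_ne 0, ?_⟩
    filter_upwards [(tendsto_smul g z).eventually (isOpen_interior.mem_nhds hgz)] with w hw hw'
    exact absurd hw' (h.not_onSide_of_mem_interior hg hw)
  · obtain ⟨k, j, hk⟩ := hpair i
    refine ⟨_, _, h.smul_vertex_ne g⁻¹ i, ?_⟩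
    filter_upwards [(tendsto_smul g z).eventually (h.eventually_quadForm_eq_zero hk hi)] with w hw hw'
    rw [← smul_mem_idealGeodesic_iff g, smul_inv_smul, smul_inv_smul, h.mem_side_iff]
    exact hw (hw'.smul hg)

lemma not_contraction (h : IsFundamentalQuad x₁ x₂ x₃) (hpair : ∀ i, ∃ k j, IsSidePairing x₁ x₂ x₃ k i j) {i : Fin 4}
    {f g : GL (Fin 2) ℝ} (hg : g ∈ torusGL) (hf : 0 < f.det.val)
    (hfi : f • quadVertex x₁ x₂ x₃ i = OnePoint.infty) {r t : ℝ} (hr0 : 0 < r) (hr1 : r < 1)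
    (hact : ∀ z : ℍ, (f • g • z).re = r * (f • z).re + t) : False := by
  set LineIn : ℝ → Prop := fun s ↦ ∀ w : ℍ, w.re = s → OnSide x₁ x₂ x₃ (f⁻¹ • w) with hLine
  have step : ∀ s, LineIn s → LineIn (r * s + t) := by
    intro s hs w hw
    have e : f⁻¹ • w = g • f⁻¹ • (f • g⁻¹ • f⁻¹ • w) := by
      rw [inv_smul_smul, smul_inv_smul]
    rw [e]
    refine OnSide.smul (hs _ ?_) hg
    have := hact (g⁻¹ • f⁻¹ • w)
    rw [smul_inv_smul, smul_inv_smul, hw] at this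
    exact mul_left_cancel₀ hr0.ne' (by linarith)
  have line : ∀ l, l = i ∨ l + 1 = i → ∃ s : ℝ, LineIn s ∧
      (f • quadVertex x₁ x₂ x₃ l = s ∨ f • quadVertex x₁ x₂ x₃ (l + 1) = s) := by
    intro l hl
    have hmem : ∀ w, f⁻¹ • w ∈ idealGeodesic (quadVertex x₁ x₂ x₃ l) (quadVertex x₁ x₂ x₃ (l + 1)) →
        OnSide x₁ x₂ x₃ (f⁻¹ • w) := fun w hw ↦
      ⟨1, one_mem _, l, by rw [one_smul]; exact h.mem_side_iff.1 hw⟩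
    have hne := h.smul_vertex_ne f l
    rcases hl with rfl | rfl
    · rw [hfi] at hne
      obtain ⟨s, hs⟩ := OnePoint.ne_infty_iff_exists.1 hne.symm
      refine ⟨s, fun w hw ↦ hmem w ?_, Or.inr hs.symm⟩
      rw [← smul_mem_idealGeodesic_iff f, smul_inv_smul, hfi, ← hs, idealGeodesic_comm,
        mem_idealGeodesic_coe_infty]
      exact hw
    · rw [hfi] at hne
      obtain ⟨s, hs⟩ := OnePoint.ne_infty_iff_exists.1 hne
      refine ⟨s, fun w hw ↦ hmem w ?_, Or.inl hs.symm⟩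
      rw [← smul_mem_idealGeodesic_iff f, smul_inv_smul, hfi, ← hs, mem_idealGeodesic_coe_infty]
      exact hw
  set x := t / (1 - r) with hx
  have hxr : r * x + t = x := by
    rw [hx]; field_simp [show (1 - r) ≠ 0 by linarith]; ring
  obtain ⟨s, hs, hsx⟩ : ∃ s, LineIn s ∧ s ≠ x := by
    obtain ⟨s₀, hs₀, e₀⟩ := line i (Or.inl rfl)
    obtain ⟨s₁, hs₁, e₁⟩ := line (i - 1) (Or.inr (sub_add_cancel i 1))
    rw [sub_add_cancel, hfi] at e₁
    rw [hfi] at e₀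
    have e₀' := e₀.resolve_left (OnePoint.infty_ne_coe _)
    have e₁' := e₁.resolve_right (OnePoint.infty_ne_coe _)
    have hne : s₀ ≠ s₁ := by
      intro he
      rw [he, ← e₁'] at e₀'
      have := quadVertex_injective h.lt₁₂ h.lt₂₃ (smul_left_cancel f e₀')
      clear * - this
      revert i; decide
    by_cases hs : s₀ = x
    · exact ⟨s₁, hs₁, fun h1 ↦ hne (hs.trans h1.symm)⟩
    · exact ⟨s₀, hs₀, hs⟩
  have hlines : ∀ n : ℕ, LineIn (x + r ^ n * (s - x)) := by
    intro n
    induction n with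
    | zero => simpa using hs
    | succ n ih =>
      have := step _ ih
      have e : r * (x + r ^ n * (s - x)) + t = x + r ^ (n + 1) * (s - x) := by
        rw [pow_succ]; linear_combination hxr
      rwa [e] at this
  obtain ⟨c, d, hcd, hev⟩ := h.exists_eventually_mem_idealGeodesic hpair
    (f⁻¹ • hpt x 1 one_pos)
  have hev' := (tendsto_smul f⁻¹ (hpt x 1 one_pos)).eventually hev
  obtain ⟨ε, hε, hball⟩ := eventually_nhds_iff_re_im.1 hev'
  have hlim : Filter.Tendsto (fun n : ℕ ↦ |r ^ n * (s - x)|) Filter.atTop (nhds 0) := by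
    have := ((tendsto_pow_atTop_nhds_zero_of_lt_one hr0.le hr1).mul_const (s - x)).abs
    simpa using this
  obtain ⟨N, hN⟩ := Filter.eventually_atTop.1 (hlim.eventually_lt_const hε)
  have hzero : ∀ n ≥ N, omega (f • c) (f • d) (hpt (x + r ^ n * (s - x)) 1 one_pos) = 0 := by
    intro n hn
    have := hball (hpt (x + r ^ n * (s - x)) 1 one_pos) (by simpa using hN n hn)
      (by simpa using hε) (hlines n _ rfl)
    rw [mem_idealGeodesic_iff hcd, ← omega_smul_eq_zero_iff hf, smul_inv_smul] at this
    exact this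
  have hinj : ∀ m n : ℕ, x + r ^ m * (s - x) = x + r ^ n * (s - x) → m = n := by
    intro m n hmn
    have := mul_right_cancel₀ (sub_ne_zero.2 hsx) (add_left_cancel hmn)
    exact pow_right_injective₀ hr0 hr1.ne this
  rcases eq_of_omega_hpt_eq_zero (fun he ↦ hcd (smul_left_cancel f he)) (hzero N le_rfl)
    (hzero (N + 1) (by omega)) (hzero (N + 2) (by omega)) with he | he | he
  · have := hinj _ _ he; omega
  · have := hinj _ _ he; omega
  · have := hinj _ _ he; omega

/-- No hyperbolic element of the group fixes a vertex. -/
lemma trace_sq_eq_four (h : IsFundamentalQuad x₁ x₂ x₃) (hpair : ∀ i, ∃ k j, IsSidePairing x₁ x₂ x₃ k i j) {i : Fin 4}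
    {g : GL (Fin 2) ℝ} (hg : g ∈ torusGL)
    (hgi : g • quadVertex x₁ x₂ x₃ i = quadVertex x₁ x₂ x₃ i) :
    (g 0 0 + g 1 1) ^ 2 = 4 := by
  obtain ⟨f, hf, hfi, -⟩ := exists_smul_eq_infty_zero (h.vertex_ne i)
  have main : ∀ k ∈ torusGL, k • quadVertex x₁ x₂ x₃ i = quadVertex x₁ x₂ x₃ i →
      ∃ r t : ℝ, 0 < r ∧ (r = 1 → (k 0 0 + k 1 1) ^ 2 = 4) ∧
        ∀ z : ℍ, (f • k • z).re = r * (f • z).re + t := by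
    intro k hk hki
    set m := f * k * f⁻¹ with hm
    have hm0 : m 1 0 = 0 := by
      rw [← OnePoint.smul_infty_eq_self_iff, hm, mul_smul, mul_smul, ← hfi, inv_smul_smul, hki]
    have hmdet : m.det.val = 1 := by
      have e1 : m.det = k.det := by rw [hm, map_mul, map_mul, map_inv, mul_right_comm,
        mul_inv_cancel, one_mul]
      rw [e1, det_of_mem hk]
    have hmtr : m 0 0 + m 1 1 = k 0 0 + k 1 1 := by
      have e1 : Matrix.trace (m : Matrix (Fin 2) (Fin 2) ℝ) =
          Matrix.trace (k : Matrix (Fin 2) (Fin 2) ℝ) := by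
        rw [hm, Units.val_mul, Matrix.trace_mul_comm, ← Units.val_mul, ← mul_assoc,
          inv_mul_cancel, one_mul]
      simpa [Matrix.trace_fin_two] using e1
    rw [det_val_eq, hm0, mul_zero, sub_zero] at hmdet
    have h11 : m 1 1 ≠ 0 := fun h0 ↦ by simp [h0] at hmdet
    refine ⟨m 0 0 / m 1 1, m 0 1 / m 1 1, ?_, ?_, ?_⟩
    · have : m 0 0 / m 1 1 = (m 0 0) ^ 2 := by
        rw [div_eq_iff h11]; linear_combination -(m 0 0) * hmdet
      rw [this]
      have : m 0 0 ≠ 0 := fun h0 ↦ by simp [h0] at hmdet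
      positivity
    · intro hone
      rw [div_eq_one_iff_eq h11] at hone
      rw [← hmtr, hone]
      rw [hone] at hmdet
      linear_combination 4 * hmdet
    · intro z
      have e : f • k • z = m • f • z := by
        rw [hm, mul_smul, mul_smul, inv_smul_smul]
      rw [e, re_smul_eq, hm0]
      field_simp
      ring
  obtain ⟨r, t, hr, hr1, hact⟩ := main g hg hgi
  rcases lt_trichotomy r 1 with hlt | heq | hgt
  · exact (h.not_contraction hpair hg hf hfi hr hlt hact).elim
  · exact hr1 heq
  · refine (h.not_contraction hpair (inv_mem hg) hf hfi (inv_pos.2 hr) (inv_lt_one_of_one_lt₀ hgt)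
      (t := -t / r) fun z ↦ ?_).elim
    have := hact (g⁻¹ • z)
    rw [smul_inv_smul] at this
    rw [this]
    field_simp
    ring

end IsFundamentalQuad

/-! ### Two parabolic elements whose quotient is parabolic -/

lemma TorusCongruence.dvd_of_trace_sq {γ : SL(2, ℤ)} (h : TorusCongruence γ)
    (ht : (γ 0 0 + γ 1 1) ^ 2 = 4) : ∃ ε p q r : ℤ, ε ^ 2 = 1 ∧ γ 0 0 = ε + 6 * p ∧
      γ 0 1 = 6 * q ∧ γ 1 0 = 6 * r ∧ γ 1 1 = ε - 6 * p := by
  obtain ⟨ε, hε, htr⟩ : ∃ ε : ℤ, (ε = 1 ∨ ε = -1) ∧ γ 0 0 + γ 1 1 = 2 * ε := by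
    have : (γ 0 0 + γ 1 1 - 2) * (γ 0 0 + γ 1 1 + 2) = 0 := by linear_combination ht
    rcases mul_eq_zero.1 this with h1 | h1
    · exact ⟨1, by norm_num, by linarith⟩
    · exact ⟨-1, by norm_num, by linarith⟩
  have hε2 : ε ^ 2 = 1 := by rcases hε with rfl | rfl <;> norm_num
  obtain ⟨h2, h3⟩ := torusCongruence_iff_dvd.1 h
  obtain ⟨hb2, hc2⟩ := h2.resolve_left (by rw [htr]; simp)
  obtain ⟨hb3, hc3⟩ := h3.resolve_left (by rcases hε with rfl | rfl <;> omega)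
  obtain ⟨q, hq⟩ : 6 ∣ γ 0 1 := by omega
  obtain ⟨r, hr⟩ : 6 ∣ γ 1 0 := by omega
  have hsq : (6 : ℤ) ^ 2 ∣ (γ 0 0 - ε) ^ 2 := by
    refine ⟨-(q * r), ?_⟩
    have hdet := det_eq_one_int γ
    rw [hq, hr, show γ 1 1 = 2 * ε - γ 0 0 by linarith] at hdet
    linear_combination -hdet + hε2
  obtain ⟨p, hp⟩ := (Int.pow_dvd_pow_iff two_ne_zero).1 hsq
  exact ⟨ε, p, q, r, hε2, by linarith, hq, hr, by linarith⟩

lemma exists_nilpotent_form {p q r : ℝ} {a : OnePoint ℝ} (h1 : p * ipX a + q * ipY a = 0)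
    (h2 : r * ipX a - p * ipY a = 0) :
    ∃ n, p = n * (ipX a * ipY a) ∧ q = -n * ipX a ^ 2 ∧ r = n * ipY a ^ 2 := by
  induction a using OnePoint.rec with
  | infty =>
    simp only [ipX_infty, ipY_infty, mul_one, mul_zero, add_zero, sub_zero] at h1 h2 ⊢
    exact ⟨-q, h1, by ring, by rw [h2]; ring⟩
  | coe t =>
    simp only [ipX_coe, ipY_coe, mul_one] at h1 h2 ⊢
    exact ⟨r, by linarith, by linear_combination h1 + t * h2, by ring⟩

lemma exists_nilpotent_form_of_smul_eq {γ : SL(2, ℤ)} {ε p q r : ℤ} (hε : ε ^ 2 = 1)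
    (h00 : γ 0 0 = ε + 6 * p) (h01 : γ 0 1 = 6 * q) (h10 : γ 1 0 = 6 * r)
    (h11 : γ 1 1 = ε - 6 * p) {a : OnePoint ℝ} (ha : mapGL ℝ γ • a = a) :
    ∃ n : ℝ, p = n * (ipX a * ipY a) ∧ q = -n * ipX a ^ 2 ∧ r = n * ipY a ^ 2 := by
  obtain ⟨c, hc, hx, hy⟩ := ip_smul (mapGL ℝ γ) a
  rw [ha] at hx hy
  simp only [mapGL_apply_real, h00, h01, h10, h11] at hx hy
  push_cast at hx hy
  have hdet := det_eq_one_int γ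
  rw [h00, h01, h10, h11] at hdet
  have hdet' : ((ε + 6 * p) * (ε - 6 * p) - 6 * q * (6 * r) : ℝ) = 1 := by exact_mod_cast hdet
  have hε' : (ε : ℝ) ^ 2 = 1 := by exact_mod_cast hε
  have k1 : (c - ε) ^ 2 * ipX a = 0 := by
    linear_combination (c - (ε - 6 * p)) * hx + 6 * q * hy + ipX a * (hε' - hdet')
  have k2 : (c - ε) ^ 2 * ipY a = 0 := by
    linear_combination (c - (ε + 6 * p)) * hy + 6 * r * hx + ipY a * (hε' - hdet')
  have hcε : c = ε := by
    have : (c - ε) ^ 2 = 0 := by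
      induction a using OnePoint.rec with
      | infty => simpa using k1
      | coe t => simpa using k2
    have := pow_eq_zero_iff two_ne_zero |>.1 this
    linarith
  rw [hcε] at hx hy
  exact exists_nilpotent_form (by linarith) (by linarith)

lemma false_of_trace_sq_eq_four {γ η : SL(2, ℤ)} (hγ : TorusCongruence γ)
    (hη : TorusCongruence η) {a b c d : OnePoint ℝ} (hab : a ≠ b) (hcd : c ≠ d)
    (ha : mapGL ℝ γ • a = a) (hb : mapGL ℝ η • b = b) (hγc : mapGL ℝ γ • c = d)
    (hηc : mapGL ℝ η • c = d) (tγ : (γ 0 0 + γ 1 1) ^ 2 = 4) (tη : (η 0 0 + η 1 1) ^ 2 = 4)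
    (t : ((γ⁻¹ * η) 0 0 + (γ⁻¹ * η) 1 1) ^ 2 = 4) : False := by
  obtain ⟨ε, p, q, r, hε, h00, h01, h10, h11⟩ := hγ.dvd_of_trace_sq tγ
  obtain ⟨ε', p', q', r', hε', h00', h01', h10', h11'⟩ := hη.dvd_of_trace_sq tη
  have htr : (γ⁻¹ * η) 0 0 + (γ⁻¹ * η) 1 1 =
      2 * (ε * ε') - 36 * (2 * p * p' + q * r' + r * q') := by
    have e : ∀ i j, (γ⁻¹ : SL(2, ℤ)) i j = (!![γ 1 1, -γ 0 1; -γ 1 0, γ 0 0] : Matrix _ _ ℤ) i j := by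
      intro i j; rw [SL2_inv_expl]; rfl
    rw [sl2_mul_apply, sl2_mul_apply, e, e, e, e, h00', h01', h10', h11']
    simp [h00, h01, h10, h11]
    ring
  rw [htr] at t
  have hK : 2 * p * p' + q * r' + r * q' = 0 := by
    generalize 2 * p * p' + q * r' + r * q' = K at t
    have h1 : ε * ε' = 1 ∨ ε * ε' = -1 := by
      have : (ε * ε' - 1) * (ε * ε' + 1) = 0 := by
        linear_combination ε' ^ 2 * hε + hε'
      rcases mul_eq_zero.1 this with h | h
      · left; linarith
      · right; linarith
    have h2 : K * (9 * K - ε * ε') = 0 := by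
      have hs : (ε * ε') ^ 2 = 1 := by rcases h1 with h | h <;> rw [h] <;> norm_num
      linarith
    rcases mul_eq_zero.1 h2 with h | h
    · exact h
    · omega
  obtain ⟨n, hp, hq, hr⟩ := exists_nilpotent_form_of_smul_eq hε h00 h01 h10 h11 ha
  obtain ⟨m, hp', hq', hr'⟩ := exists_nilpotent_form_of_smul_eq hε' h00' h01' h10' h11' hb
  have hK' : (2 * p * p' + q * r' + r * q' : ℝ) = 0 := by exact_mod_cast hK
  have hnm : n * m * wedge a b ^ 2 = 0 := by
    rw [hp, hq, hr, hp', hq', hr'] at hK'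
    unfold wedge
    linear_combination -hK'
  have triv : ∀ {γ : SL(2, ℤ)} {ε p q r : ℤ} {n : ℝ} {a : OnePoint ℝ}, γ 0 0 = ε + 6 * p →
      γ 0 1 = 6 * q → γ 1 0 = 6 * r → γ 1 1 = ε - 6 * p → p = n * (ipX a * ipY a) →
      q = -n * ipX a ^ 2 → r = n * ipY a ^ 2 → n = 0 → mapGL ℝ γ • c = c := by
    intro γ ε p q r n a h00 h01 h10 h11 hp hq hr hn
    have hp0 : p = 0 := by
      have : (p : ℝ) = 0 := by rw [hp, hn]; ring
      exact_mod_cast this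
    have hq0 : q = 0 := by
      have : (q : ℝ) = 0 := by rw [hq, hn]; ring
      exact_mod_cast this
    have hr0 : r = 0 := by
      have : (r : ℝ) = 0 := by rw [hr, hn]; ring
      exact_mod_cast this
    exact smul_onePoint_of_eq_one_or_neg_one
      (eq_one_or_neg_one_of_entries (by rw [h01, hq0, mul_zero]) (by rw [h10, hr0, mul_zero])
        (by rw [h00, h11, hp0]; ring)) c
  have hw : wedge a b ^ 2 ≠ 0 := pow_ne_zero 2 fun h ↦ hab (wedge_eq_zero_iff.1 h)
  rcases mul_eq_zero.1 ((mul_eq_zero.1 hnm).resolve_right hw) with h | h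
  · exact hcd ((triv h00 h01 h10 h11 hp hq hr h).symm.trans hγc)
  · exact hcd ((triv h00' h01' h10' h11' hp' hq' hr' h).symm.trans hηc)

lemma trace_sq_of_real {γ : SL(2, ℤ)}
    (h : ((mapGL ℝ γ) 0 0 + (mapGL ℝ γ) 1 1) ^ 2 = (4 : ℝ)) : (γ 0 0 + γ 1 1) ^ 2 = 4 := by
  simp only [mapGL_apply_real] at h
  exact_mod_cast h

lemma torusShift_add_smul (a b : ℤ) (z : ℍ) :
    torusShift (a + b) • z = torusShift a • torusShift b • z := by
  rw [← mul_smul, torusShift, torusShift, torusShift, ← map_mul, ← _root_.zpow_add, mul_add]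

lemma torusShift_zero_smul (z : ℍ) : torusShift 0 • z = z := by
  simp [torusShift]

namespace IsFundamentalQuad

variable {x₁ x₂ x₃ : ℝ}

/-- The sides cannot be paired in such a way that pairings fix two vertices. -/
lemma false_of_adjacent (h : IsFundamentalQuad x₁ x₂ x₃) (hpair : ∀ i, ∃ k j, IsSidePairing x₁ x₂ x₃ k i j)
    {g k : GL (Fin 2) ℝ} (hg : g ∈ torusGL) (hk : k ∈ torusGL) {a b c d : Fin 4} (hab : a ≠ b)
    (hcd : c ≠ d) (hga : g • quadVertex x₁ x₂ x₃ a = quadVertex x₁ x₂ x₃ a)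
    (hkb : k • quadVertex x₁ x₂ x₃ b = quadVertex x₁ x₂ x₃ b)
    (hgc : g • quadVertex x₁ x₂ x₃ c = quadVertex x₁ x₂ x₃ d)
    (hkc : k • quadVertex x₁ x₂ x₃ c = quadVertex x₁ x₂ x₃ d) : False := by
  have hinj := quadVertex_injective h.lt₁₂ h.lt₂₃
  have t1 := h.trace_sq_eq_four hpair hg hga
  have t2 := h.trace_sq_eq_four hpair hk hkb
  have t3 := h.trace_sq_eq_four hpair (mul_mem (inv_mem hg) hk) (i := c) (by
    rw [mul_smul, hkc, ← hgc, inv_smul_smul])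
  obtain ⟨γ, hγ, rfl⟩ := hg
  obtain ⟨η, hη, rfl⟩ := hk
  rw [← map_inv, ← map_mul] at t3
  exact false_of_trace_sq_eq_four hγ hη (hinj.ne hab) (hinj.ne hcd) hga hkb hgc hkc
    (trace_sq_of_real t1) (trace_sq_of_real t2) (trace_sq_of_real t3)

/-! ### Two sides paired by a translation -/

/-- The sides that end at `∞` cannot be paired without pairing the other two. -/
lemma exists_isSidePairing_one (h : IsFundamentalQuad x₁ x₂ x₃) {g : GL (Fin 2) ℝ} (hg : IsSidePairing x₁ x₂ x₃ g 0 3) :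
    ∃ k i j, IsSidePairing x₁ x₂ x₃ k i j ∧ (i = 1 ∨ i = 2) := by
  by_contra! hno
  have hno' : ∀ {k i j}, IsSidePairing x₁ x₂ x₃ k i j → (i = 0 ∨ i = 3) ∧ (j = 0 ∨ j = 3) := by
    intro k i j hk
    have h1 := hno _ _ _ hk
    have h2 := hno _ _ _ hk.inv
    clear * - h1 h2
    revert i j; decide
  obtain ⟨k, hk⟩ := torusShift_smul_of_smul_infty hg.1 hg.2.2
  have hx : x₁ = x₃ + 6 * k := by
    have h1 : g • (x₃ : OnePoint ℝ) = x₁ := hg.2.1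
    rw [hk, torusShift_smul_coe] at h1
    exact (OnePoint.coe_injective h1).symm
  have h₁₂ := h.lt₁₂
  have h₂₃ := h.lt₂₃
  have hk0 : k < 0 := by
    have : (k : ℝ) < 0 := by linarith
    exact_mod_cast this
  set D := idealQuadrilateral x₁ x₂ x₃ OnePoint.infty with hD
  have hDmem : ∀ {z}, z ∈ D ↔ ∀ i, quadForm x₁ x₂ x₃ i z ≤ 0 :=
    mem_idealQuadrilateral_iff_quadForm h₁₂ h₂₃
  have hDint : ∀ {z}, z ∈ D → z ∉ interior D → ∃ i, quadForm x₁ x₂ x₃ i z = 0 := by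
    intro z hz hzi
    by_contra! hc
    exact hzi ((mem_interior_iff_quadForm h₁₂ h₂₃).2 fun i ↦ lt_of_le_of_ne (hDmem.1 hz i) (hc i))
  -- a motion that does not separate the domain from its image is a translation
  have shiftlike : ∀ f ∈ torusGL, ∀ w ∈ D, f • w ∈ D →
      ∃ m : ℤ, ∀ z : ℍ, f • z = torusShift (m * k) • z := by
    intro f hf w hw hfw
    have triv : f = 1 ∨ f = -1 → ∃ m : ℤ, ∀ z : ℍ, f • z = torusShift (m * k) • z := fun hpm ↦
      ⟨0, fun z ↦ by rw [smul_of_eq_one_or_neg_one hpm, zero_mul, torusShift_zero_smul]⟩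
    have ofInfty : ∀ m : ℤ, f • (OnePoint.infty : OnePoint ℝ) = OnePoint.infty →
        (∃ t : ℝ, f • (t : OnePoint ℝ) = ((t + 6 * (m * k : ℤ) : ℝ) : OnePoint ℝ)) →
        ∃ m : ℤ, ∀ z : ℍ, f • z = torusShift (m * k) • z := by
      rintro m h1 ⟨t, ht⟩
      obtain ⟨l, hl⟩ := eq_torusShift_of_smul_infty hf h1
      have e1 : ∀ a : OnePoint ℝ, f • a = torusShift l • a := by
        rcases hl with rfl | rfl
        · exact fun _ ↦ rfl
        · exact fun a ↦ neg_smul_onePoint _ a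
      rw [e1, torusShift_smul_coe] at ht
      have e2 : l = m * k := by
        have := OnePoint.coe_injective ht
        have : (l : ℝ) = (m * k : ℤ) := by linarith
        exact_mod_cast this
      refine ⟨m, fun z ↦ ?_⟩
      rw [← e2]
      rcases hl with rfl | rfl
      · rfl
      · exact UpperHalfPlane.neg_smul _ _
    by_cases hwi : w ∈ interior D
    · by_cases hfwi : f • w ∈ interior D
      · exact triv (h.eq_one_or_neg_one hf hwi hfwi)
      · obtain ⟨j, hj⟩ := hDint hfw hfwi
        have := h.smul_not_mem_interior (inv_mem hf) hj
        rw [inv_smul_smul] at this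
        exact absurd hwi this
    · obtain ⟨i, hi⟩ := hDint hw hwi
      obtain ⟨j, hj⟩ := hDint hfw (h.smul_not_mem_interior hf hi)
      rcases h.eq_or_isSidePairing hf hj (by rwa [inv_smul_smul]) with hpm | hp
      · exact triv hpm
      · obtain ⟨hj', hi'⟩ := hno' hp
        rcases hj' with rfl | rfl <;> rcases hi' with rfl | rfl
        · exact (h.isSidePairing_irrefl hp).elim
        · refine ofInfty 1 hp.2.2 ⟨x₃, hp.2.1.trans ?_⟩
          rw [quadVertex, one_mul, ← hx]; rfl
        · refine ofInfty (-1) hp.2.1 ⟨x₁, hp.2.2.trans ?_⟩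
          push_cast
          rw [show x₁ + 6 * (-1 * (k : ℝ)) = x₃ by linarith]; rfl
        · exact (h.isSidePairing_irrefl hp).elim
  set U : Set ℍ := ⋃ m : ℤ, {z | torusShift (m * k) • z ∈ D} with hU
  have memU : ∀ {z}, z ∈ U ↔ ∃ m : ℤ, torusShift (m * k) • z ∈ D := Set.mem_iUnion
  have hre : ∀ {z : ℍ} {m : ℤ}, torusShift (m * k) • z ∈ D →
      x₁ ≤ z.re + 6 * (m * k) ∧ z.re + 6 * (m * k) ≤ x₃ := by
    intro z m hz
    obtain ⟨h1, h2, -⟩ := (mem_idealQuadrilateral h₁₂ h₂₃).1 hz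
    rw [torusShift_smul_re] at h1 h2
    push_cast at h1 h2
    exact ⟨h1, h2⟩
  have hUc : IsClosed U := by
    refine LocallyFinite.isClosed_iUnion ?_ fun m ↦
      h.isFundamentalDomain.isClosed.preimage (continuous_const_smul _)
    intro z
    refine ⟨{w | |w.re - z.re| < 1}, eventually_nhds_iff_re_im.2
      ⟨1, one_pos, fun w hw _ ↦ hw⟩, ?_⟩
    set C : ℤ := ⌈|x₁| + |x₃| + |z.re| + 1⌉ with hC
    refine (Set.finite_Icc (-C) C).subset ?_
    rintro m ⟨w, hw1, hw2⟩
    have hw2' : |w.re - z.re| < 1 := hw2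
    obtain ⟨h1, h2⟩ := hre hw1
    have hCle : |x₁| + |x₃| + |z.re| + 1 ≤ C := Int.le_ceil _
    have b1 : |6 * ((m : ℝ) * k)| ≤ C := by
      rw [abs_le]
      rw [abs_lt] at hw2'
      constructor
      · linarith [neg_abs_le x₁, abs_nonneg x₃, le_abs_self z.re]
      · linarith [le_abs_self x₃, abs_nonneg x₁, neg_abs_le z.re]
    have b2 : |6 * (m * k)| ≤ C := by exact_mod_cast b1
    have b3 : |m| ≤ C := by
      rw [abs_mul, abs_mul] at b2
      have : 1 ≤ |k| := Int.one_le_abs hk0.ne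
      have : |(6 : ℤ)| = 6 := rfl
      nlinarith [abs_nonneg m, mul_nonneg (abs_nonneg m) (show 0 ≤ |k| - 1 by linarith)]
    exact abs_le.1 b3
  have hUshift : ∀ (m : ℤ) {z : ℍ}, z ∈ U → torusShift (m * k) • z ∈ U := by
    intro m z hz
    obtain ⟨l, hl⟩ := memU.1 hz
    refine memU.2 ⟨l - m, ?_⟩
    rw [← torusShift_add_smul, ← add_mul, sub_add_cancel]
    exact hl
  set A : torusGL → Set ℍ := fun g ↦ {z | (g : GL (Fin 2) ℝ)⁻¹ • z ∈ U} with hA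
  have hAsub : ∀ g f : torusGL, (A g ∩ A f).Nonempty → A g ⊆ A f := by
    rintro ⟨g, hg⟩ ⟨f, hf⟩ ⟨z, hz1, hz2⟩ u hu
    obtain ⟨m, hm⟩ := memU.1 hz1
    obtain ⟨l, hl⟩ := memU.1 hz2
    simp only at hm hl
    obtain ⟨n, hn⟩ := shiftlike (torusShift (l * k) * f⁻¹ * g * torusShift (-(m * k)))
      (mul_mem (mul_mem (mul_mem (torusShift_mem _) (inv_mem hf)) hg) (torusShift_mem _))
      (torusShift (m * k) • g⁻¹ • z) hm (by
        rw [mul_smul, ← torusShift_add_smul, neg_add_cancel, torusShift_zero_smul, mul_smul,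
          smul_inv_smul, mul_smul]
        exact hl)
    have hn' := hn (torusShift (m * k) • g⁻¹ • u)
    rw [mul_smul, ← torusShift_add_smul, neg_add_cancel, torusShift_zero_smul, mul_smul,
      smul_inv_smul, mul_smul] at hn'
    have h1 := hUshift (-l) (hUshift n (hUshift m hu))
    simp only at h1
    rw [← hn', ← torusShift_add_smul, ← add_mul, neg_add_cancel, zero_mul,
      torusShift_zero_smul] at h1
    exact h1
  have := (Set.countable_range A).to_subtype
  obtain ⟨⟨_, g, rfl⟩, hg⟩ := exists_eq_univ_of_iUnion_isClosed
    (A := fun s : Set.range A ↦ (s : Set ℍ))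
    (by
      rintro ⟨_, g, rfl⟩
      exact hUc.preimage (continuous_const_smul _))
    (by
      rintro ⟨_, g, rfl⟩ ⟨_, f, rfl⟩ hne
      rw [Set.disjoint_iff_inter_eq_empty]
      by_contra hc
      have hc' := Set.nonempty_iff_ne_empty.2 hc
      exact hne (Subtype.ext ((hAsub g f hc').antisymm (hAsub f g (Set.inter_comm _ _ ▸ hc')))))
    (by
      rw [Set.eq_univ_iff_forall]
      intro z
      obtain ⟨w, hw, hwz⟩ := h.isFundamentalDomain.surjOn (Set.mem_univ (torusProj z))
      obtain ⟨f, hf, rfl⟩ := torusProj_eq_iff.1 hwz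
      refine Set.mem_iUnion.2 ⟨⟨_, ⟨f, hf⟩, rfl⟩, ?_⟩
      simp only [hA, Set.mem_ofPred_eq, inv_smul_smul]
      exact memU.2 ⟨0, by rwa [zero_mul, torusShift_zero_smul]⟩)
  set z := hpt ((x₁ + x₂) / 2) ((x₂ - x₁) / 4) (by linarith) with hz
  have hzU : z ∈ U := by
    have : (g : GL (Fin 2) ℝ) • z ∈ A g := hg.symm.subset (Set.mem_univ _)
    simpa only [hA, Set.mem_ofPred_eq, inv_smul_smul] using this
  obtain ⟨m, hm⟩ := memU.1 hzU
  obtain ⟨h1, h2⟩ := hre hm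
  simp only [hz, hpt_re] at h1 h2
  have hm0 : m = 0 := by
    have hk0' : (k : ℝ) < 0 := by exact_mod_cast hk0
    by_contra hne
    rcases lt_or_gt_of_ne hne with hlt | hgt
    · have : (m : ℝ) ≤ -1 := by exact_mod_cast (by omega : m ≤ -1)
      nlinarith
    · have : (1 : ℝ) ≤ m := by exact_mod_cast hgt
      nlinarith
  rw [hm0, zero_mul, torusShift_zero_smul] at hm
  obtain ⟨-, -, h3, -⟩ := (mem_idealQuadrilateral h₁₂ h₂₃).1 hm
  simp only [hz, hpt_re, hpt_im] at h3
  nlinarith [pow_pos (sub_pos.2 h₁₂) 2]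

end IsFundamentalQuad

/-! ### Opposite sides paired -/

lemma mapGL_smul_infty_eq_div {γ : SL(2, ℤ)} {x : ℝ}
    (h : mapGL ℝ γ • (OnePoint.infty : OnePoint ℝ) = x) :
    γ 1 0 ≠ 0 ∧ x = (γ 0 0 : ℝ) / (γ 1 0 : ℝ) := by
  rw [OnePoint.smul_infty_eq_ite] at h
  simp only [mapGL_apply_real] at h
  split_ifs at h with h0
  · exact absurd h (OnePoint.infty_ne_coe _)
  · exact ⟨by exact_mod_cast h0, (OnePoint.coe_injective h).symm⟩

lemma mapGL_smul_div {γ : SL(2, ℤ)} {p q : ℤ} {x y : ℝ} (hq : q ≠ 0) (hx : x = (p : ℝ) / q)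
    (h : mapGL ℝ γ • (x : OnePoint ℝ) = y) :
    γ 1 0 * p + γ 1 1 * q ≠ 0 ∧
      y = ((γ 0 0 * p + γ 0 1 * q : ℤ) : ℝ) / ((γ 1 0 * p + γ 1 1 * q : ℤ) : ℝ) := by
  have hq' : (q : ℝ) ≠ 0 := by exact_mod_cast hq
  rw [OnePoint.smul_some_eq_ite] at h
  simp only [mapGL_apply_real] at h
  have e : ∀ a b : ℝ, a * x + b = (a * p + b * q) / q := by
    intro a b; rw [hx]; field_simp
  rw [e, e] at h
  split_ifs at h with h0
  · exact absurd h (OnePoint.infty_ne_coe _)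
  · rw [div_eq_zero_iff, or_iff_left hq'] at h0
    refine ⟨by exact_mod_cast h0, ?_⟩
    rw [← OnePoint.coe_injective h, div_div_div_cancel_right₀ hq']
    push_cast; rfl

lemma eq_neg_of_primitive {p q p' q' : ℤ} (h : IsCoprime p q) (h' : IsCoprime p' q')
    (he : p * q' = p' * q) (hq : 0 < q) (hq' : q' < 0) : p' = -p ∧ q' = -q := by
  have d1 : q ∣ q' := h.symm.dvd_of_dvd_mul_left ⟨p', by linarith⟩
  have d2 : q' ∣ q := h'.symm.dvd_of_dvd_mul_left ⟨p, by linarith⟩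
  have e : q' = -q := by
    have := Int.natAbs_eq_of_dvd_dvd d1 d2
    omega
  refine ⟨?_, e⟩
  rw [e] at he
  exact mul_right_cancel₀ hq.ne' (by linarith)

lemma exists_mapGL_pos {g : GL (Fin 2) ℝ} (hg : g ∈ torusGL) {x : ℝ}
    (h : g • (OnePoint.infty : OnePoint ℝ) = x) : ∃ γ : SL(2, ℤ), TorusCongruence γ ∧
      0 < γ 1 0 ∧ ∀ a : OnePoint ℝ, mapGL ℝ γ • a = g • a := by
  obtain ⟨γ, hγ, rfl⟩ := hg
  have h0 := (mapGL_smul_infty_eq_div h).1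
  rcases lt_or_gt_of_ne h0 with hlt | hgt
  · refine ⟨-γ, (torusCongruence_neg γ).2 hγ, by simpa using hlt, fun a ↦ ?_⟩
    have : mapGL ℝ (-γ) = -mapGL ℝ γ := by
      ext i j; rw [mapGL_apply_real]; simp
    rw [this, neg_smul_onePoint]
  · exact ⟨γ, hγ, hgt, fun _ ↦ rfl⟩

/-- A matrix that fixes `∞` and has negative eigenvalues is a translation by a multiple of `6`. -/
lemma TorusCongruence.dvd_of_eq_neg_one {δ : SL(2, ℤ)} (h : TorusCongruence δ)
    (h00 : δ 0 0 = -1) (h11 : δ 1 1 = -1) : 6 ∣ δ 0 1 := by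
  obtain ⟨h2, h3⟩ := torusCongruence_iff_dvd.1 h
  rw [h00, h11] at h2 h3
  have := (h2.resolve_left (by norm_num)).1
  have := (h3.resolve_left (by norm_num)).1
  omega

theorem isRationalMarkovTriple_of_opposite {x₁ x₂ x₃ : ℝ} (h₁₂ : x₁ < x₂) (h₂₃ : x₂ < x₃)
    {g k : GL (Fin 2) ℝ} (hg : g ∈ torusGL) (hk : k ∈ torusGL)
    (hg3 : g • (OnePoint.infty : OnePoint ℝ) = x₃) (hg2 : g • (x₁ : OnePoint ℝ) = x₂)
    (hk1 : k • (OnePoint.infty : OnePoint ℝ) = x₁) (hk2 : k • (x₃ : OnePoint ℝ) = x₂) :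
    IsRationalMarkovTriple x₁ x₂ x₃ := by
  obtain ⟨γ, hγ, hq3, hγg⟩ := exists_mapGL_pos hg hg3
  obtain ⟨κ, hκ, hq1, hκk⟩ := exists_mapGL_pos hk hk1
  rw [← hγg] at hg3 hg2
  rw [← hκk] at hk1 hk2
  have e3 := (mapGL_smul_infty_eq_div hg3).2
  have e1 := (mapGL_smul_infty_eq_div hk1).2
  obtain ⟨hq2, e2⟩ := mapGL_smul_div hq1.ne' e1 hg2
  obtain ⟨hq2', e2'⟩ := mapGL_smul_div hq3.ne' e3 hk2
  have dγ := det_eq_one_int γ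
  have dκ := det_eq_one_int κ
  have hδ : TorusCongruence ((γ * κ)⁻¹ * (κ * γ)) :=
    torusGroupPM.mul_mem (torusGroupPM.inv_mem (torusGroupPM.mul_mem hγ hκ))
      (torusGroupPM.mul_mem hκ hγ)
  have hδe : ∀ i j, ((γ * κ)⁻¹ * (κ * γ)) i j =
      (!![(γ * κ) 1 1, -(γ * κ) 0 1; -(γ * κ) 1 0, (γ * κ) 0 0] : Matrix _ _ ℤ) i 0 *
        (κ * γ) 0 j +
      (!![(γ * κ) 1 1, -(γ * κ) 0 1; -(γ * κ) 1 0, (γ * κ) 0 0] : Matrix _ _ ℤ) i 1 *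
        (κ * γ) 1 j := by
    intro i j; rw [sl2_mul_apply, SL2_inv_expl]; rfl
  have d00 := hδe 0 0
  have d01 := hδe 0 1
  have d11 := hδe 1 1
  have h6 := hδ.dvd_of_eq_neg_one
  generalize ((γ * κ)⁻¹ * (κ * γ)) 0 0 = δ00 at *
  generalize ((γ * κ)⁻¹ * (κ * γ)) 0 1 = δ01 at *
  generalize ((γ * κ)⁻¹ * (κ * γ)) 1 1 = δ11 at *
  clear hδe hδ hg3 hg2 hk1 hk2 hγg hκk
  simp only [sl2_mul_apply, Matrix.of_apply, Matrix.cons_val', Matrix.cons_val_zero,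
    Matrix.cons_val_one, Matrix.cons_val_fin_one] at d00 d01 d11
  generalize γ 0 0 = p₃ at *
  generalize γ 1 0 = q₃ at *
  generalize γ 0 1 = b at *
  generalize γ 1 1 = d at *
  generalize κ 0 0 = p₁ at *
  generalize κ 1 0 = q₁ at *
  generalize κ 0 1 = b' at *
  generalize κ 1 1 = d' at *
  obtain ⟨p₂, hp₂⟩ : ∃ p₂, p₂ = p₃ * p₁ + b * q₁ := ⟨_, rfl⟩
  obtain ⟨q₂, hq₂⟩ : ∃ q₂, q₂ = q₃ * p₁ + d * q₁ := ⟨_, rfl⟩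
  have f1 : (0 : ℝ) < q₁ := by exact_mod_cast hq1
  have f3 : (0 : ℝ) < q₃ := by exact_mod_cast hq3
  rw [← hq₂] at hq2 e2
  rw [← hp₂] at e2
  have det₂₃ : p₃ * q₂ - p₂ * q₃ = q₁ := by rw [hp₂, hq₂]; linear_combination q₁ * dγ
  have hq2pos : 0 < q₂ := by
    have f2 : (q₂ : ℝ) ≠ 0 := by exact_mod_cast hq2
    have hr : (p₃ * q₂ - p₂ * q₃ : ℝ) = q₁ := by exact_mod_cast det₂₃
    have : x₃ - x₂ = q₁ / (q₃ * q₂) := by rw [e2, e3, ← hr]; field_simp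
    have hpos : 0 < (q₁ : ℝ) / (q₃ * q₂) := by linarith
    rw [div_pos_iff_of_pos_left f1, mul_pos_iff_of_pos_left f3] at hpos
    exact_mod_cast hpos
  have f2 : (0 : ℝ) < q₂ := by exact_mod_cast hq2pos
  have hq2neg : q₁ * p₃ + d' * q₃ < 0 := by
    have f2' : ((q₁ * p₃ + d' * q₃ : ℤ) : ℝ) ≠ 0 := by exact_mod_cast hq2'
    have hr : ((p₁ * p₃ + b' * q₃ : ℤ) * q₁ - p₁ * (q₁ * p₃ + d' * q₃ : ℤ) : ℝ) = -q₃ := by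
      exact_mod_cast (by linear_combination -q₃ * dκ :
        (p₁ * p₃ + b' * q₃) * q₁ - p₁ * (q₁ * p₃ + d' * q₃) = -q₃)
    have : x₂ - x₁ = -(q₃ / (q₁ * (q₁ * p₃ + d' * q₃ : ℤ))) := by
      rw [e2', e1, ← neg_div, ← hr]; field_simp
    have hpos : (q₃ : ℝ) / (q₁ * (q₁ * p₃ + d' * q₃ : ℤ)) < 0 := by linarith
    by_contra! hc
    have hc' : (0 : ℝ) ≤ (q₁ * p₃ + d' * q₃ : ℤ) := by exact_mod_cast hc
    exact absurd hpos (not_lt.2 (by positivity))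
  obtain ⟨hp₂', hq₂'⟩ : p₁ * p₃ + b' * q₃ = -p₂ ∧ q₁ * p₃ + d' * q₃ = -q₂ := by
    refine eq_neg_of_primitive ?_ ?_ ?_ hq2pos hq2neg
    · exact ⟨d' * d + b' * q₃, -(d' * b) - b' * p₃, by rw [hp₂, hq₂]; linear_combination (d' * p₁ - b' * q₁) * dγ + dκ⟩
    · exact ⟨d * d' + b * q₁, -(d * b') - b * p₁, by linear_combination dγ + (p₃ * d - b * q₃) * dκ⟩
    · have f2' : ((q₁ * p₃ + d' * q₃ : ℤ) : ℝ) ≠ 0 := by exact_mod_cast hq2'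
      rw [e2, div_eq_div_iff f2.ne' f2'] at e2'
      exact_mod_cast e2'
  have det₁₂ : p₂ * q₁ - p₁ * q₂ = q₃ := by
    linear_combination q₃ * dκ + q₁ * hp₂' - p₁ * hq₂'
  have hδ00 : δ00 = -1 := by
    rw [d00]
    linear_combination (q₃ * b' + d * d') * hp₂' - (p₃ * b' + b * d') * hq₂' -
      (q₃ * b' + d * d') * hp₂ + (p₃ * b' + b * d') * hq₂ - (p₁ * d' - b' * q₁) * dγ - dκ
  have hδ11 : -(q₃ * p₁ + d * q₁) * (p₁ * b + b' * d) + (p₃ * p₁ + b * q₁) * (q₁ * b + d' * d) =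
      -1 := by
    linear_combination -(q₁ * b + d' * d) * hp₂ + (p₁ * b + b' * d) * hq₂ +
      (q₁ * b + d' * d) * hp₂' - (p₁ * b + b' * d) * hq₂' - (p₃ * d - b * q₃) * dκ - dγ
  obtain ⟨l, hl⟩ := h6 hδ00 (d11.trans hδ11)
  have hA : δ01 * q₂ = (q₁ * b + d' * d) + (q₃ * b' + d * d') := by
    rw [d01, hq₂]
    linear_combination -(q₃ * b' + d * d') * hδ11 +
      (q₁ * b + d' * d) * ((p₁ * d' - b' * q₁) * dγ + dκ)
  have hB : ((q₁ * b + d' * d) + (q₃ * b' + d * d')) * (q₁ * q₃) =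
      -2 * q₂ ^ 2 - 2 * (q₂ * (q₁ * p₃ - q₃ * p₁)) := by
    linear_combination -(q₁ * q₃) * hp₂ + q₁ * q₃ * hp₂' - 2 * (d' * q₃) * hq₂ +
      2 * (q₂ - q₃ * p₁) * hq₂'
  have hsum : q₁ ^ 2 + q₂ ^ 2 + q₃ ^ 2 = 3 * (-l) * (q₁ * q₂ * q₃) := by
    have : δ01 * q₂ * (q₁ * q₃) = -2 * (q₁ ^ 2 + q₂ ^ 2 + q₃ ^ 2) := by
      rw [hA, hB]; linear_combination -2 * q₁ * det₂₃ - 2 * q₃ * det₁₂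
    rw [hl] at this
    linarith
  have hprod : 0 < q₁ * q₂ * q₃ := by positivity
  have hl1 : -l = 1 := by
    have hpos : 0 < -l := by
      by_contra! hc
      nlinarith [pow_pos hq1 2, sq_nonneg q₂, sq_nonneg q₃, mul_nonneg (neg_nonneg.2 hc) hprod.le]
    by_contra hne
    exact hurwitz (k := -l) (by omega) _ q₁ q₂ q₃ hq1 hq2pos hq3 hsum le_rfl
  rw [hl1] at hsum
  exact ⟨p₁, p₂, p₃, q₁, q₂, q₃, ⟨hq1, hq2pos, hq3, by linarith⟩, det₁₂, det₂₃, e1, e2, e3⟩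

namespace IsFundamentalQuad

variable {x₁ x₂ x₃ : ℝ}

theorem isRationalMarkovTriple (h : IsFundamentalQuad x₁ x₂ x₃) :
    IsRationalMarkovTriple x₁ x₂ x₃ := by
  obtain ⟨g, j, hg⟩ := h.exists_isSidePairing_zero
  obtain ⟨f, l, hf⟩ := h.exists_isSidePairing_three
  have all : (∃ k j, IsSidePairing x₁ x₂ x₃ k 1 j) → (∃ k j, IsSidePairing x₁ x₂ x₃ k 2 j) →
      ∀ i, ∃ k j, IsSidePairing x₁ x₂ x₃ k i j := by
    intro h1 h2 i
    fin_cases i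
    · exact ⟨g, j, hg⟩
    · exact h1
    · exact h2
    · exact ⟨f, l, hf⟩
  have uniq : ∀ {k k' : GL (Fin 2) ℝ} {i a b : Fin 4}, IsSidePairing x₁ x₂ x₃ k i a →
      IsSidePairing x₁ x₂ x₃ k' i b → a ≠ b → False := fun h1 h2 hne ↦
    hne (h.isSidePairing_unique h1 h2)
  fin_cases j
  · exact (h.isSidePairing_irrefl hg).elim
  · fin_cases l
    · exact (uniq hf.inv hg (by decide)).elim
    · exact (uniq hf.inv hg.inv (by decide)).elim
    · exact (h.false_of_adjacent (all ⟨_, _, hg.inv⟩ ⟨_, _, hf.inv⟩) hg.1 hf.1 (a := 1) (b := 3)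
        (c := 2) (d := 0) (by decide) (by decide) hg.2.1 hf.2.2 hg.2.2 hf.2.1).elim
    · exact (h.isSidePairing_irrefl hf).elim
  · fin_cases l
    · exact (uniq hf.inv hg (by decide)).elim
    · have hg' := hg.inv
      exact isRationalMarkovTriple_of_opposite h.lt₁₂ h.lt₂₃ hg'.1 hf.inv.1
        hg'.2.1 hg'.2.2 hf.inv.2.2 hf.inv.2.1
    · exact (uniq hf.inv hg.inv (by decide)).elim
    · exact (h.isSidePairing_irrefl hf).elim
  · obtain ⟨k, hk⟩ : ∃ k, IsSidePairing x₁ x₂ x₃ k 1 2 := by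
      obtain ⟨k, i, j, hk, rfl | rfl⟩ := h.exists_isSidePairing_one hg
      · fin_cases j
        · exact (uniq hk.inv hg (by decide)).elim
        · exact (h.isSidePairing_irrefl hk).elim
        · exact ⟨k, hk⟩
        · exact (uniq hk.inv hg.inv (by decide)).elim
      · fin_cases j
        · exact (uniq hk.inv hg (by decide)).elim
        · exact ⟨_, hk.inv⟩
        · exact (h.isSidePairing_irrefl hk).elim
        · exact (uniq hk.inv hg.inv (by decide)).elim
    exact (h.false_of_adjacent (all ⟨_, _, hk⟩ ⟨_, _, hk.inv⟩) hg.1 hk.1 (a := 0) (b := 2)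
      (c := 3) (d := 1) (by decide) (by decide) hg.2.2 hk.2.1 hg.2.1 hk.2.2).elim

end IsFundamentalQuad

theorem lemma4p2 (x₁ x₂ x₃ : ℝ) (h₁₂ : x₁ < x₂) (h₂₃ : x₂ < x₃) :
    List.TFAE [
      IsRationalMarkovTriple x₁ x₂ x₃,
      IsTorusFundamentalDomain (idealQuadrilateral x₁ x₂ x₃ OnePoint.infty),
      ∃ T : TorusIdealTriangulation,
        torusProj '' interior (idealTriangle x₁ x₂ OnePoint.infty) ≠
          torusProj '' interior (idealTriangle x₂ x₃ OnePoint.infty) ∧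
        T.triangles =
          {torusProj '' interior (idealTriangle x₁ x₂ OnePoint.infty),
           torusProj '' interior (idealTriangle x₂ x₃ OnePoint.infty)}] := by
  tfae_have 1 → 3 := by
    rintro ⟨p₁, p₂, p₃, q₁, q₂, q₃, ⟨hq₁, hq₂, hq₃, hm⟩, d₁₂, d₂₃, e₁, e₂, e₃⟩
    exact exists_triangulation_of_isMarkovData ⟨hq₁, hq₂, hq₃, hm, d₁₂, d₂₃⟩ e₁ e₂ e₃
  tfae_have 3 → 2 := by
    rintro ⟨T, hne, hT⟩
    exact T.isTorusFundamentalDomain h₁₂ h₂₃ hne hT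
  tfae_have 2 → 1 := fun h ↦ IsFundamentalQuad.isRationalMarkovTriple ⟨h₁₂, h₂₃, h⟩
  tfae_finish
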